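/- Let $(\mathcal N_k)_{k\ge 1}$ be i.i.d. complex Gaussian random variables with $\mathbb E[\mathcal N_k]=\mathbb E[\mathcal N_k^2]=0$ and $\mathbb E[|\mathcal N_k|^2]=1$, and for $|z|<1$ let $G^{\mathbb C}(z)=\sum_{k\ge 1}\frac{z^k}{\sqrt k}\mathcal N_k$ (the series converges almost surely on the whole open unit disc). For $n\ge 0$, let $c_n$ be the $n$-th Fourier coefficient of the holomorphic multiplicative chaos of (critical) parameter $\theta=1$, that is, $$c_n=\lim_{r\to 1^-}\frac1{2\pi}\int_0^{2\pi}e^{G^{\mathbb C}(re^{i\vartheta})}\,\overline{(re^{i\vartheta})^n}\,d\vartheta ,$$ where the limit exists almost surely; equivalently, $c_n$ is the coefficient of $z^n$ in the power series expansion of $e^{G^{\mathbb C}(z)}$ at $z=0$. Then, uniformly in $y\ge 2$ and $n\ge 1$, $$\mathbb P\left((\log n)^{1/4}|c_n|\ge y\right)=\mathcal O\left(\frac{\min(\sqrt{\log n},\log y)}{y^2}\right),$$ that is, there is an absolute constant $C$ such that for all real $y\ge 2$ and all integers $n\ge 1$ the left-hand side is at most $C\min(\sqrt{\log n},\log y)/y^2$.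 -/

import Mathlib

open MeasureTheory ProbabilityTheory

/-- `Z` is a standard complex Gaussian variable under `μ`: it is (jointly, as a vector of `ℂ ≃ ℝ²`)
Gaussian, with `E[Z] = E[Z²] = 0` and `E[|Z|²] = 1`. -/
structure IsStdComplexGaussian {Ω : Type*} [MeasurableSpace Ω] (Z : Ω → ℂ) (μ : Measure Ω) :
    Prop where
  gaussian : HasGaussianLaw Z μ
  mean : ∫ ω, Z ω ∂μ = 0
  sq_mean : ∫ ω, Z ω ^ 2 ∂μ = 0
  normSq_mean : ∫ ω, ‖Z ω‖ ^ 2 ∂μ = 1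

/-- The holomorphic function `G(z) = ∑_{k ≥ 1} z^k / √k * a_k` on the open unit disc, for a
coefficient sequence `a` (a realization of the Gaussian variables). When the `a_k` are
realizations of i.i.d. standard complex Gaussians, the series almost surely converges absolutely
at every point of the open unit disc. -/
noncomputable def gaussianSeries (a : ℕ+ → ℂ) (z : ℂ) : ℂ :=
  ∑' k : ℕ+, z ^ (k : ℕ) / (Real.sqrt ((k : ℕ) : ℝ) : ℂ) * a k

/-- The action of the holomorphic multiplicative chaos of parameter `θ` on (the extension to
`ℂ \ {0}` as a Laurent polynomial `φ` of) a trigonometric polynomial: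
`lim_{r → 1⁻} (1 / 2π) ∫_0^{2π} exp(√θ G(r e^{iϑ})) * conj (φ(r e^{iϑ})) dϑ`.
Almost surely, this limit exists for every Laurent polynomial `φ`. -/
noncomputable def hmc (θ : ℝ) (a : ℕ+ → ℂ) (φ : ℂ → ℂ) : ℂ :=
  Filter.limUnder (nhdsWithin (1 : ℝ) (Set.Iio 1)) fun r : ℝ =>
    (1 / (2 * Real.pi) : ℂ) * ∫ t in (0 : ℝ)..(2 * Real.pi),
      Complex.exp ((Real.sqrt θ : ℂ) * gaussianSeries a (r * Complex.exp (Complex.I * t))) *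
        (starRingEnd ℂ) (φ (r * Complex.exp (Complex.I * t)))

/-- The `n`-th Fourier coefficient of the holomorphic multiplicative chaos of parameter `θ`:
its action on `e^{iϑ} ↦ e^{inϑ}`, which extends as `z ↦ z^n`. -/
noncomputable def hmcCoeff (θ : ℝ) (a : ℕ+ → ℂ) (n : ℕ) : ℂ :=
  hmc θ a fun z => z ^ n

section Independence

variable {Ω ι β γ δ : Type*} {mΩ : MeasurableSpace Ω} {μ : Measure Ω} [MeasurableSpace β]
  [MeasurableSpace γ] [MeasurableSpace δ]

/-- Measurable functions of the coordinates of an independent family that depend on disjoint finite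
sets of coordinates are independent. -/
theorem indepFun_of_dependsOn [Nonempty β] {X : ι → Ω → β} (hX : iIndepFun X μ)
    (hm : ∀ i, Measurable (X i)) {s t : Finset ι} (hst : Disjoint s t)
    {f : (ι → β) → γ} {g : (ι → β) → δ} (hf : Measurable f) (hg : Measurable g)
    (hfs : DependsOn f s) (hgt : DependsOn g t) :
    IndepFun (fun ω => f fun i => X i ω) (fun ω => g fun i => X i ω) μ := by
  classical
  obtain ⟨b⟩ := ‹Nonempty β›
  have ext_meas : ∀ u : Finset ι, Measurable fun (y : u → β) (i : ι) =>
      if h : i ∈ u then y ⟨i, h⟩ else b := by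
    intro u
    refine measurable_pi_lambda _ fun i => ?_
    by_cases h : i ∈ u
    · simpa [h] using measurable_pi_apply (⟨i, h⟩ : u)
    · simp [h]
  have key := (hX.indepFun_finset s t hst hm).comp (hf.comp (ext_meas s)) (hg.comp (ext_meas t))
  convert key using 1
  · ext ω
    exact hfs fun i hi => by simp [Finset.mem_coe.1 hi]
  · ext ω
    exact hgt fun i hi => by simp [Finset.mem_coe.1 hi]

theorem map_sum_gaussianReal {X : ι → Ω → ℝ} (hX : iIndepFun X μ) (hm : ∀ i, Measurable (X i))
    {v : ι → NNReal} (hlaw : ∀ i, μ.map (X i) = gaussianReal 0 (v i)) (s : Finset ι) :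
    μ.map (fun ω => ∑ i ∈ s, X i ω) = gaussianReal 0 (∑ i ∈ s, v i) := by
  classical
  have := hX.isProbabilityMeasure
  induction s using Finset.induction_on with
  | empty => simp [Measure.map_const]
  | insert a s ha ih =>
    have h := gaussianReal_add_gaussianReal_of_indepFun
      (hX.indepFun_finsetSum_of_notMem hm ha).symm (hlaw a) (by simpa [Finset.sum_fn] using ih)
    simp only [add_zero] at h
    rw [Finset.sum_insert ha, ← h]
    congr 1
    ext ω
    simp [Finset.sum_insert ha]

end Independence

section GaussianTail

theorem gaussianReal_real_Ioi_zero_le (v : NNReal) :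
    (gaussianReal 0 v).real (Set.Ioi 0) ≤ 1 / 2 := by
  have h1 : (gaussianReal 0 v).real (Set.Ioi 0) = (gaussianReal 0 v).real (Set.Iio 0) := by
    have h := gaussianReal_map_neg (μ := 0) (v := v)
    rw [neg_zero] at h
    conv_lhs => rw [← h]
    rw [measureReal_def, measureReal_def, Measure.map_apply measurable_neg measurableSet_Ioi]
    simp
  have h2 : (gaussianReal 0 v).real (Set.Ioi 0) + (gaussianReal 0 v).real (Set.Iio 0) ≤ 1 := by
    rw [← measureReal_union _ measurableSet_Iio]
    · exact measureReal_le_one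
    · exact Set.disjoint_left.2 fun x hx hx' => lt_asymm (Set.mem_Ioi.1 hx) hx'
  linarith

theorem gaussianReal_real_Ici_neg_le {v : NNReal} (hv : v ≠ 0) {x : ℝ} (hx : 0 ≤ x) :
    (gaussianReal 0 v).real (Set.Ici (-x)) ≤ 1 / 2 + x / √v := by
  have hsub : Set.Ici (-x) ⊆ Set.Ioi 0 ∪ Set.Icc (-x) 0 := by
    intro t ht
    rcases lt_or_ge 0 t with h | h
    · exact Or.inl h
    · exact Or.inr ⟨ht, h⟩
  have hv' : (0 : ℝ) < v := by positivity
  have hI : (gaussianReal 0 v).real (Set.Icc (-x) 0) ≤ x / √v := by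
    rw [measureReal_def, gaussianReal_apply_eq_integral 0 hv,
      ENNReal.toReal_ofReal (integral_nonneg fun t => gaussianPDFReal_nonneg _ _ _)]
    have hb : ∀ t ∈ Set.Icc (-x) 0, ‖gaussianPDFReal 0 v t‖ ≤ 1 / √v := by
      intro t _
      rw [Real.norm_of_nonneg (gaussianPDFReal_nonneg _ _ _), gaussianPDFReal_def]
      have h1 : Real.exp (-(t - 0) ^ 2 / (2 * v)) ≤ 1 := by
        apply Real.exp_le_one_iff.2
        apply div_nonpos_of_nonpos_of_nonneg
        · nlinarith [sq_nonneg t]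
        · positivity
      have h2 : (√(2 * Real.pi * v))⁻¹ ≤ 1 / √v := by
        rw [one_div]
        apply inv_anti₀ (by positivity)
        apply Real.sqrt_le_sqrt
        nlinarith [Real.pi_gt_three]
      calc (√(2 * Real.pi * v))⁻¹ * Real.exp (-(t - 0) ^ 2 / (2 * v))
          ≤ (√(2 * Real.pi * v))⁻¹ * 1 := by gcongr
        _ ≤ 1 / √v := by simpa using h2
    have := norm_setIntegral_le_of_norm_le_const (μ := volume) (s := Set.Icc (-x) 0) (by simp) hb
    refine (le_abs_self _).trans (this.trans (le_of_eq ?_))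
    simp [hx]
    ring
  calc (gaussianReal 0 v).real (Set.Ici (-x))
      ≤ (gaussianReal 0 v).real (Set.Ioi 0 ∪ Set.Icc (-x) 0) := measureReal_mono hsub
    _ ≤ _ := measureReal_union_le _ _
    _ ≤ _ := add_le_add (gaussianReal_real_Ioi_zero_le v) hI

end GaussianTail

section Independence

variable {Ω ι β : Type*} {mΩ : MeasurableSpace Ω} {μ : Measure Ω} [MeasurableSpace β]

theorem setIntegral_of_dependsOn [Nonempty β] {X : ι → Ω → β} (hX : iIndepFun X μ)
    (hm : ∀ i, Measurable (X i)) {s t : Finset ι} (hst : Disjoint s t)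
    {E : Set (ι → β)} {f : (ι → β) → ℝ} (hE : MeasurableSet E) (hf : Measurable f)
    (hEs : DependsOn (· ∈ E) (s : Set ι)) (hft : DependsOn f t) :
    ∫ ω in {ω | (fun i => X i ω) ∈ E}, f (fun i => X i ω) ∂μ =
      μ.real {ω | (fun i => X i ω) ∈ E} * ∫ ω, f (fun i => X i ω) ∂μ := by
  have hmX : Measurable fun ω => fun i => X i ω := measurable_pi_lambda _ hm
  have hE' : MeasurableSet {ω | (fun i => X i ω) ∈ E} := hmX hE
  have hind : DependsOn (E.indicator (1 : (ι → β) → ℝ)) s := by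
    intro x y hxy
    have := hEs hxy
    simp only [eq_iff_iff] at this
    by_cases h : y ∈ E
    · simp [h, this.2 h]
    · simp [h, mt this.1 h]
  have hmi : Measurable (E.indicator (1 : (ι → β) → ℝ)) := measurable_one.indicator hE
  have h := (indepFun_of_dependsOn hX hm hst hmi hf hind hft).integral_fun_mul_eq_mul_integral
    (hmi.comp hmX).aestronglyMeasurable (hf.comp hmX).aestronglyMeasurable
  rw [← integral_indicator hE', ← integral_indicator_one hE']
  refine Eq.trans (integral_congr_ae (.of_forall fun ω => ?_)) h
  by_cases hω : (fun i => X i ω) ∈ E <;> simp [Set.indicator, hω]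

theorem measureReal_inter_of_dependsOn [Nonempty β] {X : ι → Ω → β} (hX : iIndepFun X μ)
    (hm : ∀ i, Measurable (X i)) {s t : Finset ι} (hst : Disjoint s t)
    {E F : Set (ι → β)} (hE : MeasurableSet E) (hF : MeasurableSet F)
    (hEs : DependsOn (· ∈ E) (s : Set ι)) (hFt : DependsOn (· ∈ F) (t : Set ι)) :
    μ.real {ω | (fun i => X i ω) ∈ E ∩ F} =
      μ.real {ω | (fun i => X i ω) ∈ E} * μ.real {ω | (fun i => X i ω) ∈ F} := by
  have hmX : Measurable fun ω => fun i => X i ω := measurable_pi_lambda _ hm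
  have h := setIntegral_of_dependsOn hX hm hst (f := F.indicator 1) hE (measurable_one.indicator hF)
    hEs (by
      intro x y hxy
      have := hFt hxy
      simp only [eq_iff_iff] at this
      by_cases h : y ∈ F
      · simp [h, this.2 h]
      · simp [h, mt this.1 h])
  have hF' : MeasurableSet {ω | (fun i => X i ω) ∈ F} := hmX hF
  have h2 : ∀ ω, F.indicator (1 : (ι → β) → ℝ) (fun i => X i ω) =
      ({ω | (fun i => X i ω) ∈ F}).indicator 1 ω := fun ω => rfl
  simp only [h2] at h
  rw [integral_indicator_one hF', integral_indicator_one hF', measureReal_restrict_apply hF'] at h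
  rw [← h, Set.inter_comm]
  rfl

end Independence

section Ballot

/-- The paths of a walk with increments `x` that stay below the barrier `L + log (j + 1)` up to
time `T`. -/
def belowBarrier (L : ℝ) (T : ℕ) : Set (ℕ → ℝ) :=
  {x | ∀ j ≤ T, ∑ l ∈ Finset.range j, x l ≤ L + Real.log (j + 1)}

theorem measurableSet_belowBarrier (L : ℝ) (T : ℕ) : MeasurableSet (belowBarrier L T) := by
  have : belowBarrier L T = ⋂ j : ℕ, ⋂ _ : j ≤ T,
      {x | ∑ l ∈ Finset.range j, x l ≤ L + Real.log (j + 1)} := by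
    ext x; simp [belowBarrier]
  rw [this]
  refine MeasurableSet.iInter fun j => MeasurableSet.iInter fun _ => ?_
  exact measurableSet_le (Finset.measurable_sum _ fun l _ => measurable_pi_apply l)
    measurable_const

theorem dependsOn_belowBarrier (L : ℝ) (T : ℕ) :
    DependsOn (· ∈ belowBarrier L T) (Finset.range T : Set ℕ) := by
  intro x y h
  simp only [belowBarrier, Set.mem_ofPred_eq, eq_iff_iff]
  refine forall_congr' fun j => forall_congr' fun hj => ?_
  rw [Finset.sum_congr rfl fun l hl => h l ?_]
  simp only [Finset.coe_range, Set.mem_Iio]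
  exact (Finset.mem_range.1 hl).trans_le hj

theorem belowBarrier_anti (L : ℝ) {S T : ℕ} (h : S ≤ T) :
    belowBarrier L T ⊆ belowBarrier L S := fun _ hx j hj => hx j (hj.trans h)

variable {Ω : Type*} {mΩ : MeasurableSpace Ω} {μ : Measure Ω} {X : ℕ → Ω → ℝ}

/-- The event that the walk with increments `X` stays below the barrier up to time `T`. -/
def aliveSet (X : ℕ → Ω → ℝ) (L : ℝ) (T : ℕ) : Set Ω := {ω | (fun i => X i ω) ∈ belowBarrier L T}

/-- The mean distance to the raised barrier `L + 2 log (T + 1)` on the survival event. -/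
noncomputable def aliveDist (μ : Measure Ω) (X : ℕ → Ω → ℝ) (L : ℝ) (T : ℕ) : ℝ :=
  ∫ ω in aliveSet X L T, (L + 2 * Real.log (T + 1) - ∑ l ∈ Finset.range T, X l ω) ∂μ

theorem measurableSet_aliveSet (hm : ∀ i, Measurable (X i)) (L : ℝ) (T : ℕ) :
    MeasurableSet (aliveSet X L T) :=
  (measurable_pi_lambda _ hm : Measurable fun ω => fun i => X i ω)
    (measurableSet_belowBarrier L T)

theorem integrable_of_map_gaussianReal {Y : Ω → ℝ} (hm : Measurable Y) {v : NNReal}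
    (h : μ.map Y = gaussianReal 0 v) : Integrable Y μ := by
  have h1 : Integrable id (μ.map Y) := by
    rw [h]; exact (memLp_id_gaussianReal 1).integrable (by simp)
  exact h1.comp_measurable hm

theorem integral_of_map_gaussianReal {Y : Ω → ℝ} (hm : Measurable Y) {v : NNReal}
    (h : μ.map Y = gaussianReal 0 v) : ∫ ω, Y ω ∂μ = 0 := by
  have h1 : ∫ y, y ∂(μ.map Y) = ∫ ω, Y ω ∂μ :=
    integral_map hm.aemeasurable measurable_id.aestronglyMeasurable
  rw [← h1, h, integral_id_gaussianReal]

theorem integrable_exp_of_map_gaussianReal {Y : Ω → ℝ} (hm : Measurable Y) {v : NNReal}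
    (h : μ.map Y = gaussianReal 0 v) (t : ℝ) : Integrable (fun ω => Real.exp (t * Y ω)) μ := by
  have h1 := integrable_exp_mul_gaussianReal (μ := 0) (v := v) t
  rw [← h] at h1
  exact h1.comp_measurable hm

theorem integral_exp_of_map_gaussianReal {Y : Ω → ℝ} {v : NNReal}
    (h : μ.map Y = gaussianReal 0 v) (t : ℝ) :
    ∫ ω, Real.exp (t * Y ω) ∂μ = Real.exp (v * t ^ 2 / 2) := by
  have := mgf_gaussianReal h t
  simpa [mgf] using this

/-- One step of the walk changes the mean distance by at most a multiple of the survival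
probability. -/
theorem aliveDist_succ_le (hX : iIndepFun X μ) (hm : ∀ i, Measurable (X i)) {v : ℕ → NNReal}
    (hlaw : ∀ i, μ.map (X i) = gaussianReal 0 (v i)) {b : ℝ} (L : ℝ) (T : ℕ) (hb : v T ≤ b) :
    aliveDist μ X L (T + 1) ≤
      aliveDist μ X L T + (2 + Real.exp (2 * b)) * (μ.real (aliveSet X L T) / (T + 1)) := by
  have := hX.isProbabilityMeasure
  have hXi : ∀ i, Integrable (X i) μ := fun i => integrable_of_map_gaussianReal (hm i) (hlaw i)
  have hsum : ∀ S : ℕ, Integrable (fun ω => ∑ l ∈ Finset.range S, X l ω) μ := fun S =>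
    integrable_finsetSum _ fun l _ => hXi l
  have hexp := integrable_exp_of_map_gaussianReal (hm T) (hlaw T) 2
  have hT : (0 : ℝ) < T + 1 := by positivity
  set δ : ℝ := 2 * (Real.log (T + 2) - Real.log (T + 1)) with hδ
  have hδ1 : δ ≤ 2 / (T + 1) := by
    have h1 : Real.log (T + 2) - Real.log (T + 1) ≤ 1 / (T + 1) := by
      rw [← Real.log_div (by positivity) (by positivity)]
      refine (Real.log_le_sub_one_of_pos (by positivity)).trans (le_of_eq ?_)
      field_simp; ring
    calc δ ≤ 2 * (1 / (T + 1)) := by rw [hδ]; gcongr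
      _ = _ := by ring
  set f : Ω → ℝ := fun ω => (L + 2 * Real.log (T + 1) - ∑ l ∈ Finset.range T, X l ω) +
    (δ - X T ω + Real.exp (2 * X T ω) / (T + 2) ^ 2) with hf
  have hfint : Integrable f μ :=
    ((integrable_const _).sub (hsum T)).add (((integrable_const _).sub (hXi T)).add
      (hexp.div_const _))
  have hpt : ∀ ω, (aliveSet X L (T + 1)).indicator (fun ω => L + 2 * Real.log ((T + 1 : ℕ) + 1) -
      ∑ l ∈ Finset.range (T + 1), X l ω) ω ≤ (aliveSet X L T).indicator f ω := by
    intro ω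
    have hcast : Real.log (((T + 1 : ℕ) : ℝ) + 1) = Real.log (T + 2) := by
      push_cast; congr 1; ring
    by_cases h0 : ω ∈ aliveSet X L T
    · rw [Set.indicator_of_mem h0]
      by_cases h1 : ω ∈ aliveSet X L (T + 1)
      · rw [Set.indicator_of_mem h1, Finset.sum_range_succ, hcast]
        have : 0 ≤ Real.exp (2 * X T ω) / (T + 2) ^ 2 := by positivity
        simp only [hf, hδ]
        linarith
      · rw [Set.indicator_of_notMem h1]
        have hS : ∑ l ∈ Finset.range T, X l ω ≤ L + Real.log (T + 1) := h0 T le_rfl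
        have hmono : Real.log (T + 1) ≤ Real.log (T + 2) :=
          Real.log_le_log hT (by linarith)
        have hx : X T ω - Real.log (T + 2) ≤ Real.exp (2 * X T ω) / (T + 2) ^ 2 := by
          have e : Real.exp (2 * X T ω) / (T + 2) ^ 2 =
              Real.exp (2 * (X T ω - Real.log (T + 2))) := by
            have e2 : Real.exp (2 * Real.log (T + 2)) = ((T : ℝ) + 2) ^ 2 := by
              rw [← Real.log_rpow (by positivity), Real.exp_log (by positivity)]
              norm_num
            rw [mul_sub, Real.exp_sub, e2]
          rw [e]
          set u := X T ω - Real.log (T + 2)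
          have := Real.add_one_le_exp (2 * u)
          have h3 := Real.exp_pos (2 * u)
          rcases le_or_gt 0 u with h | h <;> linarith
        simp only [hf, hδ]
        linarith
    · have h1 : ω ∉ aliveSet X L (T + 1) := fun h => h0 (belowBarrier_anti L (Nat.le_succ T) h)
      rw [Set.indicator_of_notMem h0, Set.indicator_of_notMem h1]
  have hA := measurableSet_aliveSet hm L T
  have hA' := measurableSet_aliveSet hm L (T + 1)
  have hindep : ∫ ω in aliveSet X L T, (δ - X T ω + Real.exp (2 * X T ω) / (T + 2) ^ 2) ∂μ =
      μ.real (aliveSet X L T) * (δ + Real.exp (2 * v T) / (T + 2) ^ 2) := by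
    have h := setIntegral_of_dependsOn hX hm (s := Finset.range T) (t := {T}) (by simp)
      (f := fun x : ℕ → ℝ => δ - x T + Real.exp (2 * x T) / (T + 2) ^ 2)
      (measurableSet_belowBarrier L T)
      (by fun_prop)
      (dependsOn_belowBarrier L T) (by
        intro x y hxy
        have : x T = y T := hxy T (by simp)
        simp only [this])
    refine h.trans ?_
    have h2 : ∫ ω, (δ - X T ω + Real.exp (2 * X T ω) / (T + 2) ^ 2) ∂μ =
        δ + Real.exp (2 * v T) / (T + 2) ^ 2 := by
      have hs : Integrable (fun ω => δ - X T ω) μ := (integrable_const _).sub (hXi T)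
      rw [integral_add hs (hexp.div_const _),
        integral_sub (integrable_const _) (hXi T), integral_div,
        integral_of_map_gaussianReal (hm T) (hlaw T), integral_exp_of_map_gaussianReal (hlaw T)]
      have hv : (v T : ℝ) * 2 ^ 2 / 2 = 2 * v T := by ring
      simp [hv]
    rw [h2]; rfl
  have hp : 0 ≤ μ.real (aliveSet X L T) := measureReal_nonneg
  calc aliveDist μ X L (T + 1)
      ≤ ∫ ω in aliveSet X L T, f ω ∂μ := by
        rw [aliveDist, ← integral_indicator hA', ← integral_indicator hA]
        refine integral_mono ?_ (hfint.indicator hA) hpt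
        exact (((integrable_const _).sub (hsum (T + 1)))).indicator hA'
    _ = aliveDist μ X L T + μ.real (aliveSet X L T) * (δ + Real.exp (2 * v T) / (T + 2) ^ 2) := by
        rw [← hindep, aliveDist, ← integral_add]
        · exact ((integrable_const _).sub (hsum T)).integrableOn
        · exact (((integrable_const _).sub (hXi T)).add (hexp.div_const _)).integrableOn
    _ ≤ _ := by
        have h1 : Real.exp (2 * v T) / ((T : ℝ) + 2) ^ 2 ≤ Real.exp (2 * b) / (T + 1) := by
          have : ((T : ℝ) + 1) ≤ (T + 2) ^ 2 := by nlinarith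
          gcongr
        have h2 : δ + Real.exp (2 * v T) / ((T : ℝ) + 2) ^ 2 ≤ (2 + Real.exp (2 * b)) / (T + 1) := by
          rw [add_div]; linarith
        calc _ ≤ aliveDist μ X L T +
              μ.real (aliveSet X L T) * ((2 + Real.exp (2 * b)) / (T + 1)) := by gcongr
          _ = _ := by ring

end Ballot

section Ballot

variable {Ω : Type*} {mΩ : MeasurableSpace Ω} {μ : Measure Ω} {X : ℕ → Ω → ℝ}

/-- A surviving walk is either far below the barrier, or has not moved down much in the second half
of its life. -/
theorem measureReal_aliveSet_le (hX : iIndepFun X μ) (hm : ∀ i, Measurable (X i)) {v : ℕ → NNReal}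
    (hlaw : ∀ i, μ.map (X i) = gaussianReal 0 (v i)) (L : ℝ) {T : ℕ} (hT : 1 ≤ T)
    (hv : ∀ i < T, (1 / 4 : ℝ) ≤ v i) :
    μ.real (aliveSet X L T) ≤
      20 * aliveDist μ X L T / √T + 13 / 20 * μ.real (aliveSet X L (T / 2)) := by
  have := hX.isProbabilityMeasure
  have hT0 : (0 : ℝ) < T := by exact_mod_cast hT
  set ε : ℝ := √T / 20 with hε
  have hε0 : 0 < ε := by positivity
  set Y : Ω → ℝ := fun ω => L + 2 * Real.log (T + 1) - ∑ l ∈ Finset.range T, X l ω with hY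
  set s := Finset.Ico (T / 2) T with hs
  set F : Set (ℕ → ℝ) := {x | -ε ≤ ∑ l ∈ s, x l} with hF
  have hmF : MeasurableSet F :=
    measurableSet_le measurable_const (Finset.measurable_sum _ fun l _ => measurable_pi_apply l)
  have hA := measurableSet_aliveSet hm L T
  have hYint : Integrable Y μ := (integrable_const _).sub
    (integrable_finsetSum _ fun l _ => integrable_of_map_gaussianReal (hm l) (hlaw l))
  have hYnn : ∀ ω ∈ aliveSet X L T, 0 ≤ Y ω := by
    intro ω hω
    have h1 : ∑ l ∈ Finset.range T, X l ω ≤ L + Real.log (T + 1) := hω T le_rfl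
    have h2 : 0 ≤ Real.log ((T : ℝ) + 1) := Real.log_nonneg (by linarith)
    simp only [hY]; linarith
  have hsub : aliveSet X L T ⊆ (aliveSet X L T ∩ {ω | ε ≤ Y ω}) ∪
      {ω | (fun i => X i ω) ∈ belowBarrier L (T / 2) ∩ F} := by
    intro ω hω
    by_cases h : ε ≤ Y ω
    · exact Or.inl ⟨hω, h⟩
    · right
      have hle : T / 2 ≤ T := Nat.div_le_self _ _
      refine ⟨belowBarrier_anti L hle hω, ?_⟩
      have h1 : ∑ l ∈ Finset.range (T / 2), X l ω ≤ L + Real.log ((T / 2 : ℕ) + 1) :=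
        hω _ hle
      have h2 : ∑ l ∈ Finset.range T, X l ω =
          ∑ l ∈ Finset.range (T / 2), X l ω + ∑ l ∈ s, X l ω :=
        (Finset.sum_range_add_sum_Ico _ hle).symm
      have h3 : Real.log ((T / 2 : ℕ) + 1) ≤ Real.log (T + 1) := by
        apply Real.log_le_log (by positivity)
        have : ((T / 2 : ℕ) : ℝ) ≤ T := by exact_mod_cast hle
        linarith
      have h4 : 0 ≤ Real.log ((T : ℝ) + 1) := Real.log_nonneg (by linarith)
      have h5 : Y ω < ε := not_le.1 h
      simp only [hY] at h5
      change -ε ≤ ∑ l ∈ s, X l ω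
      linarith
  have hfar : μ.real (aliveSet X L T ∩ {ω | ε ≤ Y ω}) ≤ 20 * aliveDist μ X L T / √T := by
    have hmk := mul_meas_ge_le_integral_of_nonneg (μ := μ.restrict (aliveSet X L T))
      (f := Y) ((ae_restrict_iff' hA).2 (.of_forall hYnn)) hYint.integrableOn ε
    have hmY : Measurable Y := measurable_const.sub (Finset.measurable_sum _ fun l _ => hm l)
    rw [measureReal_restrict_apply (measurableSet_le measurable_const hmY), Set.inter_comm] at hmk
    have : ∫ ω in aliveSet X L T, Y ω ∂μ = aliveDist μ X L T := rfl
    rw [this, ← le_div_iff₀' hε0] at hmk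
    refine hmk.trans (le_of_eq ?_)
    rw [hε]; field_simp
  have hvs : (T : ℝ) / 8 ≤ ∑ l ∈ s, (v l : ℝ) := by
    have h1 : ∑ l ∈ s, (1 / 4 : ℝ) ≤ ∑ l ∈ s, (v l : ℝ) :=
      Finset.sum_le_sum fun l hl => hv l (Finset.mem_Ico.1 hl).2
    have h2 : (T : ℝ) / 2 ≤ ((T - T / 2 : ℕ) : ℝ) := by
      have : T ≤ 2 * (T - T / 2) := by omega
      have : (T : ℝ) ≤ 2 * ((T - T / 2 : ℕ) : ℝ) := by exact_mod_cast this
      linarith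
    simp [hs] at h1
    linarith
  have hnear : μ.real {ω | (fun i => X i ω) ∈ belowBarrier L (T / 2) ∩ F} ≤
      13 / 20 * μ.real (aliveSet X L (T / 2)) := by
    rw [measureReal_inter_of_dependsOn hX hm (s := Finset.range (T / 2)) (t := s)
      (by rw [Finset.disjoint_left]; intro a ha hb; simp [hs] at ha hb; omega)
      (measurableSet_belowBarrier L _) hmF
      (dependsOn_belowBarrier L _) (by
        intro x y hxy
        simp only [hF, Set.mem_ofPred_eq, eq_iff_iff]
        rw [Finset.sum_congr rfl fun l hl => hxy l (Finset.mem_coe.2 hl)]), mul_comm]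
    have hlawS := map_sum_gaussianReal hX hm hlaw s
    have hFm : μ.real {ω | (fun i => X i ω) ∈ F} =
        (gaussianReal 0 (∑ l ∈ s, v l)).real (Set.Ici (-ε)) := by
      rw [← hlawS, measureReal_def, measureReal_def,
        Measure.map_apply (Finset.measurable_sum _ fun l _ => hm l) measurableSet_Ici]
      rfl
    have hsum0 : (∑ l ∈ s, v l) ≠ 0 := by
      intro h
      have h' : ((∑ l ∈ s, v l : NNReal) : ℝ) = 0 := by rw [h]; rfl
      push_cast at h'
      linarith
    have hq : ε / √((∑ l ∈ s, v l : NNReal) : ℝ) ≤ 3 / 20 := by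
      have hc : √((T : ℝ) / 8) ≤ √((∑ l ∈ s, v l : NNReal) : ℝ) :=
        Real.sqrt_le_sqrt (by push_cast; exact hvs)
      have h9 : √T ≤ 3 * √((T : ℝ) / 8) := by
        have : (3 : ℝ) = √9 := by
          rw [show (9 : ℝ) = 3 ^ 2 by norm_num, Real.sqrt_sq (by norm_num)]
        rw [this, ← Real.sqrt_mul (by norm_num)]
        exact Real.sqrt_le_sqrt (by linarith)
      rw [div_le_iff₀ (lt_of_lt_of_le (by positivity) hc), hε]
      linarith
    refine mul_le_mul_of_nonneg_right ?_ measureReal_nonneg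
    rw [hFm]
    refine (gaussianReal_real_Ici_neg_le hsum0 hε0.le).trans ?_
    linarith
  calc μ.real (aliveSet X L T) ≤ _ := measureReal_mono hsub
    _ ≤ _ := measureReal_union_le _ _
    _ ≤ _ := add_le_add hfar hnear

theorem measureReal_aliveSet_le_of_aliveDist_le (hX : iIndepFun X μ) (hm : ∀ i, Measurable (X i))
    {v : ℕ → NNReal} (hlaw : ∀ i, μ.map (X i) = gaussianReal 0 (v i)) {L E : ℝ} {T : ℕ}
    (hv : ∀ i < T, (1 / 4 : ℝ) ≤ v i) (hE1 : 1 ≤ E) (hE : ∀ t ≤ T, aliveDist μ X L t ≤ E) :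
    μ.real (aliveSet X L T) ≤ 400 * E / √(T + 1) := by
  have := hX.isProbabilityMeasure
  induction T using Nat.strong_induction_on with
  | _ T ih =>
  rcases Nat.eq_zero_or_pos T with rfl | hT
  · refine measureReal_le_one.trans ?_
    simp; linarith
  have hT0 : (0 : ℝ) < T := by exact_mod_cast hT
  have hT1 : (1 : ℝ) ≤ T := by exact_mod_cast hT
  have hhalf := ih (T / 2) (Nat.div_lt_self hT (by norm_num))
    (fun i hi => hv i (hi.trans_le (Nat.div_le_self _ _)))
    (fun t ht => hE t (ht.trans (Nat.div_le_self _ _)))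
  have hmain := measureReal_aliveSet_le hX hm hlaw L hT hv
  have h2 : √(2 : ℝ) ≤ 1415 / 1000 := by
    rw [Real.sqrt_le_left (by norm_num)]; norm_num
  have hpos : 0 < √((T : ℝ) + 1) := by positivity
  have hq : √((T : ℝ) + 1) ≤ 1415 / 1000 * √T := by
    calc √((T : ℝ) + 1) ≤ √(2 * T) := Real.sqrt_le_sqrt (by linarith)
      _ = √2 * √T := Real.sqrt_mul (by norm_num) _
      _ ≤ _ := by gcongr
  have hq2 : √((T : ℝ) + 1) ≤ 1415 / 1000 * √((T / 2 : ℕ) + 1) := by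
    calc √((T : ℝ) + 1) ≤ √(2 * ((T / 2 : ℕ) + 1)) := by
          apply Real.sqrt_le_sqrt
          have : T + 1 ≤ 2 * (T / 2 + 1) := by omega
          exact_mod_cast this
      _ = √2 * √((T / 2 : ℕ) + 1) := Real.sqrt_mul (by norm_num) _
      _ ≤ _ := by gcongr
  have hA : 20 * aliveDist μ X L T / √T ≤ 28.3 * E / √((T : ℝ) + 1) := by
    calc 20 * aliveDist μ X L T / √T ≤ 20 * E / √T := by gcongr; exact hE T le_rfl
      _ ≤ _ := by
        rw [div_le_div_iff₀ (by positivity) hpos]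
        calc 20 * E * √((T : ℝ) + 1) ≤ 20 * E * (1415 / 1000 * √T) := by gcongr
          _ = _ := by ring
  have hB : 400 * E / √((T / 2 : ℕ) + 1) ≤ 566 * E / √((T : ℝ) + 1) := by
    rw [div_le_div_iff₀ (by positivity) hpos]
    calc 400 * E * √((T : ℝ) + 1) ≤ 400 * E * (1415 / 1000 * √((T / 2 : ℕ) + 1)) := by gcongr
      _ = _ := by ring
  calc μ.real (aliveSet X L T)
      ≤ 28.3 * E / √((T : ℝ) + 1) + 13 / 20 * (566 * E / √((T : ℝ) + 1)) := by linarith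
    _ = 396.2 * E / √((T : ℝ) + 1) := by ring
    _ ≤ _ := by gcongr; norm_num

theorem aliveDist_le_sum (hX : iIndepFun X μ) (hm : ∀ i, Measurable (X i)) {v : ℕ → NNReal}
    (hlaw : ∀ i, μ.map (X i) = gaussianReal 0 (v i)) {b L : ℝ} (hL : 0 ≤ L) {T : ℕ}
    (hb : ∀ i < T, v i ≤ b) :
    aliveDist μ X L T ≤ L + (2 + Real.exp (2 * b)) *
      ∑ j ∈ Finset.range T, μ.real (aliveSet X L j) / (j + 1) := by
  have := hX.isProbabilityMeasure
  induction T with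
  | zero =>
    simp only [aliveDist, Finset.range_zero, Finset.sum_empty, CharP.cast_eq_zero, zero_add,
      Real.log_one, mul_zero, add_zero, sub_zero, integral_const, measureReal_restrict_apply,
      MeasurableSet.univ, Set.univ_inter, smul_eq_mul]
    exact mul_le_of_le_one_left hL measureReal_le_one
  | succ T ih =>
    have h1 := aliveDist_succ_le hX hm hlaw L T (hb T (Nat.lt_succ_self T))
    have h2 := ih fun i hi => hb i (hi.trans (Nat.lt_succ_self T))
    rw [Finset.sum_range_succ, mul_add]
    linarith

/-- A centred Gaussian walk stays below a logarithmic barrier with probability of order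
`(1 + L) / √T`. -/
theorem exists_ballot_bound (b : ℝ) : ∃ C : ℝ, 0 < C ∧ ∀ {Ω : Type*} [MeasurableSpace Ω]
    {μ : Measure Ω} {X : ℕ → Ω → ℝ}, iIndepFun X μ → (∀ i, Measurable (X i)) →
    ∀ {v : ℕ → NNReal}, (∀ i, μ.map (X i) = gaussianReal 0 (v i)) → ∀ {L : ℝ}, 0 ≤ L →
    ∀ {T : ℕ}, (∀ i < T, (1 / 4 : ℝ) ≤ v i) → (∀ i < T, v i ≤ b) →
    μ.real (aliveSet X L T) ≤ C * (1 + L) / √(T + 1) := by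
  set K : ℝ := 2 + Real.exp (2 * b) with hK
  have hK2 : 2 ≤ K := by have := Real.exp_pos (2 * b); linarith
  have hsm : Summable fun j : ℕ => ((j : ℝ) + 1) ^ (-(5 / 4) : ℝ) := by
    have h := (Real.summable_nat_rpow (p := -(5 / 4))).2 (by norm_num)
    simpa using (summable_nat_add_iff 1).2 h
  set W : ℝ := ∑' j : ℕ, ((j : ℝ) + 1) ^ (-(5 / 4) : ℝ) with hW
  have hW0 : 0 ≤ W := tsum_nonneg fun j => by positivity
  refine ⟨400 * (1 + K * (400 * (6 * K) * W)), by positivity, ?_⟩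
  intro Ω _ μ X hX hm v hlaw L hL T hv hb
  have := hX.isProbabilityMeasure
  have first : ∀ t ≤ T, aliveDist μ X L t ≤ 6 * K * (1 + L) * ((t : ℝ) + 1) ^ (1 / 4 : ℝ) := by
    intro t ht
    have h1 := aliveDist_le_sum hX hm hlaw hL (T := t) fun i hi => hb i (hi.trans_le ht)
    have hr : 1 ≤ ((t : ℝ) + 1) ^ (1 / 4 : ℝ) := by
      apply Real.one_le_rpow _ (by norm_num)
      linarith [Nat.cast_nonneg (α := ℝ) t]
    have h2 : ∑ j ∈ Finset.range t, μ.real (aliveSet X L j) / ((j : ℝ) + 1) ≤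
        5 * ((t : ℝ) + 1) ^ (1 / 4 : ℝ) := by
      calc ∑ j ∈ Finset.range t, μ.real (aliveSet X L j) / ((j : ℝ) + 1)
          ≤ ∑ j ∈ Finset.range t, ((j : ℝ) + 1)⁻¹ := by
            refine Finset.sum_le_sum fun j _ => ?_
            rw [← one_div]
            gcongr
            exact measureReal_le_one
        _ = ((harmonic t : ℚ) : ℝ) := by simp [harmonic]
        _ ≤ 1 + Real.log t := harmonic_le_one_add_log t
        _ ≤ 1 + Real.log (t + 1) := by
            rcases Nat.eq_zero_or_pos t with rfl | h
            · simp
            · have : (0 : ℝ) < t := by exact_mod_cast h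
              gcongr
              linarith
        _ ≤ 1 + ((t : ℝ) + 1) ^ (1 / 4 : ℝ) / (1 / 4) := by
            gcongr
            exact Real.log_le_rpow_div (by positivity) (by norm_num)
        _ ≤ _ := by linarith
    calc aliveDist μ X L t ≤ L + K * (5 * ((t : ℝ) + 1) ^ (1 / 4 : ℝ)) := by
          refine h1.trans ?_; gcongr
      _ ≤ L * (6 * K * ((t : ℝ) + 1) ^ (1 / 4 : ℝ)) + 6 * K * ((t : ℝ) + 1) ^ (1 / 4 : ℝ) := by
          have h3 : 1 ≤ 6 * K * ((t : ℝ) + 1) ^ (1 / 4 : ℝ) := by nlinarith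
          have h4 := le_mul_of_one_le_right hL h3
          nlinarith
      _ = _ := by ring
  have second : ∀ t ≤ T, μ.real (aliveSet X L t) / ((t : ℝ) + 1) ≤
      400 * (6 * K * (1 + L)) * ((t : ℝ) + 1) ^ (-(5 / 4) : ℝ) := by
    intro t ht
    have ht0 : (0 : ℝ) < (t : ℝ) + 1 := by positivity
    have hr : 1 ≤ ((t : ℝ) + 1) ^ (1 / 4 : ℝ) := by
      apply Real.one_le_rpow _ (by norm_num)
      linarith [Nat.cast_nonneg (α := ℝ) t]
    have h := measureReal_aliveSet_le_of_aliveDist_le hX hm hlaw (T := t) (L := L)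
      (E := 6 * K * (1 + L) * ((t : ℝ) + 1) ^ (1 / 4 : ℝ))
      (fun i hi => hv i (hi.trans_le ht)) (by nlinarith [mul_nonneg (by linarith : 0 ≤ K) hL])
      (fun u hu => (first u (hu.trans ht)).trans (by gcongr))
    calc μ.real (aliveSet X L t) / ((t : ℝ) + 1)
        ≤ 400 * (6 * K * (1 + L) * ((t : ℝ) + 1) ^ (1 / 4 : ℝ)) / √((t : ℝ) + 1) / (t + 1) := by
          gcongr
      _ = 400 * (6 * K * (1 + L)) *
          (((t : ℝ) + 1) ^ (1 / 4 : ℝ) / √((t : ℝ) + 1) / (t + 1)) := by ring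
      _ = _ := by
          congr 1
          rw [Real.sqrt_eq_rpow, ← Real.rpow_sub ht0, ← Real.rpow_sub_one ht0.ne']
          norm_num
  have third : ∀ t ≤ T, aliveDist μ X L t ≤ (1 + K * (400 * (6 * K) * W)) * (1 + L) := by
    intro t ht
    have h1 := aliveDist_le_sum hX hm hlaw hL (T := t) fun i hi => hb i (hi.trans_le ht)
    have h2 : ∑ j ∈ Finset.range t, μ.real (aliveSet X L j) / ((j : ℝ) + 1) ≤
        400 * (6 * K * (1 + L)) * W := by
      calc _ ≤ ∑ j ∈ Finset.range t, 400 * (6 * K * (1 + L)) * ((j : ℝ) + 1) ^ (-(5 / 4) : ℝ) :=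
            Finset.sum_le_sum fun j hj => second j ((Finset.mem_range.1 hj).le.trans ht)
        _ = 400 * (6 * K * (1 + L)) * ∑ j ∈ Finset.range t, ((j : ℝ) + 1) ^ (-(5 / 4) : ℝ) := by
            rw [Finset.mul_sum]
        _ ≤ _ := by
            gcongr
            exact hsm.sum_le_tsum _ fun j _ => by positivity
    calc aliveDist μ X L t ≤ L + K * (400 * (6 * K * (1 + L)) * W) := by
          refine h1.trans ?_; gcongr
      _ ≤ (1 + L) + K * (400 * (6 * K * (1 + L)) * W) := by linarith
      _ = _ := by ring
  have h := measureReal_aliveSet_le_of_aliveDist_le hX hm hlaw hv (by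
    have h3 : 0 ≤ K * (400 * (6 * K) * W) := by positivity
    nlinarith) third
  rwa [← mul_assoc] at h

end Ballot

section PowerSeries

open PowerSeries

variable {𝕜 : Type*} [RCLike 𝕜]

/-- The power series of `z ↦ exp (c * z ^ k)`. -/
noncomputable def expMonomial (k : ℕ+) (c : 𝕜) : PowerSeries 𝕜 :=
  PowerSeries.mk fun m => if (k : ℕ) ∣ m then c ^ (m / k) / (Nat.factorial (m / k) : 𝕜) else 0

theorem coeff_expMonomial (k : ℕ+) (c : 𝕜) (m : ℕ) : coeff m (expMonomial k c) =
    if (k : ℕ) ∣ m then c ^ (m / k) / (Nat.factorial (m / k) : 𝕜) else 0 := by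
  simp [expMonomial]

theorem norm_coeff_expMonomial (k : ℕ+) (c : 𝕜) (m : ℕ) :
    ‖coeff m (expMonomial k c)‖ = coeff m (expMonomial k ‖c‖) := by
  rw [coeff_expMonomial, coeff_expMonomial]
  split_ifs <;> simp

theorem hasSum_expMonomial (k : ℕ+) (c z : 𝕜) :
    HasSum (fun m => coeff m (expMonomial k c) * z ^ m) (NormedSpace.exp (c * z ^ (k : ℕ))) := by
  have h := NormedSpace.expSeries_div_hasSum_exp (c * z ^ (k : ℕ))
  have hinj : Function.Injective fun j : ℕ => (k : ℕ) * j :=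
    fun a b hab => Nat.eq_of_mul_eq_mul_left k.pos hab
  rw [← hinj.hasSum_iff]
  · convert h using 1
    ext j
    simp only [Function.comp, coeff_expMonomial, dvd_mul_right, if_true,
      Nat.mul_div_cancel_left j k.pos]
    rw [mul_pow, pow_mul]
    ring
  · intro m hm
    rw [coeff_expMonomial, if_neg, zero_mul]
    rintro ⟨j, rfl⟩
    exact hm ⟨j, rfl⟩

theorem summable_norm_expMonomial (k : ℕ+) (c z : 𝕜) :
    Summable fun m => ‖coeff m (expMonomial k c) * z ^ m‖ := by
  have h := (hasSum_expMonomial k ‖c‖ ‖z‖).summable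
  simpa [norm_mul, norm_coeff_expMonomial] using h

/-- The power series of `z ↦ exp (∑ k ∈ s, c k * z ^ k)`. -/
noncomputable def expPoly (s : Finset ℕ+) (c : ℕ+ → 𝕜) : PowerSeries 𝕜 :=
  ∏ k ∈ s, expMonomial k (c k)

theorem summable_and_tsum_expPoly (s : Finset ℕ+) (c : ℕ+ → 𝕜) (z : 𝕜) :
    (Summable fun m => ‖coeff m (expPoly s c) * z ^ m‖) ∧
      ∑' m, coeff m (expPoly s c) * z ^ m = NormedSpace.exp (∑ k ∈ s, c k * z ^ (k : ℕ)) := by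
  classical
  induction s using Finset.induction_on with
  | empty =>
    have h1 : ∀ m, coeff m (expPoly ∅ c) * z ^ m = if m = 0 then 1 else 0 := by
      intro m
      simp only [expPoly, Finset.prod_empty, coeff_one]
      split_ifs with h <;> simp [h]
    simp only [h1]
    constructor
    · refine summable_of_ne_finset_zero (s := {0}) fun m hm => ?_
      simp at hm
      simp [hm]
    · simp
  | insert k s hk ih =>
    obtain ⟨f, hf⟩ : ∃ f : ℕ → 𝕜, ∀ m, f m = coeff m (expMonomial k (c k)) * z ^ m :=
      ⟨_, fun _ => rfl⟩
    obtain ⟨g, hg⟩ : ∃ g : ℕ → 𝕜, ∀ m, g m = coeff m (expPoly s c) * z ^ m := ⟨_, fun _ => rfl⟩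
    have hconv : ∀ m, coeff m (expPoly (insert k s) c) * z ^ m =
        ∑ p ∈ Finset.HasAntidiagonal.antidiagonal m, f p.1 * g p.2 := by
      intro m
      rw [expPoly, Finset.prod_insert hk, coeff_mul, Finset.sum_mul]
      refine Finset.sum_congr rfl fun p hp => ?_
      rw [← Finset.HasAntidiagonal.mem_antidiagonal.1 hp, pow_add, hf, hg, expPoly]
      ring
    simp only [← hg] at ih
    have hs := summable_norm_expMonomial k (c k) z
    have hfs := (hasSum_expMonomial k (c k) z).tsum_eq
    simp only [← hf] at hs hfs
    simp only [hconv]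
    refine ⟨summable_norm_sum_mul_antidiagonal_of_summable_norm hs ih.1, ?_⟩
    have hprod := tsum_mul_tsum_eq_tsum_sum_antidiagonal_of_summable_norm hs ih.1
    rw [← hprod, hfs, ih.2, Finset.sum_insert hk, NormedSpace.exp_add]

theorem summable_norm_expPoly (s : Finset ℕ+) (c : ℕ+ → 𝕜) (z : 𝕜) :
    Summable fun m => ‖coeff m (expPoly s c) * z ^ m‖ := (summable_and_tsum_expPoly s c z).1

theorem hasSum_expPoly (s : Finset ℕ+) (c : ℕ+ → 𝕜) (z : 𝕜) :
    HasSum (fun m => coeff m (expPoly s c) * z ^ m)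
      (NormedSpace.exp (∑ k ∈ s, c k * z ^ (k : ℕ))) := by
  rw [← (summable_and_tsum_expPoly s c z).2]
  exact (summable_norm_expPoly s c z).of_norm.hasSum

theorem X_mul_derivative_expMonomial (k : ℕ+) (c : 𝕜) :
    X * d⁄dX 𝕜 (expMonomial k c) = C ((k : ℕ) * c) * X ^ (k : ℕ) * expMonomial k c := by
  ext m
  rw [mul_assoc, coeff_C_mul, coeff_X_pow_mul']
  rcases m with _ | m
  · simp
  · rw [coeff_succ_X_mul, coeff_derivative, coeff_expMonomial]
    by_cases hd : (k : ℕ) ∣ m + 1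
    · obtain ⟨j, hj⟩ := hd
      have hj0 : j ≠ 0 := by rintro rfl; simp at hj
      obtain ⟨i, rfl⟩ := Nat.exists_eq_succ_of_ne_zero hj0
      have hle : (k : ℕ) ≤ m + 1 := by rw [hj]; exact Nat.le_mul_of_pos_right _ (Nat.succ_pos i)
      have hsub : m + 1 - k = k * i := by rw [hj, Nat.mul_succ]; simp
      rw [if_pos ⟨_, hj⟩, if_pos hle, hsub, coeff_expMonomial, if_pos (dvd_mul_right _ _),
        Nat.mul_div_cancel_left i k.pos, hj, Nat.mul_div_cancel_left _ k.pos]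
      have hc : ((m : 𝕜) + 1) = (k : ℕ) * ((i : 𝕜) + 1) := by exact_mod_cast hj
      rw [hc, Nat.factorial_succ, pow_succ]
      have h1 : (Nat.factorial i : 𝕜) ≠ 0 := by exact_mod_cast Nat.factorial_ne_zero i
      have h2 : ((i : 𝕜) + 1) ≠ 0 := by exact_mod_cast Nat.succ_ne_zero i
      push_cast
      field_simp
    · rw [if_neg hd, zero_mul]
      split_ifs with hle
      · rw [coeff_expMonomial, if_neg, mul_zero]
        intro h
        apply hd
        have := dvd_add h (dvd_refl (k : ℕ))
        rwa [Nat.sub_add_cancel hle] at this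
      · simp

theorem X_mul_derivative_expPoly (s : Finset ℕ+) (c : ℕ+ → 𝕜) :
    X * d⁄dX 𝕜 (expPoly s c) = (∑ k ∈ s, C ((k : ℕ) * c k) * X ^ (k : ℕ)) * expPoly s c := by
  classical
  induction s using Finset.induction_on with
  | empty => simp [expPoly]
  | insert k s hk ih =>
    have e : expPoly (insert k s) c = expMonomial k (c k) * expPoly s c := Finset.prod_insert hk
    rw [e, Derivation.leibniz, Finset.sum_insert hk]
    simp only [smul_eq_mul]
    linear_combination expMonomial k (c k) * ih +
      expPoly s c * X_mul_derivative_expMonomial k (c k)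

theorem natCast_mul_coeff_expPoly (s : Finset ℕ+) (c : ℕ+ → 𝕜) (m : ℕ) :
    (m : 𝕜) * coeff m (expPoly s c) =
      ∑ k ∈ s.filter fun k : ℕ+ => (k : ℕ) ≤ m, (k : ℕ) * c k * coeff (m - k) (expPoly s c) := by
  have h := congrArg (coeff m) (X_mul_derivative_expPoly s c)
  rw [Finset.sum_mul, map_sum, Finset.sum_filter] at *
  rcases m with _ | m
  · rw [Nat.cast_zero, zero_mul]
    refine (Finset.sum_eq_zero fun k _ => ?_).symm
    rw [if_neg (by simp)]
  · rw [coeff_succ_X_mul, coeff_derivative] at h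
    push_cast
    rw [mul_comm, h]
    refine Finset.sum_congr rfl fun k _ => ?_
    rw [mul_assoc, coeff_C_mul, coeff_X_pow_mul', mul_ite, mul_zero]

theorem coeff_zero_expPoly (s : Finset ℕ+) (c : ℕ+ → 𝕜) : coeff 0 (expPoly s c) = 1 := by
  rw [coeff_zero_eq_constantCoeff_apply, expPoly, map_prod]
  refine Finset.prod_eq_one fun k _ => ?_
  rw [← coeff_zero_eq_constantCoeff_apply, coeff_expMonomial]
  simp

theorem coeff_expPoly_eq_zero {s : Finset ℕ+} (c : ℕ+ → 𝕜) {m : ℕ} (hm : m ≠ 0)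
    (hs : ∀ k ∈ s, m < (k : ℕ)) : coeff m (expPoly s c) = 0 := by
  have h := natCast_mul_coeff_expPoly s c m
  rw [Finset.filter_false_of_mem fun k hk => not_le.2 (hs k hk), Finset.sum_empty] at h
  exact (mul_eq_zero.1 h).resolve_left (by exact_mod_cast hm)

theorem expPoly_union {s t : Finset ℕ+} (h : Disjoint s t) (c : ℕ+ → 𝕜) :
    expPoly (s ∪ t) c = expPoly s c * expPoly t c := Finset.prod_union h

/-- Adding higher frequencies does not change the coefficients of low degree. -/
theorem coeff_expPoly_of_subset {s t : Finset ℕ+} (hst : s ⊆ t) (c : ℕ+ → 𝕜) {m : ℕ}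
    (h : ∀ k ∈ t, (k : ℕ) ≤ m → k ∈ s) : coeff m (expPoly t c) = coeff m (expPoly s c) := by
  classical
  have e : expPoly t c = expPoly s c * expPoly (t \ s) c := by
    rw [← expPoly_union Finset.disjoint_sdiff, Finset.union_sdiff_of_subset hst]
  rw [e, coeff_mul, Finset.sum_eq_single (m, 0)]
  · simp [coeff_zero_expPoly]
  · rintro ⟨i, j⟩ hij hne
    have hij' := Finset.HasAntidiagonal.mem_antidiagonal.1 hij
    simp only at hij'
    have hj : j ≠ 0 := by rintro rfl; simp at hij'; simp [hij'] at hne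
    rw [coeff_expPoly_eq_zero (s := t \ s) c hj, mul_zero]
    intro k hk
    rw [Finset.mem_sdiff] at hk
    by_contra hlt
    exact hk.2 (h k hk.1 (by omega))
  · simp

theorem coeff_expPoly_nonneg (s : Finset ℕ+) {c : ℕ+ → ℝ} (hc : ∀ k, 0 ≤ c k) (m : ℕ) :
    0 ≤ coeff m (expPoly s c) := by
  classical
  induction s using Finset.induction_on generalizing m with
  | empty => simp only [expPoly, Finset.prod_empty, coeff_one]; split_ifs <;> simp
  | insert k s hk ih =>
    have e : expPoly (insert k s) c = expMonomial k (c k) * expPoly s c := Finset.prod_insert hk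
    rw [e, coeff_mul]
    refine Finset.sum_nonneg fun p _ => mul_nonneg ?_ (ih _)
    rw [coeff_expMonomial]
    have := hc k
    split_ifs <;> positivity

/-- The variances of the coefficients of the chaos restricted to the frequencies in `s`. -/
noncomputable def varCoeff (s : Finset ℕ+) (m : ℕ) : ℝ :=
  coeff m (expPoly s fun k => ((k : ℕ) : ℝ)⁻¹)

theorem varCoeff_nonneg (s : Finset ℕ+) (m : ℕ) : 0 ≤ varCoeff s m :=
  coeff_expPoly_nonneg s (fun _ => by positivity) m

theorem natCast_mul_varCoeff (s : Finset ℕ+) (m : ℕ) :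
    m * varCoeff s m = ∑ k ∈ s.filter fun k : ℕ+ => (k : ℕ) ≤ m, varCoeff s (m - k) := by
  rw [varCoeff, natCast_mul_coeff_expPoly]
  refine Finset.sum_congr rfl fun k _ => ?_
  have : ((k : ℕ) : ℝ) ≠ 0 := by exact_mod_cast k.pos.ne'
  rw [mul_inv_cancel₀ this, one_mul, varCoeff]

theorem card_filter_le (s : Finset ℕ+) (m : ℕ) : (s.filter fun k : ℕ+ => (k : ℕ) ≤ m).card ≤ m := by
  have : (s.filter fun k : ℕ+ => (k : ℕ) ≤ m).card ≤ (Finset.Icc 1 m).card := by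
    refine Finset.card_le_card_of_injOn (fun k : ℕ+ => (k : ℕ)) ?_ fun a _ b _ h => PNat.coe_injective h
    intro k hk
    simp at hk ⊢
    exact ⟨k.pos, hk.2⟩
  simpa using this

theorem varCoeff_le_one (s : Finset ℕ+) (m : ℕ) : varCoeff s m ≤ 1 := by
  induction m using Nat.strong_induction_on with
  | _ m ih =>
  rcases Nat.eq_zero_or_pos m with rfl | hm
  · rw [varCoeff, coeff_zero_expPoly]
  · have h1 : (m : ℝ) * varCoeff s m ≤ m * 1 := by
      rw [natCast_mul_varCoeff]
      calc ∑ k ∈ s.filter fun k : ℕ+ => (k : ℕ) ≤ m, varCoeff s (m - k)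
          ≤ ∑ k ∈ s.filter fun k : ℕ+ => (k : ℕ) ≤ m, (1 : ℝ) :=
            Finset.sum_le_sum fun k _ => ih _ (Nat.sub_lt hm k.pos)
        _ = ((s.filter fun k : ℕ+ => (k : ℕ) ≤ m).card : ℝ) := by simp
        _ ≤ m * 1 := by rw [mul_one]; exact_mod_cast card_filter_le s m
    exact le_of_mul_le_mul_left h1 (by exact_mod_cast hm)

theorem hasSum_varCoeff (s : Finset ℕ+) (x : ℝ) : HasSum (fun m => varCoeff s m * x ^ m)
    (Real.exp (∑ k ∈ s, x ^ (k : ℕ) / (k : ℕ))) := by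
  have h := hasSum_expPoly s (fun k : ℕ+ => ((k : ℕ) : ℝ)⁻¹) x
  rw [Real.exp_eq_exp_ℝ]
  have e : ∑ k ∈ s, x ^ (k : ℕ) / ((k : ℕ) : ℝ) = ∑ k ∈ s, ((k : ℕ) : ℝ)⁻¹ * x ^ (k : ℕ) :=
    Finset.sum_congr rfl fun k _ => by ring
  rw [e]
  exact h

/-- Exponential decay of the variances for frequencies at scale `K`. -/
theorem varCoeff_mul_pow_le {s : Finset ℕ+} {K : ℕ} (hK : 0 < K) (hs : ∀ k ∈ s, K ≤ (k : ℕ))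
    (hsum : ∑ k ∈ s, (((k : ℕ) : ℝ))⁻¹ ≤ 1) {x A : ℝ} (hx : 0 ≤ x)
    (hA : ∀ k ∈ s, x ^ (k : ℕ) ≤ A) (hA0 : 0 ≤ A) {m : ℕ} (hm : m ≠ 0) :
    varCoeff s m * x ^ m ≤ A * Real.exp A / K := by
  rcases lt_or_ge m K with h | h
  · rw [varCoeff, coeff_expPoly_eq_zero _ hm fun k hk => h.trans_le (hs k hk), zero_mul]
    positivity
  have hnn : ∀ l, 0 ≤ varCoeff s l * x ^ l := fun l =>
    mul_nonneg (varCoeff_nonneg s l) (pow_nonneg hx l)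
  have h1 : (m : ℝ) * (varCoeff s m * x ^ m) ≤ A * Real.exp A := by
    rw [← mul_assoc, natCast_mul_varCoeff, Finset.sum_mul]
    calc ∑ k ∈ s.filter fun k : ℕ+ => (k : ℕ) ≤ m, varCoeff s (m - k) * x ^ m
        ≤ ∑ k ∈ s.filter fun k : ℕ+ => (k : ℕ) ≤ m, A * (varCoeff s (m - k) * x ^ (m - k)) := by
          refine Finset.sum_le_sum fun k hk => ?_
          rw [Finset.mem_filter] at hk
          have e : x ^ m = x ^ (k : ℕ) * x ^ (m - k) := by
            rw [← pow_add, Nat.add_sub_cancel' hk.2]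
          rw [e]
          calc varCoeff s (m - k) * (x ^ (k : ℕ) * x ^ (m - k))
              = x ^ (k : ℕ) * (varCoeff s (m - k) * x ^ (m - k)) := by ring
            _ ≤ _ := mul_le_mul_of_nonneg_right (hA k hk.1) (hnn _)
      _ = A * ∑ k ∈ s.filter fun k : ℕ+ => (k : ℕ) ≤ m, varCoeff s (m - k) * x ^ (m - k) := by
          rw [Finset.mul_sum]
      _ ≤ A * Real.exp (∑ k ∈ s, x ^ (k : ℕ) / (k : ℕ)) := by
          refine mul_le_mul_of_nonneg_left ?_ hA0
          rw [← Finset.sum_image (f := fun l => varCoeff s l * x ^ l)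
            (g := fun k : ℕ+ => m - (k : ℕ)) (s := s.filter fun k : ℕ+ => (k : ℕ) ≤ m)]
          · exact sum_le_hasSum _ (fun l _ => hnn l) (hasSum_varCoeff s x)
          · intro a ha b hb hab
            simp at ha hb hab
            exact PNat.coe_injective (by omega)
      _ ≤ A * Real.exp A := by
          gcongr
          calc ∑ k ∈ s, x ^ (k : ℕ) / (k : ℕ) ≤ ∑ k ∈ s, A * (((k : ℕ) : ℝ))⁻¹ := by
                refine Finset.sum_le_sum fun k hk => ?_
                rw [div_eq_mul_inv]
                have := hA k hk
                gcongr
            _ = A * ∑ k ∈ s, (((k : ℕ) : ℝ))⁻¹ := by rw [Finset.mul_sum]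
            _ ≤ A * 1 := by gcongr
            _ = A := mul_one A
  rw [le_div_iff₀ (by exact_mod_cast hK)]
  calc varCoeff s m * x ^ m * K ≤ varCoeff s m * x ^ m * m :=
        mul_le_mul_of_nonneg_left (by exact_mod_cast h) (hnn m)
    _ ≤ _ := by linarith

end PowerSeries

section Girsanov

variable {Ω ι : Type*} {mΩ : MeasurableSpace Ω} {μ : Measure Ω}

theorem setLIntegral_exp_gaussianReal {v : NNReal} (hv : v ≠ 0) {B : Set ℝ}
    (hB : MeasurableSet B) :
    ∫⁻ x in B, ENNReal.ofReal (Real.exp (2 * x - 2 * v)) ∂gaussianReal 0 v =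
      gaussianReal (2 * v) v B := by
  have hv' : (v : ℝ) ≠ 0 := by exact_mod_cast hv
  rw [gaussianReal_of_var_ne_zero 0 hv, gaussianReal_apply _ hv,
    setLIntegral_withDensity_eq_setLIntegral_mul _ (measurable_gaussianPDF 0 v) (by fun_prop) hB]
  refine setLIntegral_congr_fun hB fun x _ => ?_
  simp only [Pi.mul_apply, gaussianPDF_def]
  rw [← ENNReal.ofReal_mul (gaussianPDFReal_nonneg _ _ _)]
  congr 1
  rw [gaussianPDFReal_def, gaussianPDFReal_def]
  simp only
  rw [mul_assoc, ← Real.exp_add]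
  congr 2
  field_simp
  ring

/-- The measure under which the Gaussian variables `η i`, `i ∈ s`, are tilted by `exp (2 η i)`. -/
noncomputable def tiltedMeasure (μ : Measure Ω) (η : ι → Ω → ℝ) (v : ι → NNReal) (s : Finset ι) :
    Measure Ω :=
  μ.withDensity fun ω => ∏ i ∈ s, ENNReal.ofReal (Real.exp (2 * η i ω - 2 * v i))

theorem tiltedMeasure_iInter [DecidableEq ι] {η : ι → Ω → ℝ} (hη : iIndepFun η μ)
    (hm : ∀ i, Measurable (η i)) {v : ι → NNReal}
    (hlaw : ∀ i, μ.map (η i) = gaussianReal 0 (v i)) (hv : ∀ i, v i ≠ 0) (s S : Finset ι)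
    {B : ι → Set ℝ} (hB : ∀ i ∈ S, MeasurableSet (B i)) :
    tiltedMeasure μ η v s (⋂ i ∈ S, η i ⁻¹' B i) =
      ∏ i ∈ S, gaussianReal (if i ∈ s then 2 * v i else 0) (v i) (B i) := by
  classical
  set B' : ι → Set ℝ := fun i => if i ∈ S then B i else Set.univ with hB'
  have hB'm : ∀ i, MeasurableSet (B' i) := by
    intro i
    by_cases h : i ∈ S
    · simpa [hB', h] using hB i h
    · simp [hB', h]
  set g : ι → ℝ → ENNReal := fun i => (B' i).indicator fun x =>
    if i ∈ s then ENNReal.ofReal (Real.exp (2 * x - 2 * v i)) else 1 with hg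
  have hgm : ∀ i, Measurable (g i) := by
    intro i
    refine Measurable.indicator ?_ (hB'm i)
    split_ifs <;> fun_prop
  have hgi : ∀ i, ∫⁻ ω, g i (η i ω) ∂μ =
      gaussianReal (if i ∈ s then 2 * v i else 0) (v i) (B' i) := by
    intro i
    rw [← lintegral_map (hgm i) (hm i), hlaw i, hg, lintegral_indicator (hB'm i)]
    split_ifs with h
    · exact setLIntegral_exp_gaussianReal (hv i) (hB'm i)
    · simp
  have hset : MeasurableSet (⋂ i ∈ S, η i ⁻¹' B i) :=
    Finset.measurableSet_biInter _ fun i hi => hm i (hB i hi)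
  have hprod := lintegral_prod_eq_prod_lintegral_of_indepFun (S ∪ s)
    (fun i ω => g i (η i ω)) (hη.comp g hgm) (fun i => (hgm i).comp (hm i))
  rw [tiltedMeasure, withDensity_apply _ hset, ← lintegral_indicator hset]
  have e1 : ∀ ω, (⋂ i ∈ S, η i ⁻¹' B i).indicator
      (fun ω => ∏ i ∈ s, ENNReal.ofReal (Real.exp (2 * η i ω - 2 * v i))) ω =
      ∏ i ∈ S ∪ s, g i (η i ω) := by
    intro ω
    by_cases hω : ω ∈ ⋂ i ∈ S, η i ⁻¹' B i
    · rw [Set.indicator_of_mem hω, ← Finset.inter_eq_right.2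
        (Finset.subset_union_right (s₁ := S) (s₂ := s)), ← Finset.prod_ite_mem,
        Finset.inter_eq_right.2 (Finset.subset_union_right (s₁ := S) (s₂ := s))]
      refine Finset.prod_congr rfl fun i _ => ?_
      simp only [hg]
      rw [Set.indicator_of_mem]
      by_cases h : i ∈ S
      · simp only [hB', h, if_true]
        simp only [Set.mem_iInter] at hω
        exact hω i h
      · simp [hB', h]
    · rw [Set.indicator_of_notMem hω]
      simp only [Set.mem_iInter, not_forall] at hω
      obtain ⟨i, hi, hne⟩ := hω
      refine (Finset.prod_eq_zero (Finset.mem_union_left s hi) ?_).symm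
      simp only [hg]
      rw [Set.indicator_of_notMem]
      simpa [hB', hi] using hne
  rw [lintegral_congr e1, hprod, Finset.prod_congr rfl fun i _ => hgi i]
  rw [← Finset.prod_subset (Finset.subset_union_left (s₁ := S) (s₂ := s))]
  · exact Finset.prod_congr rfl fun i hi => by simp [hB', hi]
  · intro i _ hi
    simp [hB', hi]

theorem tiltedMeasure_map [DecidableEq ι] {η : ι → Ω → ℝ} (hη : iIndepFun η μ)
    (hm : ∀ i, Measurable (η i)) {v : ι → NNReal}
    (hlaw : ∀ i, μ.map (η i) = gaussianReal 0 (v i)) (hv : ∀ i, v i ≠ 0) (s : Finset ι) (i : ι) :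
    (tiltedMeasure μ η v s).map (η i) = gaussianReal (if i ∈ s then 2 * v i else 0) (v i) := by
  ext B hB
  rw [Measure.map_apply (hm i) hB]
  have := tiltedMeasure_iInter hη hm hlaw hv s {i} (B := fun _ => B) (fun _ _ => hB)
  simpa using this

theorem tiltedMeasure_iIndepFun [DecidableEq ι] {η : ι → Ω → ℝ} (hη : iIndepFun η μ)
    (hm : ∀ i, Measurable (η i)) {v : ι → NNReal}
    (hlaw : ∀ i, μ.map (η i) = gaussianReal 0 (v i)) (hv : ∀ i, v i ≠ 0) (s : Finset ι) :
    iIndepFun η (tiltedMeasure μ η v s) := by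
  rw [iIndepFun_iff_measure_inter_preimage_eq_mul]
  intro S B hB
  rw [tiltedMeasure_iInter hη hm hlaw hv s S hB]
  refine Finset.prod_congr rfl fun i hi => ?_
  rw [← tiltedMeasure_map hη hm hlaw hv s i, Measure.map_apply (hm i) (hB i hi)]

end Girsanov

section ComplexGaussian

variable {Ω : Type*} {mΩ : MeasurableSpace Ω} {μ : Measure Ω} {Z : Ω → ℂ}

theorem IsStdComplexGaussian.integrable_sq (h : IsStdComplexGaussian Z μ) :
    Integrable (fun ω => Z ω ^ 2) μ := by
  have h2 := h.gaussian.memLp_two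
  have := h2.integrable_mul h2
  simp only [sq]
  exact this

theorem IsStdComplexGaussian.hasGaussianLaw_re_mul (h : IsStdComplexGaussian Z μ) (w : ℂ) :
    HasGaussianLaw (fun ω => (w * Z ω).re) μ :=
  h.gaussian.map_fun (Complex.reCLM.comp
    ((ContinuousLinearMap.mul ℂ ℂ w).restrictScalars ℝ))

theorem IsStdComplexGaussian.integral_re_mul (h : IsStdComplexGaussian Z μ) (w : ℂ) :
    ∫ ω, (w * Z ω).re ∂μ = 0 := by
  have h1 := integral_re (h.gaussian.integrable.const_mul w)
  have h2 : ∫ ω, w * Z ω ∂μ = 0 := by rw [integral_const_mul, h.mean, mul_zero]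
  rw [h2] at h1
  simpa using h1

theorem IsStdComplexGaussian.integral_re_mul_sq (h : IsStdComplexGaussian Z μ) (w : ℂ) :
    ∫ ω, (w * Z ω).re ^ 2 ∂μ = ‖w‖ ^ 2 / 2 := by
  have hid : ∀ ω, (w * Z ω).re ^ 2 = (‖w‖ ^ 2 * ‖Z ω‖ ^ 2 + (w ^ 2 * Z ω ^ 2).re) / 2 := by
    intro ω
    rw [← mul_pow, ← mul_pow, ← norm_mul, Complex.sq_norm, Complex.normSq_apply, sq (w * Z ω),
      Complex.mul_re (w * Z ω)]
    ring
  simp only [hid]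
  have h2 : ∫ ω, w ^ 2 * Z ω ^ 2 ∂μ = 0 := by rw [integral_const_mul, h.sq_mean, mul_zero]
  have h1 := integral_re (h.integrable_sq.const_mul (w ^ 2))
  rw [h2] at h1
  have hn : Integrable (fun ω => ‖Z ω‖ ^ 2) μ := h.gaussian.memLp_two.integrable_norm_pow (by simp)
  have hre : Integrable (fun ω => (w ^ 2 * Z ω ^ 2).re) μ := (h.integrable_sq.const_mul (w ^ 2)).re
  rw [integral_div, integral_add (hn.const_mul _) hre,
    integral_const_mul, h.normSq_mean]
  have h1' : ∫ ω, (w ^ 2 * Z ω ^ 2).re ∂μ = 0 := by simpa using h1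
  rw [h1']
  simp

theorem IsStdComplexGaussian.map_re_mul (h : IsStdComplexGaussian Z μ) (w : ℂ) :
    μ.map (fun ω => (w * Z ω).re) = gaussianReal 0 (‖w‖₊ ^ 2 / 2) := by
  have := h.gaussian.isProbabilityMeasure
  have hg := h.hasGaussianLaw_re_mul w
  rw [hg.map_eq_gaussianReal, h.integral_re_mul w]
  congr 1
  rw [variance_of_integral_eq_zero hg.aemeasurable (h.integral_re_mul w), h.integral_re_mul_sq w]
  ext
  rw [Real.coe_toNNReal _ (by positivity)]
  simp

theorem IsStdComplexGaussian.map_eq_withDensity (h : IsStdComplexGaussian Z μ) :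
    μ.map Z = volume.withDensity fun z =>
      ENNReal.ofReal (Real.pi⁻¹ * Real.exp (-‖z‖ ^ 2)) := by
  have := h.gaussian.isProbabilityMeasure
  have hZ := h.gaussian.aemeasurable
  have hpair : HasGaussianLaw (fun ω => ((Z ω).re, (Z ω).im)) μ :=
    h.gaussian.map_fun (Complex.equivRealProdCLM : ℂ →L[ℝ] ℝ × ℝ)
  have hre : μ.map (fun ω => (Z ω).re) = gaussianReal 0 (1 / 2) := by
    simpa using h.map_re_mul 1
  have him : μ.map (fun ω => (Z ω).im) = gaussianReal 0 (1 / 2) := by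
    simpa using h.map_re_mul (-Complex.I)
  have hcov : cov[fun ω => (Z ω).re, fun ω => (Z ω).im; μ] = 0 := by
    rw [covariance_eq_sub hpair.fst.memLp_two hpair.snd.memLp_two]
    have h1 : ∫ ω, (Z ω).re ∂μ = 0 := by simpa using h.integral_re_mul 1
    have h2 : ∫ ω, (Z ω ^ 2).im ∂μ = 0 := by
      have := integral_im h.integrable_sq
      rw [h.sq_mean] at this
      simpa using this
    have h3 : ∀ ω, ((fun ω => (Z ω).re) * fun ω => (Z ω).im) ω = (Z ω ^ 2).im / 2 := by
      intro ω
      simp only [Pi.mul_apply, sq, Complex.mul_im]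
      ring
    rw [h1, zero_mul, sub_zero, integral_congr_ae (.of_forall h3), integral_div, h2, zero_div]
  have hind := hpair.indepFun_of_covariance_eq_zero hcov
  have hlaw : μ.map (fun ω => ((Z ω).re, (Z ω).im)) =
      (gaussianReal 0 (1 / 2)).prod (gaussianReal 0 (1 / 2)) := by
    rw [← hre, (indepFun_iff_map_prod_eq_prod_map_map hpair.fst.aemeasurable
      hpair.snd.aemeasurable).1 hind, hre, him]
  have hne : (1 / 2 : NNReal) ≠ 0 := by norm_num
  rw [gaussianReal_of_var_ne_zero _ hne, prod_withDensity (measurable_gaussianPDF _ _)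
    (measurable_gaussianPDF _ _)] at hlaw
  have hcomp : μ.map Z =
      (μ.map fun ω => ((Z ω).re, (Z ω).im)).map Complex.measurableEquivRealProd.symm := by
    rw [AEMeasurable.map_map_of_aemeasurable
      Complex.measurableEquivRealProd.symm.measurable.aemeasurable hpair.aemeasurable]
    rfl
  rw [hcomp, hlaw]
  ext B hB
  rw [Measure.map_apply Complex.measurableEquivRealProd.symm.measurable hB,
    withDensity_apply _ (Complex.measurableEquivRealProd.symm.measurable hB),
    withDensity_apply _ hB]
  rw [← Complex.volume_preserving_equiv_real_prod.symm.setLIntegral_comp_preimage hB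
    (by fun_prop)]
  refine lintegral_congr fun p => ?_
  rw [gaussianPDF_def, ← ENNReal.ofReal_mul (gaussianPDFReal_nonneg _ _ _), gaussianPDFReal_def]
  congr 1
  have hn : ‖Complex.measurableEquivRealProd.symm p‖ ^ 2 = p.1 ^ 2 + p.2 ^ 2 := by
    rw [Complex.sq_norm, Complex.normSq_apply]
    simp [Complex.measurableEquivRealProd_symm_apply, sq]
  rw [hn]
  have e : 2 * Real.pi * ((1 / 2 : NNReal) : ℝ) = Real.pi := by
    push_cast; ring
  simp only [e]
  have e2 : Real.pi⁻¹ = (√Real.pi)⁻¹ * (√Real.pi)⁻¹ := by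
    rw [← mul_inv, Real.mul_self_sqrt Real.pi_pos.le]
  rw [e2, neg_add, Real.exp_add]
  push_cast
  ring_nf

theorem integral_pow_mul_conj_pow_mul_exp (m l : ℕ) :
    ∫ z : ℂ, (Real.pi⁻¹ * Real.exp (-‖z‖ ^ 2)) • (z ^ m * (starRingEnd ℂ) z ^ l) =
      if m = l then (m.factorial : ℂ) else 0 := by
  split_ifs with hml
  · subst hml
    have e : ∀ z : ℂ, (Real.pi⁻¹ * Real.exp (-‖z‖ ^ 2)) • (z ^ m * (starRingEnd ℂ) z ^ m) =
        ((Real.pi⁻¹ * (‖z‖ ^ (2 * m : ℝ) * Real.exp (-‖z‖ ^ (2 : ℝ))) : ℝ) : ℂ) := by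
      intro z
      rw [← mul_pow, Complex.mul_conj, Complex.normSq_eq_norm_sq, Complex.real_smul]
      have : ‖z‖ ^ (2 * m : ℝ) = (‖z‖ ^ 2) ^ m := by
        rw [← pow_mul]
        exact_mod_cast Real.rpow_natCast ‖z‖ (2 * m)
      rw [this]
      norm_num
      ring
    simp only [e]
    rw [integral_complex_ofReal, integral_const_mul,
      Complex.integral_rpow_mul_exp_neg_rpow (by norm_num)
        (by have : (0 : ℝ) ≤ 2 * m := by positivity
            linarith)]
    have e3 : (2 * (m : ℝ) + 2) / 2 = m + 1 := by ring
    rw [e3, Real.Gamma_nat_eq_factorial]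
    have := Real.pi_ne_zero
    norm_cast
    field_simp
  · set I := ∫ z : ℂ, (Real.pi⁻¹ * Real.exp (-‖z‖ ^ 2)) • (z ^ m * (starRingEnd ℂ) z ^ l) with hI
    have hml' : ((m : ℝ) - l) ≠ 0 := sub_ne_zero.2 (by exact_mod_cast hml)
    set φ : ℝ := Real.pi / (m - l) with hφ
    have hrot := (rotation (Circle.exp φ)).measurePreserving.integral_comp
      (rotation (Circle.exp φ)).toHomeomorph.measurableEmbedding
      (fun z : ℂ => (Real.pi⁻¹ * Real.exp (-‖z‖ ^ 2)) • (z ^ m * (starRingEnd ℂ) z ^ l))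
    have hu : ((Circle.exp φ : ℂ)) ^ m * (starRingEnd ℂ) (Circle.exp φ : ℂ) ^ l = -1 := by
      rw [Circle.coe_exp, ← Complex.exp_conj, ← Complex.exp_nat_mul, ← Complex.exp_nat_mul,
        ← Complex.exp_add, ← Complex.exp_pi_mul_I]
      congr 1
      have hc : ((m : ℂ) - l) ≠ 0 := by exact_mod_cast hml'
      simp only [hφ, map_mul, Complex.conj_ofReal, Complex.conj_I]
      push_cast
      field_simp
      ring
    have hneg : I = -I := by
      rw [hI]
      conv_lhs => rw [← hrot]
      rw [← integral_neg]
      congr 1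
      ext z
      rw [rotation_apply, norm_mul, Circle.norm_coe, one_mul, map_mul, mul_pow, mul_pow]
      rw [show ((Circle.exp φ : ℂ)) ^ m * z ^ m *
          ((starRingEnd ℂ) (Circle.exp φ : ℂ) ^ l * (starRingEnd ℂ) z ^ l) =
          (((Circle.exp φ : ℂ)) ^ m * (starRingEnd ℂ) (Circle.exp φ : ℂ) ^ l) *
          (z ^ m * (starRingEnd ℂ) z ^ l) by ring, hu, neg_one_mul, smul_neg]
    exact self_eq_neg.1 hneg

/-- Mixed moments of a standard complex Gaussian variable. -/
theorem IsStdComplexGaussian.integral_pow_mul_conj_pow (h : IsStdComplexGaussian Z μ) (m l : ℕ) :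
    ∫ ω, Z ω ^ m * (starRingEnd ℂ) (Z ω) ^ l ∂μ = if m = l then (m.factorial : ℂ) else 0 := by
  have hf : Continuous fun z : ℂ => z ^ m * (starRingEnd ℂ) z ^ l := by fun_prop
  rw [← integral_map (f := fun z : ℂ => z ^ m * (starRingEnd ℂ) z ^ l) h.gaussian.aemeasurable
    hf.aestronglyMeasurable, h.map_eq_withDensity,
    integral_withDensity_eq_integral_toReal_smul (by fun_prop) (by simp)]
  rw [← integral_pow_mul_conj_pow_mul_exp]
  congr 1
  ext z
  rw [ENNReal.toReal_ofReal (by positivity)]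

theorem IsStdComplexGaussian.integrable_pow_mul_conj_pow (h : IsStdComplexGaussian Z μ)
    (m l : ℕ) : Integrable (fun ω => Z ω ^ m * (starRingEnd ℂ) (Z ω) ^ l) μ := by
  have := h.gaussian.isProbabilityMeasure
  have h1 : Integrable (fun ω => ‖Z ω‖ ^ (m + l)) μ :=
    (h.gaussian.memLp (p := ((m + l : ℕ) : ENNReal)) (by simp)).integrable_norm_pow'
  refine h1.mono' ?_ (.of_forall fun ω => ?_)
  · have hf : Continuous fun z : ℂ => z ^ m * (starRingEnd ℂ) z ^ l := by fun_prop
    exact (hf.measurable.comp_aemeasurable h.gaussian.aemeasurable).aestronglyMeasurable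
  · simp [pow_add]

end ComplexGaussian

section Circle

/-- The point `r * exp (i t)`. -/
noncomputable def circlePt (r t : ℝ) : ℂ := r * Complex.exp (Complex.I * t)

theorem continuous_circlePt (r : ℝ) : Continuous (circlePt r) := by
  unfold circlePt; fun_prop

theorem norm_circlePt {r : ℝ} (hr : 0 ≤ r) (t : ℝ) : ‖circlePt r t‖ = r := by
  rw [circlePt, norm_mul, mul_comm Complex.I, Complex.norm_exp_ofReal_mul_I, mul_one,
    Complex.norm_real, Real.norm_of_nonneg hr]

theorem integral_circlePt_pow_mul_conj (r : ℝ) (m n : ℕ) :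
    ∫ t in (0 : ℝ)..(2 * Real.pi), circlePt r t ^ m * (starRingEnd ℂ) (circlePt r t ^ n) =
      if m = n then ((2 * Real.pi * r ^ (2 * n) : ℝ) : ℂ) else 0 := by
  have e : ∀ t : ℝ, circlePt r t ^ m * (starRingEnd ℂ) (circlePt r t ^ n) =
      (r : ℂ) ^ (m + n) * Complex.exp (Complex.I * (m - n) * t) := by
    intro t
    simp only [circlePt, map_pow, map_mul, Complex.conj_ofReal, mul_pow, ← Complex.exp_conj,
      Complex.conj_I, ← Complex.exp_nat_mul, pow_add, map_natCast]
    rw [show Complex.I * (m - n) * t = m * (Complex.I * t) + n * (-Complex.I * t) by ring,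
      Complex.exp_add]
    ring
  simp only [e]
  rw [intervalIntegral.integral_const_mul]
  split_ifs with h
  · subst h
    simp
    ring
  · have hc : Complex.I * ((m : ℂ) - n) ≠ 0 :=
      mul_ne_zero Complex.I_ne_zero (sub_ne_zero.2 (by exact_mod_cast h))
    rw [integral_exp_mul_complex hc]
    have h1 : Complex.exp (Complex.I * (m - n) * ((2 * Real.pi : ℝ) : ℂ)) = 1 := by
      rw [Complex.exp_eq_one_iff]
      exact ⟨(m : ℤ) - n, by push_cast; ring⟩
    rw [h1]
    simp

/-- Extraction of a power series coefficient by integration over a circle. -/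
theorem integral_mul_conj_circlePt_pow {a : ℕ → ℂ} {r : ℝ} (hr : 0 ≤ r)
    (ha : Summable fun m => ‖a m‖ * r ^ m) {f : ℝ → ℂ}
    (hf : ∀ t, HasSum (fun m => a m * circlePt r t ^ m) (f t)) (n : ℕ) :
    ∫ t in (0 : ℝ)..(2 * Real.pi), f t * (starRingEnd ℂ) (circlePt r t ^ n) =
      2 * Real.pi * (a n * r ^ (2 * n)) := by
  have h := intervalIntegral.hasSum_integral_of_dominated_convergence (μ := volume)
    (a := 0) (b := 2 * Real.pi)
    (F := fun (m : ℕ) t => a m * circlePt r t ^ m * (starRingEnd ℂ) (circlePt r t ^ n))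
    (f := fun t => f t * (starRingEnd ℂ) (circlePt r t ^ n))
    (fun m _ => ‖a m‖ * r ^ m * r ^ n)
    (fun m => by
      have := continuous_circlePt r
      exact Continuous.aestronglyMeasurable (by fun_prop))
    (fun m => .of_forall fun t _ => by
      simp [norm_pow, norm_circlePt hr])
    (.of_forall fun t _ => ha.mul_right _)
    (by simp)
    (.of_forall fun t _ => (hf t).mul_right _)
  have e : ∀ m, ∫ t in (0 : ℝ)..(2 * Real.pi),
      a m * circlePt r t ^ m * (starRingEnd ℂ) (circlePt r t ^ n) =
      if m = n then a n * ((2 * Real.pi * r ^ (2 * n) : ℝ) : ℂ) else 0 := by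
    intro m
    simp only [mul_assoc]
    rw [intervalIntegral.integral_const_mul]
    have := integral_circlePt_pow_mul_conj r m n
    rw [this]
    split_ifs with hmn
    · rw [hmn]; push_cast; ring
    · simp
  simp only [e] at h
  rw [h.unique (hasSum_ite_eq n _)]
  push_cast
  ring

/-- Bessel's inequality on the circle of radius `r`. -/
theorem sum_norm_sq_le_integral {a : ℕ → ℂ} {r : ℝ} (hr : 0 ≤ r)
    (ha : Summable fun m => ‖a m‖ * r ^ m) {f : ℝ → ℂ} (hfc : Continuous f)
    (hf : ∀ t, HasSum (fun m => a m * circlePt r t ^ m) (f t)) (S : Finset ℕ) :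
    2 * Real.pi * ∑ m ∈ S, ‖a m‖ ^ 2 * r ^ (2 * m) ≤
      ∫ t in (0 : ℝ)..(2 * Real.pi), ‖f t‖ ^ 2 := by
  have hcp := continuous_circlePt r
  set P : ℝ → ℂ := fun t => ∑ m ∈ S, a m * circlePt r t ^ m with hP
  have hPc : Continuous P := by rw [hP]; fun_prop
  set A : ℂ := 2 * Real.pi * ∑ m ∈ S, ((‖a m‖ ^ 2 * r ^ (2 * m) : ℝ) : ℂ) with hA
  have hterm : ∀ (g : ℝ → ℂ), Continuous g → (∀ m ∈ S, ∫ t in (0 : ℝ)..(2 * Real.pi),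
      g t * (starRingEnd ℂ) (circlePt r t ^ m) = 2 * Real.pi * (a m * r ^ (2 * m))) →
      ∫ t in (0 : ℝ)..(2 * Real.pi), g t * (starRingEnd ℂ) (P t) = A := by
    intro g hg hgm
    have e : ∀ t, g t * (starRingEnd ℂ) (P t) =
        ∑ m ∈ S, (starRingEnd ℂ) (a m) * (g t * (starRingEnd ℂ) (circlePt r t ^ m)) := by
      intro t
      simp only [hP, map_sum, Finset.mul_sum, map_mul]
      refine Finset.sum_congr rfl fun m _ => by ring
    simp only [e]
    rw [intervalIntegral.integral_finsetSum]
    · rw [hA, Finset.mul_sum]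
      refine Finset.sum_congr rfl fun m hm => ?_
      rw [intervalIntegral.integral_const_mul, hgm m hm]
      have := Complex.conj_mul' (a m)
      push_cast
      rw [← this]
      ring
    · intro m _
      exact Continuous.intervalIntegrable (by fun_prop) _ _
  have h1 : ∫ t in (0 : ℝ)..(2 * Real.pi), f t * (starRingEnd ℂ) (P t) = A :=
    hterm f hfc fun m _ => integral_mul_conj_circlePt_pow hr ha hf m
  have h2 : ∫ t in (0 : ℝ)..(2 * Real.pi), P t * (starRingEnd ℂ) (P t) = A := by
    refine hterm P hPc fun m hm => ?_
    have := integral_mul_conj_circlePt_pow (a := fun l => if l ∈ S then a l else 0) (f := P) hr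
      (summable_of_ne_finset_zero (s := S) fun l hl => by simp [hl])
      (fun t => by
        have h := hasSum_sum_of_ne_finset_zero (s := S) (L := .unconditional _)
          (f := fun l => (if l ∈ S then a l else 0) * circlePt r t ^ l)
          (fun l hl => by simp [hl])
        convert h using 1
        exact Finset.sum_congr rfl fun l hl => by simp [hl]) m
    simpa [hm] using this
  have hre : ∀ t, ‖f t - P t‖ ^ 2 = ‖f t‖ ^ 2 - 2 * (f t * (starRingEnd ℂ) (P t)).re +
      (P t * (starRingEnd ℂ) (P t)).re := by
    intro t
    rw [Complex.sq_norm, Complex.sq_norm, Complex.normSq_sub, Complex.mul_conj, Complex.ofReal_re]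
    ring
  have hc1 : Continuous fun t => f t * (starRingEnd ℂ) (P t) := by fun_prop
  have hc2 : Continuous fun t => P t * (starRingEnd ℂ) (P t) := by fun_prop
  have hAre : A.re = 2 * Real.pi * ∑ m ∈ S, ‖a m‖ ^ 2 * r ^ (2 * m) := by
    have : A = ((2 * Real.pi * ∑ m ∈ S, ‖a m‖ ^ 2 * r ^ (2 * m) : ℝ) : ℂ) := by
      rw [hA]; push_cast; rfl
    rw [this, Complex.ofReal_re]
  have hr1 : ∫ t in (0 : ℝ)..(2 * Real.pi), (f t * (starRingEnd ℂ) (P t)).re = A.re := by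
    rw [← h1]
    exact (Complex.reCLM.intervalIntegral_comp_comm (hc1.intervalIntegrable _ _))
  have hr2 : ∫ t in (0 : ℝ)..(2 * Real.pi), (P t * (starRingEnd ℂ) (P t)).re = A.re := by
    rw [← h2]
    exact (Complex.reCLM.intervalIntegral_comp_comm (hc2.intervalIntegrable _ _))
  have hnn : 0 ≤ ∫ t in (0 : ℝ)..(2 * Real.pi), ‖f t - P t‖ ^ 2 :=
    intervalIntegral.integral_nonneg (by positivity) fun t _ => by positivity
  have hi1 : IntervalIntegrable (fun t => ‖f t‖ ^ 2) volume 0 (2 * Real.pi) :=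
    Continuous.intervalIntegrable (by fun_prop) _ _
  have hi2 : IntervalIntegrable (fun t => 2 * (f t * (starRingEnd ℂ) (P t)).re) volume 0
      (2 * Real.pi) :=
    Continuous.intervalIntegrable (continuous_const.mul (Complex.continuous_re.comp hc1)) _ _
  have hi3 : IntervalIntegrable (fun t => (P t * (starRingEnd ℂ) (P t)).re) volume 0
      (2 * Real.pi) := Continuous.intervalIntegrable (Complex.continuous_re.comp hc2) _ _
  simp only [hre] at hnn
  rw [intervalIntegral.integral_add (hi1.sub hi2) hi3, intervalIntegral.integral_sub hi1 hi2,
    intervalIntegral.integral_const_mul, hr1, hr2, hAre] at hnn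
  linarith

end Circle

section ChaosCoeff

open PowerSeries

/-- The coefficient of `z ^ m` in `exp (∑ k ∈ s, z ^ k / √k * x k)`. -/
noncomputable def chaosCoeff (s : Finset ℕ+) (x : ℕ+ → ℂ) (m : ℕ) : ℂ :=
  coeff m (expPoly s fun k => x k / (√((k : ℕ) : ℝ) : ℂ))

theorem chaosCoeff_insert {k : ℕ+} {s : Finset ℕ+} (hk : k ∉ s) (x : ℕ+ → ℂ) (m : ℕ) :
    chaosCoeff (insert k s) x m = ∑ p ∈ Finset.HasAntidiagonal.antidiagonal m,
      coeff p.1 (expMonomial k (x k / (√((k : ℕ) : ℝ) : ℂ))) * chaosCoeff s x p.2 := by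
  rw [chaosCoeff, expPoly, Finset.prod_insert hk, coeff_mul]
  rfl

theorem chaosCoeff_union {s t : Finset ℕ+} (h : Disjoint s t) (x : ℕ+ → ℂ) (m : ℕ) :
    chaosCoeff (s ∪ t) x m = ∑ p ∈ Finset.HasAntidiagonal.antidiagonal m,
      chaosCoeff s x p.1 * chaosCoeff t x p.2 := by
  rw [chaosCoeff, expPoly_union h, coeff_mul]
  rfl

theorem chaosCoeff_empty (x : ℕ+ → ℂ) {m : ℕ} (hm : m ≠ 0) : chaosCoeff ∅ x m = 0 :=
  coeff_expPoly_eq_zero _ hm (by simp)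

theorem dependsOn_chaosCoeff (s : Finset ℕ+) (m : ℕ) :
    DependsOn (fun x => chaosCoeff s x m) (s : Set ℕ+) := by
  intro x y h
  simp only [chaosCoeff, expPoly]
  congr 1
  exact Finset.prod_congr rfl fun k hk => by rw [h k (Finset.mem_coe.2 hk)]

theorem measurable_coeff_expMonomial (k : ℕ+) (m : ℕ) : Measurable fun x : ℕ+ → ℂ =>
    coeff m (expMonomial k (x k / (√((k : ℕ) : ℝ) : ℂ))) := by
  simp only [coeff_expMonomial]
  split_ifs <;> fun_prop

theorem measurable_chaosCoeff (s : Finset ℕ+) (m : ℕ) :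
    Measurable fun x => chaosCoeff s x m := by
  classical
  induction s using Finset.induction_on generalizing m with
  | empty => simp only [chaosCoeff, expPoly, Finset.prod_empty]; exact measurable_const
  | insert k s hk ih =>
    simp only [chaosCoeff_insert hk]
    exact Finset.measurable_sum _ fun p _ => (measurable_coeff_expMonomial k _).mul (ih _)

variable {Ω : Type*} {mΩ : MeasurableSpace Ω} {μ : Measure Ω} {N : ℕ+ → Ω → ℂ}

theorem integrable_and_integral_coeff_expMonomial {k : ℕ+} (hG : IsStdComplexGaussian (N k) μ)
    (m l : ℕ) :
    Integrable (fun ω => coeff m (expMonomial k (N k ω / (√((k : ℕ) : ℝ) : ℂ))) *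
      (starRingEnd ℂ) (coeff l (expMonomial k (N k ω / (√((k : ℕ) : ℝ) : ℂ))))) μ ∧
    ∫ ω, coeff m (expMonomial k (N k ω / (√((k : ℕ) : ℝ) : ℂ))) *
      (starRingEnd ℂ) (coeff l (expMonomial k (N k ω / (√((k : ℕ) : ℝ) : ℂ)))) ∂μ =
      if m = l then ((coeff m (expMonomial k (((k : ℕ) : ℝ)⁻¹)) : ℝ) : ℂ) else 0 := by
  simp only [coeff_expMonomial]
  by_cases hm : (k : ℕ) ∣ m; swap
  · simp [hm]
  by_cases hl : (k : ℕ) ∣ l; swap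
  · have : m ≠ l := by rintro rfl; exact hl hm
    simp [hl, this]
  obtain ⟨i, rfl⟩ := hm
  obtain ⟨j, rfl⟩ := hl
  simp only [dvd_mul_right, if_true, Nat.mul_div_cancel_left _ k.pos]
  set w : ℂ := (√((k : ℕ) : ℝ) : ℂ) with hw
  have hk0 : (0 : ℝ) < ((k : ℕ) : ℝ) := by exact_mod_cast k.pos
  have hw2 : w * w = ((k : ℕ) : ℂ) := by
    rw [hw, ← Complex.ofReal_mul, Real.mul_self_sqrt hk0.le]; simp
  have hwc : (starRingEnd ℂ) w = w := Complex.conj_ofReal _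
  have e : ∀ ω, (N k ω / w) ^ i / (i.factorial : ℂ) *
      (starRingEnd ℂ) ((N k ω / w) ^ j / (j.factorial : ℂ)) =
      (w ^ i * w ^ j * i.factorial * j.factorial)⁻¹ *
        (N k ω ^ i * (starRingEnd ℂ) (N k ω) ^ j) := by
    intro ω
    simp only [map_div₀, map_pow, hwc, map_natCast, div_pow]
    rw [mul_inv, mul_inv, mul_inv]
    ring
  simp only [e]
  refine ⟨(hG.integrable_pow_mul_conj_pow i j).const_mul _, ?_⟩
  rw [integral_const_mul, hG.integral_pow_mul_conj_pow i j]
  have hiff : (k : ℕ) * i = k * j ↔ i = j :=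
    ⟨fun h => Nat.eq_of_mul_eq_mul_left k.pos h, fun h => by rw [h]⟩
  simp only [hiff]
  split_ifs with hij
  · subst hij
    have hf : (i.factorial : ℂ) ≠ 0 := by exact_mod_cast Nat.factorial_ne_zero i
    rw [← mul_pow, hw2]
    push_cast
    field_simp
    rw [← mul_pow, mul_one_div_cancel (by exact_mod_cast k.pos.ne'), one_pow]
  · simp

theorem integrable_and_integral_chaosCoeff (hG : ∀ k, IsStdComplexGaussian (N k) μ)
    (hI : iIndepFun N μ) (hm : ∀ k, Measurable (N k)) (s : Finset ℕ+) (m l : ℕ) :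
    Integrable (fun ω => chaosCoeff s (fun k => N k ω) m *
      (starRingEnd ℂ) (chaosCoeff s (fun k => N k ω) l)) μ ∧
    ∫ ω, chaosCoeff s (fun k => N k ω) m * (starRingEnd ℂ) (chaosCoeff s (fun k => N k ω) l) ∂μ =
      if m = l then (varCoeff s m : ℂ) else 0 := by
  classical
  have := hI.isProbabilityMeasure
  have hmN : Measurable fun ω => fun k => N k ω := measurable_pi_lambda _ hm
  induction s using Finset.induction_on generalizing m l with
  | empty =>
    have h0 : ∀ (x : ℕ+ → ℂ) (n : ℕ), chaosCoeff ∅ x n = if n = 0 then 1 else 0 := by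
      intro x n
      simp [chaosCoeff, expPoly, coeff_one]
    have h1 : ∀ n : ℕ, varCoeff ∅ n = if n = 0 then 1 else 0 := by
      intro n
      simp [varCoeff, expPoly, coeff_one]
    simp only [h0, h1]
    refine ⟨integrable_const _, ?_⟩
    rw [integral_const]
    by_cases hm0 : m = 0 <;> by_cases hl0 : l = 0 <;> simp [hm0, hl0]
    exact fun h => hl0 h.symm
  | insert k s hk ih =>
    set f : ℕ → ℕ → (ℕ+ → ℂ) → ℂ := fun i j x =>
      coeff i (expMonomial k (x k / (√((k : ℕ) : ℝ) : ℂ))) *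
      (starRingEnd ℂ) (coeff j (expMonomial k (x k / (√((k : ℕ) : ℝ) : ℂ)))) with hf
    set g : ℕ → ℕ → (ℕ+ → ℂ) → ℂ := fun i j x =>
      chaosCoeff s x i * (starRingEnd ℂ) (chaosCoeff s x j) with hg
    have hfm : ∀ i j, Measurable (f i j) := fun i j =>
      (measurable_coeff_expMonomial k i).mul
        (Complex.continuous_conj.measurable.comp (measurable_coeff_expMonomial k j))
    have hgm : ∀ i j, Measurable (g i j) := fun i j =>
      (measurable_chaosCoeff s i).mul
        (Complex.continuous_conj.measurable.comp (measurable_chaosCoeff s j))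
    have hind : ∀ i j i' j', IndepFun (fun ω => f i j fun k => N k ω)
        (fun ω => g i' j' fun k => N k ω) μ := by
      intro i j i' j'
      refine indepFun_of_dependsOn hI hm (s := {k}) (t := s) (by simpa using hk) (hfm i j)
        (hgm i' j') ?_ ?_
      · intro x y h
        have : x k = y k := h k (by simp)
        simp only [hf, this]
      · intro x y h
        have h1 : chaosCoeff s x i' = chaosCoeff s y i' := dependsOn_chaosCoeff s i' h
        have h2 : chaosCoeff s x j' = chaosCoeff s y j' := dependsOn_chaosCoeff s j' h
        simp only [hg, h1, h2]
    have hfi : ∀ i j, Integrable (fun ω => f i j fun k => N k ω) μ := fun i j =>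
      (integrable_and_integral_coeff_expMonomial (hG k) i j).1
    have hfv : ∀ i j, ∫ ω, f i j (fun k => N k ω) ∂μ =
        if i = j then ((coeff i (expMonomial k (((k : ℕ) : ℝ)⁻¹)) : ℝ) : ℂ) else 0 := fun i j =>
      (integrable_and_integral_coeff_expMonomial (hG k) i j).2
    have hgi : ∀ i j, Integrable (fun ω => g i j fun k => N k ω) μ := fun i j => (ih i j).1
    have hgv : ∀ i j, ∫ ω, g i j (fun k => N k ω) ∂μ =
        if i = j then (varCoeff s i : ℂ) else 0 := fun i j => (ih i j).2
    have hfgi : ∀ i j i' j', Integrable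
        (fun ω => f i j (fun k => N k ω) * g i' j' fun k => N k ω) μ := fun i j i' j' =>
      (hind i j i' j').integrable_mul (hfi i j) (hgi i' j')
    have hfgv : ∀ i j i' j', ∫ ω, f i j (fun k => N k ω) * g i' j' (fun k => N k ω) ∂μ =
        (if i = j then ((coeff i (expMonomial k (((k : ℕ) : ℝ)⁻¹)) : ℝ) : ℂ) else 0) *
        (if i' = j' then (varCoeff s i' : ℂ) else 0) := by
      intro i j i' j'
      rw [(hind i j i' j').integral_fun_mul_eq_mul_integral
        ((hfm i j).comp hmN).aestronglyMeasurable ((hgm i' j').comp hmN).aestronglyMeasurable,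
        hfv, hgv]
    have hexp : ∀ ω, chaosCoeff (insert k s) (fun k => N k ω) m *
        (starRingEnd ℂ) (chaosCoeff (insert k s) (fun k => N k ω) l) =
        ∑ p ∈ Finset.HasAntidiagonal.antidiagonal m, ∑ q ∈ Finset.HasAntidiagonal.antidiagonal l,
          f p.1 q.1 (fun k => N k ω) * g p.2 q.2 (fun k => N k ω) := by
      intro ω
      rw [chaosCoeff_insert hk, chaosCoeff_insert hk, map_sum, Finset.sum_mul_sum]
      refine Finset.sum_congr rfl fun p _ => Finset.sum_congr rfl fun q _ => ?_
      simp only [hf, hg, map_mul]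
      ring
    simp only [hexp]
    refine ⟨integrable_finsetSum _ fun p _ => integrable_finsetSum _ fun q _ => hfgi _ _ _ _, ?_⟩
    rw [integral_finsetSum _ fun p _ => integrable_finsetSum _ fun q _ => hfgi _ _ _ _]
    rw [Finset.sum_congr rfl fun p _ => integral_finsetSum _ fun q _ => hfgi _ _ _ _]
    simp only [hfgv]
    by_cases hml : m = l
    · subst hml
      rw [if_pos rfl, varCoeff, expPoly, Finset.prod_insert hk, coeff_mul]
      push_cast
      refine Finset.sum_congr rfl fun p hp => ?_
      rw [Finset.sum_eq_single p]
      · simp [varCoeff, expPoly]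
      · intro q hq hne
        by_cases h1 : p.1 = q.1
        · exfalso
          rw [Finset.HasAntidiagonal.mem_antidiagonal] at hp hq
          exact hne (Prod.ext h1.symm (by omega))
        · simp [h1]
      · intro h; exact absurd hp h
    · rw [if_neg hml]
      refine Finset.sum_eq_zero fun p hp => Finset.sum_eq_zero fun q hq => ?_
      rw [Finset.HasAntidiagonal.mem_antidiagonal] at hp hq
      by_cases h1 : p.1 = q.1
      · have h2 : p.2 ≠ q.2 := by omega
        simp [h2]
      · simp [h1]

theorem integrable_norm_chaosCoeff_sq (hG : ∀ k, IsStdComplexGaussian (N k) μ)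
    (hI : iIndepFun N μ) (hm : ∀ k, Measurable (N k)) (s : Finset ℕ+) (m : ℕ) :
    Integrable (fun ω => ‖chaosCoeff s (fun k => N k ω) m‖ ^ 2) μ := by
  have h := (integrable_and_integral_chaosCoeff hG hI hm s m m).1.re
  refine h.congr (.of_forall fun ω => ?_)
  simp only [Complex.mul_conj, Complex.normSq_eq_norm_sq]
  exact Complex.ofReal_re _

theorem integral_norm_chaosCoeff_sq (hG : ∀ k, IsStdComplexGaussian (N k) μ)
    (hI : iIndepFun N μ) (hm : ∀ k, Measurable (N k)) (s : Finset ℕ+) (m : ℕ) :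
    ∫ ω, ‖chaosCoeff s (fun k => N k ω) m‖ ^ 2 ∂μ = varCoeff s m := by
  have h := (integrable_and_integral_chaosCoeff hG hI hm s m m).2
  simp only [Complex.mul_conj, Complex.normSq_eq_norm_sq, if_true] at h
  rw [integral_complex_ofReal] at h
  exact_mod_cast h

/-- The increment of a coefficient when the independent frequencies `t` are added, in mean square
over an event that is determined by the frequencies `s`. -/
theorem setIntegral_norm_chaosCoeff_sub_sq (hG : ∀ k, IsStdComplexGaussian (N k) μ)
    (hI : iIndepFun N μ) (hm : ∀ k, Measurable (N k)) {s t : Finset ℕ+} (hst : Disjoint s t)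
    {E : Set (ℕ+ → ℂ)} (hE : MeasurableSet E) (hEs : DependsOn (· ∈ E) (s : Set ℕ+)) (n : ℕ) :
    ∫ ω in {ω | (fun k => N k ω) ∈ E},
      ‖chaosCoeff (s ∪ t) (fun k => N k ω) n - chaosCoeff s (fun k => N k ω) n‖ ^ 2 ∂μ =
    ∑ p ∈ (Finset.HasAntidiagonal.antidiagonal n).filter (fun p => p.2 ≠ 0), varCoeff t p.2 *
      ∫ ω in {ω | (fun k => N k ω) ∈ E}, ‖chaosCoeff s (fun k => N k ω) p.1‖ ^ 2 ∂μ := by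
  classical
  have := hI.isProbabilityMeasure
  have hmN : Measurable fun ω => fun k => N k ω := measurable_pi_lambda _ hm
  have hE' : MeasurableSet {ω | (fun k => N k ω) ∈ E} := hmN hE
  set A := (Finset.HasAntidiagonal.antidiagonal n).filter (fun p => p.2 ≠ 0) with hA
  set f : ℕ → ℕ → (ℕ+ → ℂ) → ℂ := fun i j => E.indicator fun x =>
    chaosCoeff s x i * (starRingEnd ℂ) (chaosCoeff s x j) with hf
  set g : ℕ → ℕ → (ℕ+ → ℂ) → ℂ := fun i j x =>
    chaosCoeff t x i * (starRingEnd ℂ) (chaosCoeff t x j) with hg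
  have hfm : ∀ i j, Measurable (f i j) := fun i j => Measurable.indicator
    ((measurable_chaosCoeff s i).mul
      (Complex.continuous_conj.measurable.comp (measurable_chaosCoeff s j))) hE
  have hgm : ∀ i j, Measurable (g i j) := fun i j =>
    (measurable_chaosCoeff t i).mul
      (Complex.continuous_conj.measurable.comp (measurable_chaosCoeff t j))
  have hfind : ∀ i j ω, f i j (fun k => N k ω) = ({ω | (fun k => N k ω) ∈ E}).indicator
      (fun ω => chaosCoeff s (fun k => N k ω) i *
        (starRingEnd ℂ) (chaosCoeff s (fun k => N k ω) j)) ω := fun i j ω => rfl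
  have hfi : ∀ i j, Integrable (fun ω => f i j fun k => N k ω) μ := by
    intro i j
    simp only [hfind]
    exact (integrable_and_integral_chaosCoeff hG hI hm s i j).1.indicator hE'
  have hgi : ∀ i j, Integrable (fun ω => g i j fun k => N k ω) μ := fun i j =>
    (integrable_and_integral_chaosCoeff hG hI hm t i j).1
  have hind : ∀ i j i' j', IndepFun (fun ω => f i j fun k => N k ω)
      (fun ω => g i' j' fun k => N k ω) μ := by
    intro i j i' j'
    refine indepFun_of_dependsOn hI hm hst (hfm i j) (hgm i' j') ?_ ?_
    · intro x y h
      have h1 : chaosCoeff s x i = chaosCoeff s y i := dependsOn_chaosCoeff s i h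
      have h2 : chaosCoeff s x j = chaosCoeff s y j := dependsOn_chaosCoeff s j h
      have h3 := hEs h
      simp only [eq_iff_iff] at h3
      by_cases hy : y ∈ E
      · simp [hf, h1, h2, hy, h3.2 hy]
      · simp [hf, hy, mt h3.1 hy]
    · intro x y h
      have h1 : chaosCoeff t x i' = chaosCoeff t y i' := dependsOn_chaosCoeff t i' h
      have h2 : chaosCoeff t x j' = chaosCoeff t y j' := dependsOn_chaosCoeff t j' h
      simp only [hg, h1, h2]
  have hfgi : ∀ i j i' j', Integrable
      (fun ω => f i j (fun k => N k ω) * g i' j' fun k => N k ω) μ := fun i j i' j' =>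
    (hind i j i' j').integrable_mul (hfi i j) (hgi i' j')
  have hfgv : ∀ i j i' j', ∫ ω, f i j (fun k => N k ω) * g i' j' (fun k => N k ω) ∂μ =
      (∫ ω, f i j (fun k => N k ω) ∂μ) * (if i' = j' then (varCoeff t i' : ℂ) else 0) := by
    intro i j i' j'
    rw [(hind i j i' j').integral_fun_mul_eq_mul_integral
      ((hfm i j).comp hmN).aestronglyMeasurable ((hgm i' j').comp hmN).aestronglyMeasurable]
    congr 1
    exact (integrable_and_integral_chaosCoeff hG hI hm t i' j').2
  have hD : ∀ x : ℕ+ → ℂ, chaosCoeff (s ∪ t) x n - chaosCoeff s x n =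
      ∑ p ∈ A, chaosCoeff s x p.1 * chaosCoeff t x p.2 := by
    intro x
    rw [chaosCoeff_union hst, ← Finset.sum_filter_add_sum_filter_not _ (fun p : ℕ × ℕ => p.2 ≠ 0)]
    have : ∑ p ∈ (Finset.HasAntidiagonal.antidiagonal n).filter (fun p => ¬ p.2 ≠ 0),
        chaosCoeff s x p.1 * chaosCoeff t x p.2 = chaosCoeff s x n := by
      rw [Finset.sum_eq_single (n, 0)]
      · simp [chaosCoeff, coeff_zero_expPoly]
      · rintro ⟨i, j⟩ hij hne
        simp only [Finset.mem_filter, Finset.HasAntidiagonal.mem_antidiagonal, not_not] at hij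
        exact absurd (Prod.ext (by simp; omega) hij.2) hne
      · intro h
        simp at h
    rw [this]
    ring
  have hsq : ∀ ω, (((({ω | (fun k => N k ω) ∈ E}).indicator (fun ω =>
      ‖chaosCoeff (s ∪ t) (fun k => N k ω) n - chaosCoeff s (fun k => N k ω) n‖ ^ 2) ω : ℝ)) : ℂ) =
      ∑ p ∈ A, ∑ q ∈ A, f p.1 q.1 (fun k => N k ω) * g p.2 q.2 (fun k => N k ω) := by
    intro ω
    by_cases hω : (fun k => N k ω) ∈ E
    · have hω' : ω ∈ {ω | (fun k => N k ω) ∈ E} := hω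
      rw [Set.indicator_of_mem hω']
      have : ((‖chaosCoeff (s ∪ t) (fun k => N k ω) n - chaosCoeff s (fun k => N k ω) n‖ ^ 2 : ℝ) :
          ℂ) = (∑ p ∈ A, chaosCoeff s (fun k => N k ω) p.1 * chaosCoeff t (fun k => N k ω) p.2) *
          (starRingEnd ℂ)
            (∑ p ∈ A, chaosCoeff s (fun k => N k ω) p.1 * chaosCoeff t (fun k => N k ω) p.2) := by
        rw [hD, Complex.mul_conj, Complex.normSq_eq_norm_sq]
      rw [this, map_sum, Finset.sum_mul_sum]
      refine Finset.sum_congr rfl fun p _ => Finset.sum_congr rfl fun q _ => ?_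
      simp only [hf, hg, map_mul]
      rw [Set.indicator_of_mem hω]
      ring
    · have hω' : ω ∉ {ω | (fun k => N k ω) ∈ E} := hω
      rw [Set.indicator_of_notMem hω', Complex.ofReal_zero]
      refine (Finset.sum_eq_zero fun p _ => Finset.sum_eq_zero fun q _ => ?_).symm
      simp only [hf]
      rw [Set.indicator_of_notMem hω, zero_mul]
  have hdiag : ∀ i, ∫ ω, f i i (fun k => N k ω) ∂μ =
      ((∫ ω in {ω | (fun k => N k ω) ∈ E}, ‖chaosCoeff s (fun k => N k ω) i‖ ^ 2 ∂μ : ℝ) : ℂ) := by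
    intro i
    simp only [hfind]
    rw [integral_indicator hE', ← integral_complex_ofReal]
    simp only [Complex.mul_conj, Complex.normSq_eq_norm_sq]
  have key : ((∫ ω in {ω | (fun k => N k ω) ∈ E},
      ‖chaosCoeff (s ∪ t) (fun k => N k ω) n - chaosCoeff s (fun k => N k ω) n‖ ^ 2 ∂μ : ℝ) : ℂ) =
      ∑ p ∈ A, ((varCoeff t p.2 *
        ∫ ω in {ω | (fun k => N k ω) ∈ E}, ‖chaosCoeff s (fun k => N k ω) p.1‖ ^ 2 ∂μ : ℝ) : ℂ) := by
    rw [← integral_indicator hE', ← integral_complex_ofReal, integral_congr_ae (.of_forall hsq)]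
    rw [integral_finsetSum _ fun p _ => integrable_finsetSum _ fun q _ => hfgi _ _ _ _]
    refine Finset.sum_congr rfl fun p hp => ?_
    rw [integral_finsetSum _ fun q _ => hfgi _ _ _ _]
    simp only [hfgv]
    rw [Finset.sum_eq_single p]
    · rw [if_pos rfl, hdiag]
      push_cast
      ring
    · intro q hq hne
      have : p.2 ≠ q.2 := by
        intro h
        simp only [hA, Finset.mem_filter, Finset.HasAntidiagonal.mem_antidiagonal] at hp hq
        exact hne (Prod.ext (by omega) h.symm)
      simp [this]
    · intro h; exact absurd hp h
  exact_mod_cast key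

end ChaosCoeff

section Frequencies

/-- The frequencies below `2 ^ i`. -/
def lowFreq (i : ℕ) : Finset ℕ+ := Finset.Ico 1 (2 ^ i)

/-- The frequencies in `[2 ^ i, 2 ^ (i + 1))`. -/
def blockFreq (i : ℕ) : Finset ℕ+ := Finset.Ico (2 ^ i) (2 ^ (i + 1))

theorem mem_lowFreq {i : ℕ} {k : ℕ+} : k ∈ lowFreq i ↔ (k : ℕ) < 2 ^ i := by
  rw [lowFreq, Finset.mem_Ico, ← PNat.coe_lt_coe]
  simp

theorem mem_blockFreq {i : ℕ} {k : ℕ+} :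
    k ∈ blockFreq i ↔ 2 ^ i ≤ (k : ℕ) ∧ (k : ℕ) < 2 ^ (i + 1) := by
  rw [blockFreq, Finset.mem_Ico, ← PNat.coe_lt_coe, ← PNat.coe_le_coe]
  simp

theorem disjoint_lowFreq_blockFreq {i j : ℕ} (h : i ≤ j) :
    Disjoint (lowFreq i) (blockFreq j) := by
  rw [Finset.disjoint_left]
  intro k hk hk'
  rw [mem_lowFreq] at hk
  rw [mem_blockFreq] at hk'
  have := Nat.pow_le_pow_right (n := 2) (by norm_num) h
  omega

theorem disjoint_blockFreq {i j : ℕ} (h : i ≠ j) : Disjoint (blockFreq i) (blockFreq j) := by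
  have key : ∀ {a b : ℕ}, a < b → Disjoint (blockFreq a) (blockFreq b) := by
    intro a b hab
    rw [Finset.disjoint_left]
    intro k hk hk'
    rw [mem_blockFreq] at hk hk'
    have := Nat.pow_le_pow_right (n := 2) (by norm_num) (Nat.succ_le_of_lt hab)
    omega
  rcases lt_or_gt_of_ne h with h | h
  · exact key h
  · exact (key h).symm

theorem lowFreq_succ (i : ℕ) : lowFreq (i + 1) = lowFreq i ∪ blockFreq i := by
  ext k
  rw [Finset.mem_union, mem_lowFreq, mem_lowFreq, mem_blockFreq]
  have := Nat.pow_lt_pow_succ (a := 2) (n := i) (by norm_num)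
  omega

theorem lowFreq_zero : lowFreq 0 = ∅ := by
  ext k
  simp [mem_lowFreq]

theorem lowFreq_mono : Monotone lowFreq := by
  intro i j h k hk
  rw [mem_lowFreq] at *
  exact hk.trans_le (Nat.pow_le_pow_right (by norm_num) h)

theorem sum_lowFreq {α : Type*} [AddCommMonoid α] (f : ℕ+ → α) (i : ℕ) :
    ∑ k ∈ lowFreq i, f k = ∑ l ∈ Finset.range i, ∑ k ∈ blockFreq l, f k := by
  induction i with
  | zero => simp [lowFreq_zero]
  | succ i ih =>
    rw [lowFreq_succ, Finset.sum_union (disjoint_lowFreq_blockFreq le_rfl), ih,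
      Finset.sum_range_succ]

theorem tendsto_lowFreq : Filter.Tendsto lowFreq Filter.atTop Filter.atTop :=
  Filter.tendsto_atTop_finset_of_monotone lowFreq_mono fun k =>
    ⟨k, mem_lowFreq.2 Nat.lt_two_pow_self⟩

theorem card_blockFreq (i : ℕ) : (blockFreq i).card = 2 ^ i := by
  rw [blockFreq, PNat.card_Ico]
  simp [pow_succ]
  omega

theorem chaosCoeff_lowFreq_eq {i j n : ℕ} (hij : i ≤ j) (hn : n < 2 ^ i) (x : ℕ+ → ℂ) :
    chaosCoeff (lowFreq j) x n = chaosCoeff (lowFreq i) x n :=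
  coeff_expPoly_of_subset (lowFreq_mono hij) _ fun _ _ hk => mem_lowFreq.2 (hk.trans_lt hn)

end Frequencies

section HmcCoeff

/-- The exponent restricted to the frequencies in `s`. -/
noncomputable def partialField (s : Finset ℕ+) (x : ℕ+ → ℂ) (z : ℂ) : ℂ :=
  ∑ k ∈ s, x k / (√((k : ℕ) : ℝ) : ℂ) * z ^ (k : ℕ)

theorem summable_chaosCoeff (s : Finset ℕ+) (x : ℕ+ → ℂ) {r : ℝ} (hr : 0 ≤ r) :
    Summable fun m => ‖chaosCoeff s x m‖ * r ^ m := by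
  have := summable_norm_expPoly s (fun k => x k / (√((k : ℕ) : ℝ) : ℂ)) (r : ℂ)
  simpa [norm_mul, chaosCoeff, abs_of_nonneg hr] using this

theorem hasSum_chaosCoeff (s : Finset ℕ+) (x : ℕ+ → ℂ) (z : ℂ) :
    HasSum (fun m => chaosCoeff s x m * z ^ m) (Complex.exp (partialField s x z)) := by
  rw [Complex.exp_eq_exp_ℂ]
  exact hasSum_expPoly s (fun k => x k / (√((k : ℕ) : ℝ) : ℂ)) z

theorem continuous_partialField (s : Finset ℕ+) (x : ℕ+ → ℂ) : Continuous (partialField s x) := by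
  unfold partialField; fun_prop

theorem one_le_sqrt_pnat (k : ℕ+) : 1 ≤ √((k : ℕ) : ℝ) := by
  rw [Real.one_le_sqrt]
  exact Nat.one_le_cast.2 k.pos

theorem norm_partialField_term_le (x : ℕ+ → ℂ) (z : ℂ) (k : ℕ+) :
    ‖x k / (√((k : ℕ) : ℝ) : ℂ) * z ^ (k : ℕ)‖ ≤ ‖x k‖ * ‖z‖ ^ (k : ℕ) := by
  rw [norm_mul, norm_pow, norm_div, Complex.norm_real, Real.norm_of_nonneg (Real.sqrt_nonneg _)]
  gcongr
  exact div_le_self (norm_nonneg _) (one_le_sqrt_pnat k)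

theorem integral_exp_gaussianSeries_mul_conj {x : ℕ+ → ℂ} {r : ℝ} (hr : 0 ≤ r)
    (hx : Summable fun k : ℕ+ => ‖x k‖ * r ^ (k : ℕ)) {n i : ℕ} (hn : n < 2 ^ i) :
    ∫ t in (0 : ℝ)..(2 * Real.pi), Complex.exp (gaussianSeries x (circlePt r t)) *
      (starRingEnd ℂ) (circlePt r t ^ n) =
      2 * Real.pi * (chaosCoeff (lowFreq i) x n * r ^ (2 * n)) := by
  have hlim : ∀ t, Filter.Tendsto (fun j => Complex.exp (partialField (lowFreq j) x (circlePt r t)) *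
      (starRingEnd ℂ) (circlePt r t ^ n)) Filter.atTop
      (nhds (Complex.exp (gaussianSeries x (circlePt r t)) *
        (starRingEnd ℂ) (circlePt r t ^ n))) := by
    intro t
    refine Filter.Tendsto.mul_const _ ((Complex.continuous_exp.tendsto _).comp ?_)
    have hs : Summable fun k : ℕ+ => x k / (√((k : ℕ) : ℝ) : ℂ) * circlePt r t ^ (k : ℕ) := by
      refine Summable.of_norm_bounded hx fun k => ?_
      have := norm_partialField_term_le x (circlePt r t) k
      rwa [norm_circlePt hr] at this
    have h := hs.hasSum.comp tendsto_lowFreq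
    have e : ∑' k : ℕ+, x k / (√((k : ℕ) : ℝ) : ℂ) * circlePt r t ^ (k : ℕ) =
        gaussianSeries x (circlePt r t) := by
      rw [gaussianSeries]
      exact tsum_congr fun k => by ring
    rw [e] at h
    exact h
  have hcp := continuous_circlePt r
  have hdom := intervalIntegral.tendsto_integral_filter_of_dominated_convergence (μ := volume)
    (a := 0) (b := 2 * Real.pi) (l := Filter.atTop)
    (F := fun j t => Complex.exp (partialField (lowFreq j) x (circlePt r t)) *
      (starRingEnd ℂ) (circlePt r t ^ n))
    (fun _ => Real.exp (∑' k : ℕ+, ‖x k‖ * r ^ (k : ℕ)) * r ^ n)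
    (.of_forall fun j => by
      have := (continuous_partialField (lowFreq j) x).comp hcp
      refine Continuous.aestronglyMeasurable ?_
      exact (Complex.continuous_exp.comp this).mul (by fun_prop))
    (.of_forall fun j => .of_forall fun t _ => by
      rw [norm_mul, RCLike.norm_conj, norm_pow, norm_circlePt hr]
      gcongr
      refine (Complex.norm_exp_le_exp_norm _).trans (Real.exp_le_exp.2 ?_)
      refine (norm_sum_le _ _).trans ?_
      refine le_trans (Finset.sum_le_sum fun k _ => ?_)
        (hx.sum_le_tsum (lowFreq j) fun k _ => by positivity)
      have := norm_partialField_term_le x (circlePt r t) k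
      rwa [norm_circlePt hr] at this)
    (by simp) (.of_forall fun t _ => hlim t)
  refine tendsto_nhds_unique hdom (tendsto_const_nhds.congr' ?_)
  filter_upwards [Filter.eventually_ge_atTop i] with j hj
  rw [integral_mul_conj_circlePt_pow hr (summable_chaosCoeff (lowFreq j) x hr)
    (fun t => hasSum_chaosCoeff (lowFreq j) x _), chaosCoeff_lowFreq_eq hj hn]

theorem hmcCoeff_one_eq {x : ℕ+ → ℂ}
    (hx : ∀ r : ℝ, 0 ≤ r → r < 1 → Summable fun k : ℕ+ => ‖x k‖ * r ^ (k : ℕ)) {n i : ℕ}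
    (hn : n < 2 ^ i) : hmcCoeff 1 x n = chaosCoeff (lowFreq i) x n := by
  rw [hmcCoeff, hmc]
  refine Filter.Tendsto.limUnder_eq ?_
  have h1 : Filter.Tendsto (fun r : ℝ => chaosCoeff (lowFreq i) x n * (r : ℂ) ^ (2 * n))
      (nhdsWithin 1 (Set.Iio 1)) (nhds (chaosCoeff (lowFreq i) x n)) := by
    have hc : Continuous fun r : ℝ => chaosCoeff (lowFreq i) x n * (r : ℂ) ^ (2 * n) := by fun_prop
    have := hc.tendsto 1
    simp only [Complex.ofReal_one, one_pow, mul_one] at this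
    exact this.mono_left nhdsWithin_le_nhds
  refine h1.congr' ?_
  have hmem : Set.Ioo (0 : ℝ) 1 ∈ nhdsWithin (1 : ℝ) (Set.Iio 1) :=
    Ioo_mem_nhdsLT (by norm_num)
  filter_upwards [hmem] with r hr
  have h := integral_exp_gaussianSeries_mul_conj hr.1.le (hx r hr.1.le hr.2) hn
  simp only [Real.sqrt_one, Complex.ofReal_one, one_mul]
  simp only [circlePt] at h
  rw [h]
  have : (Real.pi : ℂ) ≠ 0 := by exact_mod_cast Real.pi_ne_zero
  field_simp

variable {Ω : Type*} {mΩ : MeasurableSpace Ω} {μ : Measure Ω} {N : ℕ+ → Ω → ℂ}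

theorem ae_summable_norm_mul_pow (hG : ∀ k, IsStdComplexGaussian (N k) μ)
    (hm : ∀ k, Measurable (N k)) :
    ∀ᵐ ω ∂μ, ∀ r : ℝ, 0 ≤ r → r < 1 → Summable fun k : ℕ+ => ‖N k ω‖ * r ^ (k : ℕ) := by
  have hterm : ∀ k : ℕ+, ∫⁻ ω, ENNReal.ofReal (‖N k ω‖ ^ 2 / ((k : ℕ) : ℝ) ^ 2) ∂μ =
      ENNReal.ofReal (1 / ((k : ℕ) : ℝ) ^ 2) := by
    intro k
    have hi : Integrable (fun ω => ‖N k ω‖ ^ 2) μ :=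
      (hG k).gaussian.memLp_two.integrable_norm_pow (by simp)
    rw [← ofReal_integral_eq_lintegral_ofReal (hi.div_const _) (.of_forall fun ω => by positivity),
      integral_div, (hG k).normSq_mean]
  have hfin : ∫⁻ ω, ∑' k : ℕ+, ENNReal.ofReal (‖N k ω‖ ^ 2 / ((k : ℕ) : ℝ) ^ 2) ∂μ ≠ ⊤ := by
    rw [lintegral_tsum fun k => by have := hm k; fun_prop]
    simp only [hterm]
    have hs0 : Summable fun k : ℕ => 1 / (k : ℝ) ^ 2 := Real.summable_one_div_nat_pow.2 (by norm_num)
    have hs : Summable fun k : ℕ+ => 1 / ((k : ℕ) : ℝ) ^ 2 :=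
      hs0.comp_injective PNat.coe_injective
    rw [← ENNReal.ofReal_tsum_of_nonneg (fun k => by positivity) hs]
    exact ENNReal.ofReal_ne_top
  have hmeas : Measurable fun ω => ∑' k : ℕ+, ENNReal.ofReal (‖N k ω‖ ^ 2 / ((k : ℕ) : ℝ) ^ 2) :=
    Measurable.tsum fun k => by have := hm k; fun_prop
  filter_upwards [ae_lt_top hmeas hfin] with ω hω r hr0 hr1
  set T := ∑' k : ℕ+, ENNReal.ofReal (‖N k ω‖ ^ 2 / ((k : ℕ) : ℝ) ^ 2) with hT
  have hb : ∀ k : ℕ+, ‖N k ω‖ ≤ √T.toReal * (k : ℕ) := by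
    intro k
    have hk0 : (0 : ℝ) < ((k : ℕ) : ℝ) := by exact_mod_cast k.pos
    have h1 : ENNReal.ofReal (‖N k ω‖ ^ 2 / ((k : ℕ) : ℝ) ^ 2) ≤ T := ENNReal.le_tsum k
    rw [ENNReal.ofReal_le_iff_le_toReal hω.ne, div_le_iff₀ (by positivity)] at h1
    rw [← Real.sqrt_sq hk0.le, ← Real.sqrt_mul ENNReal.toReal_nonneg]
    exact Real.le_sqrt_of_sq_le h1
  have hs0 : Summable fun k : ℕ => (k : ℝ) ^ 1 * r ^ k :=
    summable_pow_mul_geometric_of_norm_lt_one 1 (by rwa [Real.norm_of_nonneg hr0])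
  have hs : Summable fun k : ℕ+ => √T.toReal * ((((k : ℕ) : ℝ)) ^ 1 * r ^ (k : ℕ)) :=
    (hs0.comp_injective PNat.coe_injective).mul_left _
  refine Summable.of_nonneg_of_le (fun k => by positivity) (fun k => ?_) hs
  rw [pow_one, ← mul_assoc]
  gcongr
  exact hb k

end HmcCoeff

section Independence

variable {Ω ι κ β γ : Type*} {mΩ : MeasurableSpace Ω} {μ : Measure Ω} [MeasurableSpace β]
  [MeasurableSpace γ]

theorem iIndepFun_of_dependsOn [Nonempty β] {X : ι → Ω → β} (hX : iIndepFun X μ)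
    (hm : ∀ i, Measurable (X i)) {s : κ → Finset ι} (hs : ∀ i j, i ≠ j → Disjoint (s i) (s j))
    {f : κ → (ι → β) → γ} (hf : ∀ j, Measurable (f j)) (hfs : ∀ j, DependsOn (f j) (s j)) :
    iIndepFun (fun j ω => f j fun i => X i ω) μ := by
  classical
  have := hX.isProbabilityMeasure
  rw [iIndepFun_iff_measure_inter_preimage_eq_mul]
  intro S
  induction S using Finset.induction_on with
  | empty => intro B _; simp
  | insert a S ha ih =>
    intro B hB
    have hind := indepFun_of_dependsOn hX hm (s := s a) (t := S.biUnion s)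
      (f := f a) (g := fun x (j : S) => f j x)
      ((Finset.disjoint_biUnion_right _ _ _).2 fun j hj => hs a j (by rintro rfl; exact ha hj))
      (hf a) (measurable_pi_lambda _ fun j => hf j) (hfs a) (by
        intro x y h
        ext j
        exact hfs j fun i hi => h i (by
          simp only [Finset.coe_biUnion, Set.mem_iUnion]
          exact ⟨j, j.2, hi⟩))
    have hpre : (⋂ j ∈ S, (fun ω => f j fun i => X i ω) ⁻¹' B j) =
        (fun ω => fun (j : S) => f j fun i => X i ω) ⁻¹' Set.univ.pi fun j : S => B j := by
      ext ω
      simp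
    rw [Finset.set_biInter_insert, Finset.prod_insert ha,
      ← ih fun j hj => hB j (Finset.mem_insert_of_mem hj), hpre]
    exact hind.measure_inter_preimage_eq_mul _ _ (hB a (Finset.mem_insert_self a S))
      (MeasurableSet.univ_pi fun j => hB j (Finset.mem_insert_of_mem j.2))

end Independence

section Energy

theorem sum_inv_lowFreq (j : ℕ) :
    ∑ k ∈ lowFreq j, (((k : ℕ) : ℝ))⁻¹ = ((harmonic (2 ^ j - 1) : ℚ) : ℝ) := by
  rw [harmonic]
  push_cast
  refine Finset.sum_bij' (fun k _ => k.natPred) (fun l _ => l.succPNat) ?_ ?_ ?_ ?_ ?_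
  · intro k hk
    rw [mem_lowFreq] at hk
    rw [Finset.mem_range, PNat.natPred]
    have := k.pos
    omega
  · intro l hl
    rw [Finset.mem_range] at hl
    rw [mem_lowFreq, Nat.succPNat_coe]
    omega
  · intro k _; simp
  · intro l _; simp
  · intro k _
    have : ((k.natPred : ℕ) : ℝ) + 1 = ((k : ℕ) : ℝ) := by exact_mod_cast PNat.natPred_add_one k
    rw [this]

theorem mul_log_two_le_sum_lowFreq (j : ℕ) :
    j * Real.log 2 ≤ ∑ k ∈ lowFreq j, (((k : ℕ) : ℝ))⁻¹ := by
  rw [sum_inv_lowFreq]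
  refine le_trans (le_of_eq ?_) (log_add_one_le_harmonic _)
  rw [Nat.sub_add_cancel Nat.one_le_two_pow]
  push_cast
  rw [Real.log_pow]

theorem sum_lowFreq_inv_le (j : ℕ) :
    ∑ k ∈ lowFreq j, (((k : ℕ) : ℝ))⁻¹ ≤ 1 + j * Real.log 2 := by
  rw [sum_inv_lowFreq]
  refine (harmonic_le_one_add_log _).trans ?_
  gcongr
  rw [← Real.log_pow]
  rcases Nat.eq_zero_or_pos (2 ^ j - 1) with h | h
  · rw [h]
    simp only [Nat.cast_zero, Real.log_zero]
    exact Real.log_nonneg (one_le_pow₀ (by norm_num))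
  · apply Real.log_le_log (by exact_mod_cast h)
    have : 2 ^ j - 1 ≤ 2 ^ j := Nat.sub_le _ _
    exact_mod_cast this

theorem exp_div_two_pow_pow_le {a : ℝ} (ha : 0 ≤ a) {j k : ℕ} (hk : k ≤ 2 ^ j) :
    Real.exp (a / 2 ^ j) ^ k ≤ Real.exp a := by
  rw [← Real.exp_nat_mul]
  apply Real.exp_le_exp.2
  have h2 : (0 : ℝ) < 2 ^ j := by positivity
  have hk' : (k : ℝ) ≤ 2 ^ j := by exact_mod_cast hk
  rw [mul_div_assoc', div_le_iff₀ h2]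
  nlinarith

theorem card_lowFreq_le (j : ℕ) : ((lowFreq j).card : ℝ) ≤ 2 ^ j := by
  rw [lowFreq, PNat.card_Ico]
  have : ((2 ^ j : ℕ+) : ℕ) - ((1 : ℕ+) : ℕ) ≤ 2 ^ j := by simp
  exact_mod_cast this

theorem sum_lowFreq_pow_div_le {a : ℝ} (ha : 0 ≤ a) (j : ℕ) :
    ∑ k ∈ lowFreq j, Real.exp (a / 2 ^ j) ^ (k : ℕ) / (k : ℕ) ≤
      j * Real.log 2 + (1 + a * Real.exp a) := by
  have hterm : ∀ k ∈ lowFreq j, Real.exp (a / 2 ^ j) ^ (k : ℕ) / (k : ℕ) ≤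
      (((k : ℕ) : ℝ))⁻¹ + a * Real.exp a / 2 ^ j := by
    intro k hk
    have hk0 : (0 : ℝ) < ((k : ℕ) : ℝ) := by exact_mod_cast k.pos
    have h1 := exp_div_two_pow_pow_le ha (mem_lowFreq.1 hk).le
    set u := Real.exp (a / 2 ^ j) ^ (k : ℕ) with hu
    have hu' : u = Real.exp ((k : ℕ) * (a / 2 ^ j)) := by rw [hu, Real.exp_nat_mul]
    set y := ((k : ℕ) : ℝ) * (a / 2 ^ j) with hy
    have hy0 : 0 ≤ y := by positivity
    have h2 : u ≤ 1 + y * u := by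
      have h3 := Real.add_one_le_exp (-y)
      have h4 : Real.exp (-y) * u = 1 := by rw [hu', ← Real.exp_add]; simp
      have hupos : 0 < u := by rw [hu']; positivity
      nlinarith
    have h5 : u ≤ 1 + y * Real.exp a := h2.trans (by gcongr)
    rw [div_le_iff₀ hk0]
    refine h5.trans (le_of_eq ?_)
    rw [hy]
    field_simp
  calc _ ≤ ∑ k ∈ lowFreq j, ((((k : ℕ) : ℝ))⁻¹ + a * Real.exp a / 2 ^ j) :=
        Finset.sum_le_sum hterm
    _ = ∑ k ∈ lowFreq j, (((k : ℕ) : ℝ))⁻¹ + (lowFreq j).card * (a * Real.exp a / 2 ^ j) := by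
        rw [Finset.sum_add_distrib, Finset.sum_const, nsmul_eq_mul]
    _ ≤ (1 + j * Real.log 2) + 2 ^ j * (a * Real.exp a / 2 ^ j) := by
        gcongr
        · exact sum_lowFreq_inv_le j
        · exact card_lowFreq_le j
    _ = _ := by field_simp; ring

theorem exp_sum_lowFreq_le {a : ℝ} (ha : 0 ≤ a) (j : ℕ) :
    Real.exp (∑ k ∈ lowFreq j, Real.exp (a / 2 ^ j) ^ (k : ℕ) / (k : ℕ)) ≤
      Real.exp (1 + a * Real.exp a) * 2 ^ j := by
  refine (Real.exp_le_exp.2 (sum_lowFreq_pow_div_le ha j)).trans (le_of_eq ?_)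
  rw [Real.exp_add, Real.exp_nat_mul, Real.exp_log (by norm_num), mul_comm]

theorem sum_blockFreq_inv_le (l : ℕ) : ∑ k ∈ blockFreq l, (((k : ℕ) : ℝ))⁻¹ ≤ 1 := by
  calc ∑ k ∈ blockFreq l, (((k : ℕ) : ℝ))⁻¹ ≤ ∑ k ∈ blockFreq l, ((2 : ℝ) ^ l)⁻¹ := by
        refine Finset.sum_le_sum fun k hk => ?_
        have : (2 : ℝ) ^ l ≤ ((k : ℕ) : ℝ) := by exact_mod_cast (mem_blockFreq.1 hk).1
        gcongr
    _ = 1 := by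
        rw [Finset.sum_const, card_blockFreq, nsmul_eq_mul]
        push_cast
        field_simp

theorem half_le_sum_blockFreq_inv (l : ℕ) : 1 / 2 ≤ ∑ k ∈ blockFreq l, (((k : ℕ) : ℝ))⁻¹ := by
  calc (1 / 2 : ℝ) = ∑ k ∈ blockFreq l, ((2 : ℝ) ^ (l + 1))⁻¹ := by
        rw [Finset.sum_const, card_blockFreq, nsmul_eq_mul]
        push_cast
        rw [pow_succ]
        field_simp
    _ ≤ _ := by
        refine Finset.sum_le_sum fun k hk => ?_
        have h1 : ((k : ℕ) : ℝ) ≤ (2 : ℝ) ^ (l + 1) := by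
          exact_mod_cast (mem_blockFreq.1 hk).2.le
        have hk0 : (0 : ℝ) < ((k : ℕ) : ℝ) := by exact_mod_cast k.pos
        gcongr

end Energy

section Spine

variable {Ω : Type*} {mΩ : MeasurableSpace Ω} {μ : Measure Ω} {N : ℕ+ → Ω → ℂ}

/-- Half the variance of the field at radius `‖z‖` carried by the `l`-th block. -/
noncomputable def blockVar (z : ℂ) (l : ℕ) : NNReal :=
  ∑ k ∈ blockFreq l, ‖z ^ (k : ℕ) / (√((k : ℕ) : ℝ) : ℂ)‖₊ ^ 2 / 2

theorem two_mul_blockVar (z : ℂ) (l : ℕ) :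
    2 * (blockVar z l : ℝ) = ∑ k ∈ blockFreq l, (‖z‖ ^ 2) ^ (k : ℕ) / (k : ℕ) := by
  rw [blockVar]
  push_cast
  rw [Finset.mul_sum]
  refine Finset.sum_congr rfl fun k _ => ?_
  rw [norm_div, Complex.norm_real, Real.norm_of_nonneg (Real.sqrt_nonneg _), div_pow,
    Real.sq_sqrt (by positivity), norm_pow]
  ring

theorem measurable_partialField (s : Finset ℕ+) (z : ℂ) :
    Measurable fun x : ℕ+ → ℂ => partialField s x z := by
  unfold partialField
  fun_prop

theorem dependsOn_partialField (s : Finset ℕ+) (z : ℂ) :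
    DependsOn (fun x : ℕ+ → ℂ => partialField s x z) (s : Set ℕ+) := by
  intro x y h
  exact Finset.sum_congr rfl fun k hk => by rw [h k (Finset.mem_coe.2 hk)]

theorem iIndepFun_re_partialField_blockFreq (hI : iIndepFun N μ) (hm : ∀ k, Measurable (N k))
    (z : ℂ) : iIndepFun (fun l ω => (partialField (blockFreq l) (fun k => N k ω) z).re) μ :=
  iIndepFun_of_dependsOn hI hm (s := blockFreq) (fun _ _ h => disjoint_blockFreq h)
    (f := fun l x => (partialField (blockFreq l) x z).re)
    (fun l => Complex.measurable_re.comp (measurable_partialField _ z))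
    (fun l x y h => by
      have : partialField (blockFreq l) x z = partialField (blockFreq l) y z :=
        dependsOn_partialField _ z h
      simp only [this])

theorem map_re_partialField_blockFreq (hG : ∀ k, IsStdComplexGaussian (N k) μ)
    (hI : iIndepFun N μ) (hm : ∀ k, Measurable (N k)) (z : ℂ) (l : ℕ) :
    μ.map (fun ω => (partialField (blockFreq l) (fun k => N k ω) z).re) =
      gaussianReal 0 (blockVar z l) := by
  have hX : iIndepFun (fun (k : ℕ+) ω => (z ^ (k : ℕ) / (√((k : ℕ) : ℝ) : ℂ) * N k ω).re) μ :=
    hI.comp (fun k w => (z ^ (k : ℕ) / (√((k : ℕ) : ℝ) : ℂ) * w).re) fun k => by fun_prop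
  have h := map_sum_gaussianReal hX (fun k => by have := hm k; fun_prop)
    (v := fun k => ‖z ^ (k : ℕ) / (√((k : ℕ) : ℝ) : ℂ)‖₊ ^ 2 / 2)
    (fun k => (hG k).map_re_mul _) (blockFreq l)
  rw [blockVar, ← h]
  congr 1
  ext ω
  rw [partialField, Complex.re_sum]
  refine Finset.sum_congr rfl fun k _ => ?_
  congr 1
  ring

theorem partialField_lowFreq (x : ℕ+ → ℂ) (z : ℂ) (i : ℕ) :
    partialField (lowFreq i) x z = ∑ l ∈ Finset.range i, partialField (blockFreq l) x z :=
  sum_lowFreq _ i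

/-- The event that the field at `z` stays below its barrier at all dyadic scales up to `i`. -/
def fieldBelow (L : ℝ) (i : ℕ) (z : ℂ) : Set (ℕ+ → ℂ) :=
  {x | ∀ j ≤ i, (partialField (lowFreq j) x z).re ≤ L + j * Real.log 2 + Real.log (j + 1)}

/-- The mean of `|F(z)|²` on the barrier event, at radius `exp (1 / 2 ^ i)`. -/
theorem exists_setLIntegral_norm_exp_sq_le : ∃ C : ℝ, 0 < C ∧ ∀ {Ω : Type*} [MeasurableSpace Ω]
    {μ : Measure Ω} {N : ℕ+ → Ω → ℂ}, (∀ k, IsStdComplexGaussian (N k) μ) → iIndepFun N μ →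
    (∀ k, Measurable (N k)) → ∀ (i : ℕ) (z : ℂ), ‖z‖ = Real.exp (1 / 2 ^ i) →
    ∀ {L : ℝ}, 0 ≤ L →
    ∫⁻ ω in {ω | (fun k => N k ω) ∈ fieldBelow L i z},
      ENNReal.ofReal (‖Complex.exp (partialField (lowFreq i) (fun k => N k ω) z)‖ ^ 2) ∂μ ≤
      ENNReal.ofReal (C * 2 ^ i * ((1 + L) / √(i + 1))) := by
  obtain ⟨C, hC0, hC⟩ := exists_ballot_bound (Real.exp 2 / 2)
  refine ⟨Real.exp (1 + 2 * Real.exp 2) * C, by positivity, ?_⟩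
  intro Ω _ μ N hG hI hm i z hz L hL
  have := hI.isProbabilityMeasure
  have hz2 : ‖z‖ ^ 2 = Real.exp (2 / 2 ^ i) := by
    rw [hz, ← Real.exp_nat_mul]; congr 1; push_cast; ring
  have hz1 : 1 ≤ ‖z‖ ^ 2 := by rw [hz2]; exact Real.one_le_exp (by positivity)
  set η : ℕ → Ω → ℝ := fun l ω => (partialField (blockFreq l) (fun k => N k ω) z).re with hη
  set v : ℕ → NNReal := blockVar z with hv
  have hmN : Measurable fun ω => fun k => N k ω := measurable_pi_lambda _ hm
  have hηm : ∀ l, Measurable (η l) := fun l =>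
    Complex.measurable_re.comp ((measurable_partialField _ z).comp hmN)
  have hηI : iIndepFun η μ := iIndepFun_re_partialField_blockFreq hI hm z
  have hηlaw : ∀ l, μ.map (η l) = gaussianReal 0 (v l) := fun l =>
    map_re_partialField_blockFreq hG hI hm z l
  have hvlow : ∀ l, (1 / 4 : ℝ) ≤ v l := by
    intro l
    have h1 : ∑ k ∈ blockFreq l, (((k : ℕ) : ℝ))⁻¹ ≤ 2 * (v l : ℝ) := by
      rw [hv, two_mul_blockVar]
      refine Finset.sum_le_sum fun k _ => ?_
      rw [← one_div]
      gcongr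
      exact one_le_pow₀ hz1
    have := half_le_sum_blockFreq_inv l
    linarith
  have hvne : ∀ l, v l ≠ 0 := by
    intro l h
    have := hvlow l
    rw [h] at this
    norm_num at this
  have hvup : ∀ l < i, (v l : ℝ) ≤ Real.exp 2 / 2 := by
    intro l hl
    have h1 : 2 * (v l : ℝ) ≤ Real.exp 2 * ∑ k ∈ blockFreq l, (((k : ℕ) : ℝ))⁻¹ := by
      rw [hv, two_mul_blockVar, Finset.mul_sum]
      refine Finset.sum_le_sum fun k hk => ?_
      rw [div_eq_mul_inv]
      gcongr
      rw [hz2]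
      refine exp_div_two_pow_pow_le (by norm_num) ?_
      exact (mem_blockFreq.1 hk).2.le.trans (Nat.pow_le_pow_right (by norm_num) hl)
    have h2 := sum_blockFreq_inv_le l
    have h3 : Real.exp 2 * ∑ k ∈ blockFreq l, (((k : ℕ) : ℝ))⁻¹ ≤ Real.exp 2 * 1 := by gcongr
    linarith
  set ν := tiltedMeasure μ η v (Finset.range i) with hν
  have hνI : iIndepFun η ν := tiltedMeasure_iIndepFun hηI hηm hηlaw hvne _
  set d : ℕ → ℝ := fun l => if l ∈ Finset.range i then 2 * (v l : ℝ) else 0 with hd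
  set ξ : ℕ → Ω → ℝ := fun l ω => η l ω - d l with hξ
  have hξI : iIndepFun ξ ν := hνI.comp (fun l y => y - d l) fun l => by fun_prop
  have hξm : ∀ l, Measurable (ξ l) := fun l => (hηm l).sub_const _
  have hξlaw : ∀ l, ν.map (ξ l) = gaussianReal 0 (v l) := by
    intro l
    have h1 : ν.map (ξ l) = (ν.map (η l)).map fun y => y - d l := by
      rw [Measure.map_map (by fun_prop) (hηm l)]
      rfl
    rw [h1, tiltedMeasure_map hηI hηm hηlaw hvne, gaussianReal_map_sub_const]
    simp [hd]
  have hνp : IsProbabilityMeasure ν := hνI.isProbabilityMeasure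
  have hball := hC hξI hξm hξlaw hL (T := i) (fun l _ => hvlow l) hvup
  have h2V : ∀ j ≤ i, ∑ l ∈ Finset.range j, d l =
      ∑ k ∈ lowFreq j, (‖z‖ ^ 2) ^ (k : ℕ) / (k : ℕ) := by
    intro j hj
    rw [sum_lowFreq]
    refine Finset.sum_congr rfl fun l hl => ?_
    have : l ∈ Finset.range i := Finset.mem_range.2 ((Finset.mem_range.1 hl).trans_le hj)
    simp only [hd, this, if_true]
    exact two_mul_blockVar z l
  set A : Set Ω := {ω | (fun k => N k ω) ∈ fieldBelow L i z} with hA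
  have hAsub : A ⊆ aliveSet ξ L i := by
    intro ω hω j hj
    have h1 : (partialField (lowFreq j) (fun k => N k ω) z).re ≤
        L + j * Real.log 2 + Real.log (j + 1) := hω j hj
    rw [partialField_lowFreq, Complex.re_sum] at h1
    have h3 : j * Real.log 2 ≤ ∑ l ∈ Finset.range j, d l := by
      rw [h2V j hj]
      refine (mul_log_two_le_sum_lowFreq j).trans (Finset.sum_le_sum fun k _ => ?_)
      rw [← one_div]
      gcongr
      exact one_le_pow₀ hz1
    simp only [hξ, Finset.sum_sub_distrib]
    have h4 : ∑ l ∈ Finset.range j, η l ω ≤ L + j * Real.log 2 + Real.log (j + 1) := h1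
    linarith
  have hdens : ∀ ω, ENNReal.ofReal
      (‖Complex.exp (partialField (lowFreq i) (fun k => N k ω) z)‖ ^ 2) =
      ENNReal.ofReal (Real.exp (∑ l ∈ Finset.range i, d l)) *
        ∏ l ∈ Finset.range i, ENNReal.ofReal (Real.exp (2 * η l ω - 2 * v l)) := by
    intro ω
    rw [← ENNReal.ofReal_prod_of_nonneg fun l _ => (Real.exp_pos _).le,
      ← ENNReal.ofReal_mul (Real.exp_pos _).le, ← Real.exp_sum, ← Real.exp_add,
      Complex.norm_exp, ← Real.exp_nat_mul, partialField_lowFreq, Complex.re_sum]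
    congr 2
    rw [Finset.sum_sub_distrib]
    have : ∑ l ∈ Finset.range i, d l = ∑ l ∈ Finset.range i, 2 * (v l : ℝ) :=
      Finset.sum_congr rfl fun l hl => by simp only [hd, hl, if_true]
    rw [this, ← Finset.mul_sum (f := fun l => η l ω)]
    push_cast
    ring
  have hmeasA : MeasurableSet A := by
    have : MeasurableSet (fieldBelow L i z) := by
      have e : fieldBelow L i z = ⋂ j : ℕ, ⋂ _ : j ≤ i, {x | (partialField (lowFreq j) x z).re ≤
          L + j * Real.log 2 + Real.log (j + 1)} := by
        ext x; simp [fieldBelow]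
      rw [e]
      refine MeasurableSet.iInter fun j => MeasurableSet.iInter fun _ => ?_
      exact measurableSet_le (Complex.measurable_re.comp (measurable_partialField _ z))
        measurable_const
    exact hmN this
  simp only [hdens]
  rw [lintegral_const_mul _ (Finset.measurable_prod _ fun l _ => by
    have := hηm l; fun_prop)]
  have hνA : ∫⁻ ω in A, ∏ l ∈ Finset.range i, ENNReal.ofReal (Real.exp (2 * η l ω - 2 * v l)) ∂μ =
      ν A := by
    rw [hν, tiltedMeasure, withDensity_apply _ hmeasA]
  rw [hνA]
  have hνle : ν A ≤ ENNReal.ofReal (C * (1 + L) / √(i + 1)) := by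
    refine (measure_mono hAsub).trans ?_
    rw [← ENNReal.ofReal_toReal (measure_ne_top ν (aliveSet ξ L i))]
    exact ENNReal.ofReal_le_ofReal hball
  refine (mul_le_mul' le_rfl hνle).trans ?_
  rw [← ENNReal.ofReal_mul (Real.exp_pos _).le]
  apply ENNReal.ofReal_le_ofReal
  have hE := exp_sum_lowFreq_le (a := 2) (by norm_num) i
  rw [h2V i le_rfl, hz2]
  calc _ ≤ (Real.exp (1 + 2 * Real.exp 2) * 2 ^ i) * (C * (1 + L) / √(i + 1)) := by gcongr
    _ = _ := by ring

end Spine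

section GoodEvent

/-- The squared Hardy norm of `exp (partialField (lowFreq j) x)` on the circle of radius
`exp (2 / 2 ^ j)`. -/
noncomputable def hardyNormSq (j : ℕ) (x : ℕ+ → ℂ) : ENNReal :=
  ∑' m, ENNReal.ofReal (‖chaosCoeff (lowFreq j) x m‖ ^ 2 * Real.exp (4 / 2 ^ j) ^ m)

/-- The event that the Hardy norms at all dyadic scales up to `i` are under control. -/
def goodSet (y : ℝ) (i : ℕ) : Set (ℕ+ → ℂ) :=
  {x | ∀ j ≤ i, hardyNormSq j x ≤ ENNReal.ofReal (y ^ 2 * 2 ^ j * (j + 1) ^ 2)}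

theorem measurable_hardyNormSq (j : ℕ) : Measurable (hardyNormSq j) :=
  Measurable.tsum fun m => by
    have := measurable_chaosCoeff (lowFreq j) m
    fun_prop

theorem dependsOn_hardyNormSq (j : ℕ) : DependsOn (hardyNormSq j) (lowFreq j : Set ℕ+) := by
  intro x y h
  refine tsum_congr fun m => ?_
  have : chaosCoeff (lowFreq j) x m = chaosCoeff (lowFreq j) y m := dependsOn_chaosCoeff _ m h
  rw [this]

theorem measurableSet_goodSet (y : ℝ) (i : ℕ) : MeasurableSet (goodSet y i) := by
  have e : goodSet y i = ⋂ j : ℕ, ⋂ _ : j ≤ i,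
      {x | hardyNormSq j x ≤ ENNReal.ofReal (y ^ 2 * 2 ^ j * (j + 1) ^ 2)} := by
    ext x; simp [goodSet]
  rw [e]
  exact MeasurableSet.iInter fun j => MeasurableSet.iInter fun _ =>
    measurableSet_le (measurable_hardyNormSq j) measurable_const

theorem dependsOn_goodSet (y : ℝ) (i : ℕ) :
    DependsOn (· ∈ goodSet y i) (lowFreq i : Set ℕ+) := by
  intro x x' h
  simp only [goodSet, Set.mem_ofPred_eq, eq_iff_iff]
  refine forall_congr' fun j => forall_congr' fun hj => ?_
  rw [dependsOn_hardyNormSq j fun k hk => h k (lowFreq_mono hj hk)]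

theorem goodSet_anti (y : ℝ) {i j : ℕ} (h : i ≤ j) : goodSet y j ⊆ goodSet y i :=
  fun _ hx l hl => hx l (hl.trans h)

theorem lintegral_hardyNormSq_le {Ω : Type*} {mΩ : MeasurableSpace Ω} {μ : Measure Ω}
    {N : ℕ+ → Ω → ℂ} (hG : ∀ k, IsStdComplexGaussian (N k) μ) (hI : iIndepFun N μ)
    (hm : ∀ k, Measurable (N k)) (j : ℕ) :
    ∫⁻ ω, hardyNormSq j (fun k => N k ω) ∂μ ≤
      ENNReal.ofReal (Real.exp (1 + 4 * Real.exp 4) * 2 ^ j) := by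
  have hmN : Measurable fun ω => fun k => N k ω := measurable_pi_lambda _ hm
  simp only [hardyNormSq]
  have hmeas : ∀ m, Measurable fun ω => chaosCoeff (lowFreq j) (fun k => N k ω) m := fun m =>
    (measurable_chaosCoeff (lowFreq j) m).comp hmN
  rw [lintegral_tsum fun m =>
    (((hmeas m).norm.pow_const 2).mul_const _).ennreal_ofReal.aemeasurable]
  have hterm : ∀ m, ∫⁻ ω, ENNReal.ofReal (‖chaosCoeff (lowFreq j) (fun k => N k ω) m‖ ^ 2 *
      Real.exp (4 / 2 ^ j) ^ m) ∂μ =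
      ENNReal.ofReal (varCoeff (lowFreq j) m * Real.exp (4 / 2 ^ j) ^ m) := by
    intro m
    rw [← ofReal_integral_eq_lintegral_ofReal
      ((integrable_norm_chaosCoeff_sq hG hI hm _ m).mul_const _)
      (.of_forall fun ω => by positivity), integral_mul_const,
      integral_norm_chaosCoeff_sq hG hI hm]
  simp only [hterm]
  have hs := hasSum_varCoeff (lowFreq j) (Real.exp (4 / 2 ^ j))
  rw [← ENNReal.ofReal_tsum_of_nonneg
    (fun m => mul_nonneg (varCoeff_nonneg _ m) (by positivity)) hs.summable, hs.tsum_eq]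
  exact ENNReal.ofReal_le_ofReal (exp_sum_lowFreq_le (by norm_num) j)

theorem exists_measure_not_goodSet_le : ∃ C : ℝ, 0 < C ∧ ∀ {Ω : Type*} [MeasurableSpace Ω]
    {μ : Measure Ω} {N : ℕ+ → Ω → ℂ}, (∀ k, IsStdComplexGaussian (N k) μ) → iIndepFun N μ →
    (∀ k, Measurable (N k)) → ∀ (y : ℝ), 0 < y → ∀ i : ℕ,
    μ.real {ω | (fun k => N k ω) ∉ goodSet y i} ≤ C / y ^ 2 := by
  set c : ℝ := Real.exp (1 + 4 * Real.exp 4) with hc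
  have hs : Summable fun j : ℕ => 1 / ((j : ℝ) + 1) ^ 2 := by
    have h := Real.summable_one_div_nat_pow.2 (by norm_num : 1 < 2)
    simpa using (summable_nat_add_iff 1).2 h
  set W := ∑' j : ℕ, 1 / ((j : ℝ) + 1) ^ 2 with hW
  have hW0 : 0 ≤ W := tsum_nonneg fun j => by positivity
  refine ⟨c * (1 + W), by positivity, ?_⟩
  intro Ω _ μ N hG hI hm y hy i
  have := hI.isProbabilityMeasure
  have hmN : Measurable fun ω => fun k => N k ω := measurable_pi_lambda _ hm
  have hsub : {ω | (fun k => N k ω) ∉ goodSet y i} ⊆ ⋃ j ∈ Finset.range (i + 1),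
      {ω | ENNReal.ofReal (y ^ 2 * 2 ^ j * (j + 1) ^ 2) ≤ hardyNormSq j (fun k => N k ω)} := by
    intro ω hω
    have hω' : ¬ ∀ j ≤ i, hardyNormSq j (fun k => N k ω) ≤
      ENNReal.ofReal (y ^ 2 * 2 ^ j * (j + 1) ^ 2) := hω
    push Not at hω'
    obtain ⟨j, hj, hlt⟩ := hω'
    simp only [Set.mem_iUnion, Finset.mem_range]
    exact ⟨j, Nat.lt_succ_of_le hj, hlt.le⟩
  have hone : ∀ j : ℕ, μ.real
      {ω | ENNReal.ofReal (y ^ 2 * 2 ^ j * (j + 1) ^ 2) ≤ hardyNormSq j (fun k => N k ω)} ≤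
      c / y ^ 2 * (1 / ((j : ℝ) + 1) ^ 2) := by
    intro j
    have hpos : 0 < y ^ 2 * 2 ^ j * ((j : ℝ) + 1) ^ 2 := by positivity
    have h1 := meas_ge_le_lintegral_div (μ := μ) (f := fun ω => hardyNormSq j (fun k => N k ω))
      ((measurable_hardyNormSq j).comp hmN).aemeasurable
      (ENNReal.ofReal_pos.2 hpos).ne' ENNReal.ofReal_ne_top
    have h2 := h1.trans (ENNReal.div_le_div_right (lintegral_hardyNormSq_le hG hI hm j) _)
    rw [← ENNReal.ofReal_div_of_pos hpos] at h2
    refine (ENNReal.toReal_le_of_le_ofReal (by positivity) h2).trans (le_of_eq ?_)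
    rw [hc]
    field_simp
  calc μ.real {ω | (fun k => N k ω) ∉ goodSet y i}
      ≤ ∑ j ∈ Finset.range (i + 1), μ.real
        {ω | ENNReal.ofReal (y ^ 2 * 2 ^ j * (j + 1) ^ 2) ≤ hardyNormSq j (fun k => N k ω)} :=
        (measureReal_mono hsub (measure_ne_top _ _)).trans (measureReal_biUnion_finset_le _ _)
    _ ≤ ∑ j ∈ Finset.range (i + 1), c / y ^ 2 * (1 / ((j : ℝ) + 1) ^ 2) :=
        Finset.sum_le_sum fun j _ => hone j
    _ = c / y ^ 2 * ∑ j ∈ Finset.range (i + 1), (1 / ((j : ℝ) + 1) ^ 2) := by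
        rw [Finset.mul_sum]
    _ ≤ c / y ^ 2 * (1 + W) := by
        gcongr
        have := hs.sum_le_tsum (Finset.range (i + 1)) fun j _ => by positivity
        linarith
    _ = _ := by ring

/-- Pointwise control of the field on the good event. -/
theorem norm_exp_partialField_sq_le {y : ℝ} (hy : 0 < y) {j : ℕ} {x : ℕ+ → ℂ}
    (hx : hardyNormSq j x ≤ ENNReal.ofReal (y ^ 2 * 2 ^ j * (j + 1) ^ 2)) {z : ℂ}
    (hz : ‖z‖ ≤ Real.exp (1 / 2 ^ j)) :
    ‖Complex.exp (partialField (lowFreq j) x z)‖ ^ 2 ≤ 2 * (y * 2 ^ j * (j + 1)) ^ 2 := by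
  set a := chaosCoeff (lowFreq j) x with ha
  set ρ : ℝ := Real.exp (2 / 2 ^ j) with hρ
  set q : ℝ := Real.exp (-(2 / 2 ^ j)) with hq
  have hu0 : (0 : ℝ) < 2 / 2 ^ j := by positivity
  have hu2 : (2 : ℝ) / 2 ^ j ≤ 2 := div_le_self (by norm_num) (one_le_pow₀ (by norm_num))
  have hq1 : q < 1 := Real.exp_lt_one_iff.2 (by linarith)
  have hq0 : 0 ≤ q := (Real.exp_pos _).le
  have hgeo : (1 - q)⁻¹ ≤ 2 * 2 ^ j := by
    have h1 : q * (1 + 2 / 2 ^ j) ≤ 1 := by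
      have h2 := Real.add_one_le_exp (2 / 2 ^ j : ℝ)
      have h3 : q * Real.exp (2 / 2 ^ j) = 1 := by rw [hq, ← Real.exp_add]; simp
      nlinarith
    have h4 : (2 * 2 ^ j : ℝ)⁻¹ ≤ 1 - q := by
      have h5 : (2 * 2 ^ j : ℝ)⁻¹ = (2 / 2 ^ j) / 4 := by field_simp; norm_num
      rw [h5]
      nlinarith
    calc (1 - q)⁻¹ ≤ ((2 * 2 ^ j : ℝ)⁻¹)⁻¹ := inv_anti₀ (by positivity) h4
      _ = _ := inv_inv _
  have hpart : ∀ M : ℕ, ‖∑ m ∈ Finset.range M, a m * z ^ m‖ ^ 2 ≤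
      2 * (y * 2 ^ j * (j + 1)) ^ 2 := by
    intro M
    have h1 : ‖∑ m ∈ Finset.range M, a m * z ^ m‖ ≤
        ∑ m ∈ Finset.range M, (‖a m‖ * ρ ^ m) * (Real.exp (-(1 / 2 ^ j)) ^ m) := by
      refine (norm_sum_le _ _).trans (Finset.sum_le_sum fun m _ => ?_)
      rw [norm_mul, norm_pow, mul_assoc, ← mul_pow]
      gcongr
      refine hz.trans (le_of_eq ?_)
      rw [hρ, ← Real.exp_add]
      congr 1
      ring
    have h2 := Finset.sum_mul_sq_le_sq_mul_sq (Finset.range M) (fun m => ‖a m‖ * ρ ^ m)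
      (fun m => Real.exp (-(1 / 2 ^ j)) ^ m)
    have h3 : ∑ m ∈ Finset.range M, (‖a m‖ * ρ ^ m) ^ 2 ≤ y ^ 2 * 2 ^ j * (j + 1) ^ 2 := by
      have h4 := (ENNReal.sum_le_tsum (Finset.range M)).trans hx
      rw [← ENNReal.ofReal_sum_of_nonneg fun m _ => by positivity,
        ENNReal.ofReal_le_ofReal_iff (by positivity)] at h4
      refine le_trans (le_of_eq ?_) h4
      refine Finset.sum_congr rfl fun m _ => ?_
      rw [mul_pow, ← pow_mul, mul_comm m 2, pow_mul, hρ, ← Real.exp_nat_mul]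
      congr 3
      push_cast
      ring
    have h5 : ∑ m ∈ Finset.range M, (Real.exp (-(1 / 2 ^ j)) ^ m) ^ 2 ≤ 2 * 2 ^ j := by
      have e : ∀ m : ℕ, (Real.exp (-(1 / 2 ^ j)) ^ m) ^ 2 = q ^ m := by
        intro m
        rw [← pow_mul, mul_comm m 2, pow_mul, hq, ← Real.exp_nat_mul]
        congr 2
        push_cast
        ring
      simp only [e]
      refine le_trans ?_ hgeo
      rw [← tsum_geometric_of_lt_one hq0 hq1]
      exact (summable_geometric_of_lt_one hq0 hq1).sum_le_tsum _ fun m _ => by positivity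
    calc ‖∑ m ∈ Finset.range M, a m * z ^ m‖ ^ 2
        ≤ (∑ m ∈ Finset.range M, (‖a m‖ * ρ ^ m) * (Real.exp (-(1 / 2 ^ j)) ^ m)) ^ 2 := by
          gcongr
      _ ≤ _ := h2
      _ ≤ (y ^ 2 * 2 ^ j * (j + 1) ^ 2) * (2 * 2 ^ j) := by
          gcongr
      _ = _ := by ring
  have hlim := ((hasSum_chaosCoeff (lowFreq j) x z).tendsto_sum_nat.norm).pow 2
  exact le_of_tendsto' hlim hpart

theorem goodSet_subset_fieldBelow {y : ℝ} (hy : 0 < y) {i : ℕ} {z : ℂ}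
    (hz : ‖z‖ = Real.exp (1 / 2 ^ i)) : goodSet y i ⊆ fieldBelow (Real.log y + 1) i z := by
  intro x hx j hj
  have hz' : ‖z‖ ≤ Real.exp (1 / 2 ^ j) := by
    rw [hz]
    apply Real.exp_le_exp.2
    exact one_div_le_one_div_of_le (by positivity) (pow_le_pow_right₀ (by norm_num) hj)
  have h := norm_exp_partialField_sq_le hy (hx j hj) hz'
  rw [Complex.norm_exp] at h
  have hpos : 0 < y * 2 ^ j * ((j : ℝ) + 1) := by positivity
  have h2 : Real.exp (partialField (lowFreq j) x z).re ≤
      Real.exp 1 * (y * 2 ^ j * (j + 1)) := by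
    have he := Real.add_one_le_exp (1 : ℝ)
    refine (pow_le_pow_iff_left₀ (Real.exp_pos _).le (by positivity) two_ne_zero).1 (h.trans ?_)
    rw [mul_pow (Real.exp 1)]
    have he2 : 2 ≤ Real.exp 1 ^ 2 := by nlinarith
    gcongr
  have h3 := Real.log_le_log (Real.exp_pos _) h2
  rw [Real.log_exp, Real.log_mul (Real.exp_pos _).ne' hpos.ne', Real.log_exp,
    Real.log_mul (by positivity) (by positivity), Real.log_mul hy.ne' (by positivity),
    Real.log_pow] at h3
  linarith

end GoodEvent

section Increment

/-- The weighted second moments of the coefficients on the good event. -/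
theorem exists_sum_setIntegral_norm_chaosCoeff_sq_le : ∃ C : ℝ, 0 < C ∧ ∀ {Ω : Type*}
    [MeasurableSpace Ω] {μ : Measure Ω} {N : ℕ+ → Ω → ℂ}, (∀ k, IsStdComplexGaussian (N k) μ) →
    iIndepFun N μ → (∀ k, Measurable (N k)) → ∀ (i : ℕ) {y : ℝ}, 1 ≤ y → ∀ S : Finset ℕ,
    ∑ l ∈ S, Real.exp (2 / 2 ^ i) ^ l * ∫ ω in {ω | (fun k => N k ω) ∈ goodSet y i},
      ‖chaosCoeff (lowFreq i) (fun k => N k ω) l‖ ^ 2 ∂μ ≤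
      C * 2 ^ i * ((2 + Real.log y) / √(i + 1)) := by
  obtain ⟨C, hC0, hC⟩ := exists_setLIntegral_norm_exp_sq_le
  refine ⟨C, hC0, ?_⟩
  intro Ω _ μ N hG hI hm i y hy S
  have := hI.isProbabilityMeasure
  have hmN : Measurable fun ω => fun k => N k ω := measurable_pi_lambda _ hm
  have hlog : 0 ≤ Real.log y := Real.log_nonneg hy
  set A : Set Ω := {ω | (fun k => N k ω) ∈ goodSet y i} with hA
  set R : ℝ := Real.exp (1 / 2 ^ i) with hR
  have hR0 : 0 ≤ R := (Real.exp_pos _).le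
  have hR2 : ∀ l : ℕ, Real.exp (2 / 2 ^ i) ^ l = R ^ (2 * l) := by
    intro l
    rw [pow_mul, hR, ← Real.exp_nat_mul _ 2]
    congr 2
    push_cast
    ring
  have hXi : ∀ l, Integrable
      (fun ω => ‖chaosCoeff (lowFreq i) (fun k => N k ω) l‖ ^ 2 * R ^ (2 * l)) (μ.restrict A) :=
    fun l => ((integrable_norm_chaosCoeff_sq hG hI hm _ l).mul_const _).integrableOn
  have hsum : ∑ l ∈ S, Real.exp (2 / 2 ^ i) ^ l * ∫ ω in A,
      ‖chaosCoeff (lowFreq i) (fun k => N k ω) l‖ ^ 2 ∂μ =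
      ∫ ω in A, ∑ l ∈ S, ‖chaosCoeff (lowFreq i) (fun k => N k ω) l‖ ^ 2 * R ^ (2 * l) ∂μ := by
    rw [integral_finsetSum _ fun l _ => hXi l]
    refine Finset.sum_congr rfl fun l _ => ?_
    rw [integral_mul_const, hR2, mul_comm]
  set F : Ω → ℝ → ENNReal := fun ω t => ENNReal.ofReal
    (‖Complex.exp (partialField (lowFreq i) (fun k => N k ω) (circlePt R t))‖ ^ 2) with hF
  have hFm : Measurable (Function.uncurry F) := by
    have h1 : ∀ k, Measurable fun p : Ω × ℝ => N k p.1 := fun k => (hm k).comp measurable_fst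
    have h2 : Measurable fun p : Ω × ℝ => circlePt R p.2 :=
      (continuous_circlePt R).measurable.comp measurable_snd
    simp only [hF, Function.uncurry_def, partialField]
    fun_prop
  have hpt : ∀ ω, ENNReal.ofReal (2 * Real.pi *
      ∑ l ∈ S, ‖chaosCoeff (lowFreq i) (fun k => N k ω) l‖ ^ 2 * R ^ (2 * l)) ≤
      ∫⁻ t in Set.Ioc 0 (2 * Real.pi), F ω t := by
    intro ω
    have hc : Continuous fun t =>
        Complex.exp (partialField (lowFreq i) (fun k => N k ω) (circlePt R t)) :=
      Complex.continuous_exp.comp ((continuous_partialField _ _).comp (continuous_circlePt R))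
    have h := sum_norm_sq_le_integral hR0 (summable_chaosCoeff (lowFreq i) (fun k => N k ω) hR0)
      hc (fun t => hasSum_chaosCoeff _ _ _) S
    refine (ENNReal.ofReal_le_ofReal h).trans (le_of_eq ?_)
    rw [intervalIntegral.integral_of_le (by positivity)]
    exact ofReal_integral_eq_lintegral_ofReal (hc.norm.pow 2).integrableOn_Ioc
      (.of_forall fun t => sq_nonneg _)
  have hfinal : ENNReal.ofReal (2 * Real.pi * ∫ ω in A,
      ∑ l ∈ S, ‖chaosCoeff (lowFreq i) (fun k => N k ω) l‖ ^ 2 * R ^ (2 * l) ∂μ) ≤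
      ENNReal.ofReal (2 * Real.pi * (C * 2 ^ i * ((2 + Real.log y) / √(i + 1)))) := by
    calc _ = ∫⁻ ω in A, ENNReal.ofReal (2 * Real.pi *
          ∑ l ∈ S, ‖chaosCoeff (lowFreq i) (fun k => N k ω) l‖ ^ 2 * R ^ (2 * l)) ∂μ := by
          rw [← integral_const_mul, ofReal_integral_eq_lintegral_ofReal
            ((integrable_finsetSum _ fun l _ => hXi l).const_mul _)
            (.of_forall fun ω => by positivity)]
      _ ≤ ∫⁻ ω in A, (∫⁻ t in Set.Ioc 0 (2 * Real.pi), F ω t) ∂μ :=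
          lintegral_mono fun ω => hpt ω
      _ = ∫⁻ t in Set.Ioc 0 (2 * Real.pi), ∫⁻ ω in A, F ω t ∂μ :=
          lintegral_lintegral_swap hFm.aemeasurable
      _ ≤ ∫⁻ t in Set.Ioc 0 (2 * Real.pi),
          ENNReal.ofReal (C * 2 ^ i * ((2 + Real.log y) / √(i + 1))) := by
          refine lintegral_mono fun t => ?_
          have hz : ‖circlePt R t‖ = Real.exp (1 / 2 ^ i) := norm_circlePt hR0 t
          have hsub : A ⊆ {ω | (fun k => N k ω) ∈ fieldBelow (Real.log y + 1) i (circlePt R t)} :=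
            fun ω hω => goodSet_subset_fieldBelow (by linarith) hz hω
          refine (lintegral_mono_set hsub).trans
            ((hC hG hI hm i _ hz (by linarith)).trans (le_of_eq ?_))
          congr 3
          ring
      _ = _ := by
          rw [setLIntegral_const, Real.volume_Ioc, sub_zero, mul_comm,
            ← ENNReal.ofReal_mul (by positivity)]
  rw [ENNReal.ofReal_le_ofReal_iff (by positivity)] at hfinal
  rw [hsum]
  exact le_of_mul_le_mul_left hfinal (by positivity)

/-- The increment of the `n`-th coefficient over one dyadic block, on the good event. -/
theorem exists_setIntegral_increment_sq_le : ∃ C : ℝ, 0 < C ∧ ∀ {Ω : Type*}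
    [MeasurableSpace Ω] {μ : Measure Ω} {N : ℕ+ → Ω → ℂ}, (∀ k, IsStdComplexGaussian (N k) μ) →
    iIndepFun N μ → (∀ k, Measurable (N k)) → ∀ (i : ℕ) {y : ℝ}, 1 ≤ y → ∀ n : ℕ,
    ∫ ω in {ω | (fun k => N k ω) ∈ goodSet y i}, ‖chaosCoeff (lowFreq (i + 1)) (fun k => N k ω) n -
      chaosCoeff (lowFreq i) (fun k => N k ω) n‖ ^ 2 ∂μ ≤
      C * Real.exp (-(2 * n / 2 ^ i)) * ((2 + Real.log y) / √(i + 1)) := by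
  obtain ⟨C, hC0, hC⟩ := exists_sum_setIntegral_norm_chaosCoeff_sq_le
  set B : ℝ := Real.exp 4 * Real.exp (Real.exp 4) with hB
  refine ⟨B * C, by positivity, ?_⟩
  intro Ω _ μ N hG hI hm i y hy n
  rw [lowFreq_succ, setIntegral_norm_chaosCoeff_sub_sq hG hI hm (disjoint_lowFreq_blockFreq le_rfl)
    (measurableSet_goodSet y i) (dependsOn_goodSet y i)]
  set x : ℝ := Real.exp (2 / 2 ^ i) with hx
  have hx0 : 0 < x := Real.exp_pos _
  set J : ℕ → ℝ := fun l => ∫ ω in {ω | (fun k => N k ω) ∈ goodSet y i},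
    ‖chaosCoeff (lowFreq i) (fun k => N k ω) l‖ ^ 2 ∂μ with hJ
  have hJ0 : ∀ l, 0 ≤ J l := fun l => integral_nonneg fun ω => by positivity
  have hxn : Real.exp (-(2 * n / 2 ^ i)) = (x ^ n)⁻¹ := by
    rw [Real.exp_neg, hx, ← Real.exp_nat_mul]
    congr 2
    ring
  have hvar : ∀ m, m ≠ 0 → varCoeff (blockFreq i) m * x ^ m ≤ B / 2 ^ i := by
    intro m hm0
    have h := varCoeff_mul_pow_le (s := blockFreq i) (K := 2 ^ i) (by positivity)
      (fun k hk => (mem_blockFreq.1 hk).1) (sum_blockFreq_inv_le i) hx0.le (A := Real.exp 4)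
      (fun k hk => by
        have h1 := exp_div_two_pow_pow_le (a := 4) (by norm_num) (mem_blockFreq.1 hk).2.le
        refine le_trans (le_of_eq ?_) h1
        rw [hx]
        congr 2
        rw [pow_succ]
        field_simp
        norm_num) (Real.exp_pos _).le hm0
    simpa [hB] using h
  have hterm : ∀ p ∈ (Finset.HasAntidiagonal.antidiagonal n).filter (fun p => p.2 ≠ 0),
      varCoeff (blockFreq i) p.2 * J p.1 ≤ B / 2 ^ i * (x ^ n)⁻¹ * (x ^ p.1 * J p.1) := by
    intro p hp
    obtain ⟨hp1, hp2⟩ := Finset.mem_filter.1 hp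
    have hpn : p.1 + p.2 = n := Finset.HasAntidiagonal.mem_antidiagonal.1 hp1
    have h := hvar p.2 hp2
    rw [← le_div_iff₀ (by positivity)] at h
    refine (mul_le_mul_of_nonneg_right h (hJ0 p.1)).trans (le_of_eq ?_)
    rw [← hpn, pow_add]
    field_simp
  refine (Finset.sum_le_sum hterm).trans ?_
  rw [← Finset.mul_sum]
  have hle : ∑ p ∈ (Finset.HasAntidiagonal.antidiagonal n).filter (fun p => p.2 ≠ 0),
      x ^ p.1 * J p.1 ≤ ∑ l ∈ Finset.range (n + 1), x ^ l * J l := by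
    rw [← Finset.Nat.sum_antidiagonal_eq_sum_range_succ (fun l _ => x ^ l * J l) n]
    exact Finset.sum_le_sum_of_subset_of_nonneg (Finset.filter_subset _ _) fun p _ _ =>
      mul_nonneg (by positivity) (hJ0 _)
  have h := hC hG hI hm i hy (Finset.range (n + 1))
  calc _ ≤ B / 2 ^ i * (x ^ n)⁻¹ * (C * 2 ^ i * ((2 + Real.log y) / √(i + 1))) := by
        gcongr
        exact hle.trans h
    _ = _ := by
        rw [hxn]
        field_simp

end Increment

section Tail

theorem norm_sum_range_sq_le_sum_two_pow {E : Type*} [SeminormedAddCommGroup E] (d : ℕ → E)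
    (I : ℕ) : ‖∑ m ∈ Finset.range I, d m‖ ^ 2 ≤
      2 * ∑ m ∈ Finset.range I, 2 ^ m * ‖d m‖ ^ 2 := by
  have h1 := Finset.sum_sq_le_sum_mul_sum_of_sq_le_mul (Finset.range I) (r := fun m => ‖d m‖)
    (f := fun m => (1 / 2 : ℝ) ^ m) (g := fun m => 2 ^ m * ‖d m‖ ^ 2)
    (fun m _ => by positivity) (fun m _ => by positivity) fun m _ => by
      rw [← mul_assoc, ← mul_pow]; norm_num
  have h2 : ∑ m ∈ Finset.range I, (1 / 2 : ℝ) ^ m ≤ 2 := sum_geometric_two_le I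
  calc ‖∑ m ∈ Finset.range I, d m‖ ^ 2 ≤ (∑ m ∈ Finset.range I, ‖d m‖) ^ 2 := by
        gcongr; exact norm_sum_le _ _
    _ ≤ _ := h1
    _ ≤ _ := by gcongr

theorem two_pow_mul_sqrt_mul_exp_neg_le (m : ℕ) :
    (2 : ℝ) ^ m * √(m + 1) * Real.exp (-(2 * 2 ^ m)) ≤ (1 / 2) ^ m := by
  set u : ℝ := 2 ^ m with hu
  have hu0 : 0 < u := by positivity
  have h1 : √((m : ℝ) + 1) ≤ u := by
    have h : ((m : ℝ) + 1) ≤ u := by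
      rw [hu]
      exact_mod_cast (Nat.lt_two_pow_self : m < 2 ^ m)
    exact Real.sqrt_le_iff.2 ⟨hu0.le, h.trans
      (le_self_pow₀ (one_le_pow₀ (by norm_num)) two_ne_zero)⟩
  have h2 : u ^ 3 ≤ Real.exp (2 * u) := by
    have := Real.pow_div_factorial_le_exp (2 * u) (by positivity) 3
    norm_num [Nat.factorial] at this
    nlinarith [pow_pos hu0 3]
  have h3 : (1 / 2 : ℝ) ^ m = u⁻¹ := by rw [hu, one_div, inv_pow]
  rw [h3, Real.exp_neg, ← div_eq_mul_inv, div_le_iff₀ (Real.exp_pos _)]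
  calc u * √((m : ℝ) + 1) ≤ u * u := by gcongr
    _ = u⁻¹ * u ^ 3 := by field_simp
    _ ≤ _ := by gcongr

theorem one_div_sqrt_sub_le {J m : ℕ} (hm : m ≤ J) :
    1 / √(((J - m : ℕ) : ℝ) + 1) ≤ √(m + 1) / √(J + 1) := by
  rw [div_le_div_iff₀ (by positivity) (by positivity), one_mul, ← Real.sqrt_mul (by positivity)]
  apply Real.sqrt_le_sqrt
  obtain ⟨k, rfl⟩ := Nat.exists_eq_add_of_le hm
  rw [Nat.add_sub_cancel_left]
  push_cast
  nlinarith [mul_nonneg (m.cast_nonneg (α := ℝ)) (k.cast_nonneg (α := ℝ))]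

/-- The second moment of the `n`-th coefficient on the good event. -/
theorem exists_setIntegral_norm_chaosCoeff_sq_le : ∃ C : ℝ, 0 < C ∧ ∀ {Ω : Type*}
    [MeasurableSpace Ω] {μ : Measure Ω} {N : ℕ+ → Ω → ℂ}, (∀ k, IsStdComplexGaussian (N k) μ) →
    iIndepFun N μ → (∀ k, Measurable (N k)) → ∀ {y : ℝ}, 1 ≤ y → ∀ {n J : ℕ}, 2 ^ J ≤ n →
    ∫ ω in {ω | (fun k => N k ω) ∈ goodSet y J},
      ‖chaosCoeff (lowFreq (J + 1)) (fun k => N k ω) n‖ ^ 2 ∂μ ≤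
      C * ((2 + Real.log y) / √(J + 1)) := by
  obtain ⟨C, hC0, hC⟩ := exists_setIntegral_increment_sq_le
  refine ⟨4 * C, by positivity, ?_⟩
  intro Ω _ μ N hG hI hm y hy n J hn
  have := hI.isProbabilityMeasure
  have hmN : Measurable fun ω => fun k => N k ω := measurable_pi_lambda _ hm
  have hlog : 0 ≤ Real.log y := Real.log_nonneg hy
  have hn0 : n ≠ 0 := (Nat.two_pow_pos J |>.trans_le hn).ne'
  set c : ℕ → Ω → ℂ := fun i ω => chaosCoeff (lowFreq i) (fun k => N k ω) n with hc
  set A : ℕ → Set Ω := fun i => {ω | (fun k => N k ω) ∈ goodSet y i} with hA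
  have hAm : ∀ i, MeasurableSet (A i) := fun i => hmN (measurableSet_goodSet y i)
  have hcm : ∀ i, Measurable (c i) := fun i => (measurable_chaosCoeff _ n).comp hmN
  have hXi : ∀ i, Integrable (fun ω => ‖c (i + 1) ω - c i ω‖ ^ 2) μ := by
    intro i
    refine Integrable.mono' (((integrable_norm_chaosCoeff_sq hG hI hm (lowFreq (i + 1)) n).add
      (integrable_norm_chaosCoeff_sq hG hI hm (lowFreq i) n)).const_mul 2)
      (((hcm (i + 1)).sub (hcm i)).norm.pow_const 2).aestronglyMeasurable (.of_forall fun ω => ?_)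
    rw [Real.norm_of_nonneg (sq_nonneg _)]
    have h1 : ‖c (i + 1) ω - c i ω‖ ^ 2 ≤ (‖c (i + 1) ω‖ + ‖c i ω‖) ^ 2 := by
      gcongr; exact norm_sub_le _ _
    refine h1.trans ?_
    change _ ≤ 2 * (‖c (i + 1) ω‖ ^ 2 + ‖c i ω‖ ^ 2)
    nlinarith [sq_nonneg (‖c (i + 1) ω‖ - ‖c i ω‖)]
  have hpt : ∀ ω, ‖c (J + 1) ω‖ ^ 2 ≤ 2 * ∑ m ∈ Finset.range (J + 1),
      2 ^ m * ‖c (J - m + 1) ω - c (J - m) ω‖ ^ 2 := by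
    intro ω
    have h0 : c 0 ω = 0 := by simp only [hc, lowFreq_zero]; exact chaosCoeff_empty _ hn0
    have h1 : c (J + 1) ω = ∑ m ∈ Finset.range (J + 1), (c (J - m + 1) ω - c (J - m) ω) := by
      have h2 := Finset.sum_range_reflect (fun i => c (i + 1) ω - c i ω) (J + 1)
      rw [Finset.sum_range_sub (fun i => c i ω), h0, sub_zero] at h2
      exact h2.symm
    rw [h1]
    exact norm_sum_range_sq_le_sum_two_pow _ _
  have hstep : ∀ m ∈ Finset.range (J + 1),
      2 ^ m * ∫ ω in A J, ‖c (J - m + 1) ω - c (J - m) ω‖ ^ 2 ∂μ ≤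
      C * ((2 + Real.log y) / √(J + 1)) * (1 / 2) ^ m := by
    intro m hmJ
    have hmJ' : m ≤ J := Nat.lt_succ_iff.1 (Finset.mem_range.1 hmJ)
    have h1 : ∫ ω in A J, ‖c (J - m + 1) ω - c (J - m) ω‖ ^ 2 ∂μ ≤
        ∫ ω in A (J - m), ‖c (J - m + 1) ω - c (J - m) ω‖ ^ 2 ∂μ :=
      setIntegral_mono_set (hXi _).integrableOn (.of_forall fun ω => sq_nonneg _)
        (Filter.Eventually.of_forall fun ω hω => goodSet_anti y (Nat.sub_le J m) hω)
    have h2 := hC hG hI hm (J - m) hy n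
    have h3 : Real.exp (-(2 * n / 2 ^ (J - m))) ≤ Real.exp (-(2 * 2 ^ m)) := by
      apply Real.exp_le_exp.2
      apply neg_le_neg
      rw [le_div_iff₀ (by positivity), mul_assoc, ← pow_add, Nat.add_sub_cancel' hmJ']
      have : (2 : ℝ) ^ J ≤ n := by exact_mod_cast hn
      linarith
    have h4 := one_div_sqrt_sub_le hmJ'
    calc 2 ^ m * ∫ ω in A J, ‖c (J - m + 1) ω - c (J - m) ω‖ ^ 2 ∂μ
        ≤ 2 ^ m * (C * Real.exp (-(2 * n / 2 ^ (J - m))) *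
          ((2 + Real.log y) / √(((J - m : ℕ) : ℝ) + 1))) := by
          gcongr; exact h1.trans h2
      _ ≤ 2 ^ m * (C * Real.exp (-(2 * 2 ^ m)) *
          ((2 + Real.log y) * (√(m + 1) / √(J + 1)))) := by
          rw [div_eq_mul_one_div (2 + Real.log y)]
          gcongr
      _ = C * ((2 + Real.log y) / √(J + 1)) *
          (2 ^ m * √(m + 1) * Real.exp (-(2 * 2 ^ m))) := by ring
      _ ≤ _ := by
          gcongr
          exact two_pow_mul_sqrt_mul_exp_neg_le m
  calc ∫ ω in A J, ‖c (J + 1) ω‖ ^ 2 ∂μ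
      ≤ ∫ ω in A J, 2 * ∑ m ∈ Finset.range (J + 1),
        2 ^ m * ‖c (J - m + 1) ω - c (J - m) ω‖ ^ 2 ∂μ :=
        integral_mono (integrable_norm_chaosCoeff_sq hG hI hm _ n).integrableOn
          ((integrable_finsetSum _ fun m _ => ((hXi (J - m)).integrableOn.const_mul _)).const_mul _)
          hpt
    _ = 2 * ∑ m ∈ Finset.range (J + 1),
        2 ^ m * ∫ ω in A J, ‖c (J - m + 1) ω - c (J - m) ω‖ ^ 2 ∂μ := by
        rw [integral_const_mul, integral_finsetSum _ fun m _ =>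
          ((hXi (J - m)).integrableOn.const_mul _)]
        simp only [integral_const_mul]
    _ ≤ 2 * ∑ m ∈ Finset.range (J + 1), C * ((2 + Real.log y) / √(J + 1)) * (1 / 2) ^ m := by
        refine mul_le_mul_of_nonneg_left (Finset.sum_le_sum hstep) (by norm_num)
    _ = 2 * (C * ((2 + Real.log y) / √(J + 1))) * ∑ m ∈ Finset.range (J + 1), (1 / 2) ^ m := by
        rw [← Finset.mul_sum]; ring
    _ ≤ 2 * (C * ((2 + Real.log y) / √(J + 1))) * 2 := by
        gcongr
        exact sum_geometric_two_le _
    _ = _ := by ring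

/-- The tail bound for a single coefficient, for measurable versions of the variables. -/
theorem exists_measure_norm_chaosCoeff_ge_le : ∃ C : ℝ, 0 < C ∧ ∀ {Ω : Type*}
    [MeasurableSpace Ω] {μ : Measure Ω} {N : ℕ+ → Ω → ℂ}, (∀ k, IsStdComplexGaussian (N k) μ) →
    iIndepFun N μ → (∀ k, Measurable (N k)) → ∀ {y : ℝ}, 2 ≤ y → ∀ {n J : ℕ}, 2 ^ J ≤ n →
    n < 2 ^ (J + 1) →
    μ.real {ω | y ≤ Real.log n ^ (1 / 4 : ℝ) *
      ‖chaosCoeff (lowFreq (J + 1)) (fun k => N k ω) n‖} ≤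
      C * (min √(Real.log n) (Real.log y) / y ^ 2) := by
  obtain ⟨C₁, hC₁0, hC₁⟩ := exists_measure_not_goodSet_le
  obtain ⟨C₂, hC₂0, hC₂⟩ := exists_setIntegral_norm_chaosCoeff_sq_le
  refine ⟨1 + 2 * C₁ + 5 * C₂, by positivity, ?_⟩
  intro Ω _ μ N hG hI hm y hy n J hn hn'
  have := hI.isProbabilityMeasure
  have hmN : Measurable fun ω => fun k => N k ω := measurable_pi_lambda _ hm
  have hn1 : (1 : ℝ) ≤ n := by exact_mod_cast (Nat.one_le_two_pow.trans hn)
  have hlogn : 0 ≤ Real.log n := Real.log_nonneg hn1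
  have hlogy : 1 ≤ 2 * Real.log y := by
    have h1 := Real.log_le_log (by norm_num) hy
    linarith [Real.log_two_gt_d9]
  have hy2 : 0 < y ^ 2 := by positivity
  set f : Ω → ℝ := fun ω => √(Real.log n) * ‖chaosCoeff (lowFreq (J + 1)) (fun k => N k ω) n‖ ^ 2
    with hf
  have hf0 : ∀ ω, 0 ≤ f ω := fun ω => by positivity
  have hfi : Integrable f μ := (integrable_norm_chaosCoeff_sq hG hI hm _ n).const_mul _
  have hsub : {ω | y ≤ Real.log n ^ (1 / 4 : ℝ) *
      ‖chaosCoeff (lowFreq (J + 1)) (fun k => N k ω) n‖} ⊆ {ω | y ^ 2 ≤ f ω} := by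
    intro ω hω
    have h1 : y ^ 2 ≤ (Real.log n ^ (1 / 4 : ℝ) *
      ‖chaosCoeff (lowFreq (J + 1)) (fun k => N k ω) n‖) ^ 2 := by gcongr; exact hω
    have h2 : (Real.log n ^ (1 / 4 : ℝ)) ^ 2 = √(Real.log n) := by
      rw [Real.sqrt_eq_rpow, ← Real.rpow_natCast, ← Real.rpow_mul hlogn]
      norm_num
    rw [mul_pow, h2] at h1
    exact h1
  refine (measureReal_mono hsub).trans ?_
  set E : Set Ω := {ω | y ^ 2 ≤ f ω} with hE
  have hb1 : μ.real E ≤ √(Real.log n) / y ^ 2 := by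
    rw [le_div_iff₀ hy2, mul_comm]
    refine (mul_meas_ge_le_integral_of_nonneg (.of_forall hf0) hfi (y ^ 2)).trans ?_
    simp only [hf]
    rw [integral_const_mul, integral_norm_chaosCoeff_sq hG hI hm]
    exact mul_le_of_le_one_right (Real.sqrt_nonneg _) (varCoeff_le_one _ _)
  have hb2 : μ.real E ≤ (2 * C₁ + 5 * C₂) * Real.log y / y ^ 2 := by
    set A : Set Ω := {ω | (fun k => N k ω) ∈ goodSet y J} with hA
    have hAm : MeasurableSet A := hmN (measurableSet_goodSet y J)
    have h1 : μ.real E ≤ μ.real (E ∩ A) + μ.real Aᶜ := by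
      refine (measureReal_mono (fun ω hω => ?_)).trans (measureReal_union_le _ _)
      by_cases h : ω ∈ A
      · exact Or.inl ⟨hω, h⟩
      · exact Or.inr h
    have h2 : μ.real Aᶜ ≤ C₁ / y ^ 2 := hC₁ hG hI hm y (by linarith) J
    have h3 : μ.real (E ∩ A) ≤ C₂ * (2 + Real.log y) / y ^ 2 := by
      rw [le_div_iff₀ hy2, mul_comm, ← measureReal_restrict_apply' hAm]
      refine (mul_meas_ge_le_integral_of_nonneg (.of_forall hf0) hfi.integrableOn (y ^ 2)).trans ?_
      simp only [hf]
      rw [integral_const_mul]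
      have h4 := hC₂ hG hI hm (by linarith : 1 ≤ y) hn
      have h5 : √(Real.log n) ≤ √((J : ℝ) + 1) := by
        apply Real.sqrt_le_sqrt
        have h6 : (n : ℝ) ≤ 2 ^ (J + 1) := by exact_mod_cast hn'.le
        have h7 := Real.log_le_log (by linarith) h6
        rw [Real.log_pow] at h7
        push_cast at h7
        nlinarith [Real.log_two_lt_d9, J.cast_nonneg (α := ℝ)]
      calc _ ≤ √((J : ℝ) + 1) * (C₂ * ((2 + Real.log y) / √(J + 1))) :=
            mul_le_mul h5 h4 (integral_nonneg fun ω => sq_nonneg _) (Real.sqrt_nonneg _)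
        _ = _ := by field_simp
    calc μ.real E ≤ C₂ * (2 + Real.log y) / y ^ 2 + C₁ / y ^ 2 := by linarith
      _ = (C₂ * (2 + Real.log y) + C₁) / y ^ 2 := by ring
      _ ≤ _ := by
          gcongr
          nlinarith
  rcases le_total √(Real.log n) (Real.log y) with h | h
  · rw [min_eq_left h]
    refine hb1.trans (le_mul_of_one_le_left (by positivity) (by linarith))
  · rw [min_eq_right h]
    refine hb2.trans ?_
    rw [mul_div_assoc]
    have : 0 ≤ Real.log y / y ^ 2 := div_nonneg (by linarith) hy2.le
    exact mul_le_mul_of_nonneg_right (by linarith) this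

theorem IsStdComplexGaussian.congr {Ω : Type*} [MeasurableSpace Ω] {μ : Measure Ω} {Z Z' : Ω → ℂ}
    (h : IsStdComplexGaussian Z μ) (hZ : Z =ᵐ[μ] Z') : IsStdComplexGaussian Z' μ where
  gaussian := h.gaussian.congr hZ
  mean := by rw [← h.mean]; exact integral_congr_ae hZ.symm
  sq_mean := by
    rw [← h.sq_mean]
    exact integral_congr_ae (hZ.symm.mono fun ω hω => by simp only [hω])
  normSq_mean := by
    rw [← h.normSq_mean]
    exact integral_congr_ae (hZ.symm.mono fun ω hω => by simp only [hω])

end Tail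

theorem mainTheorem8 :
    ∃ C : ℝ, ∀ (Ω : Type*) [MeasurableSpace Ω] (μ : Measure Ω) [IsProbabilityMeasure μ]
      (N : ℕ+ → Ω → ℂ), (∀ k, IsStdComplexGaussian (N k) μ) → iIndepFun N μ →
      ∀ (n : ℕ), 1 ≤ n → ∀ (y : ℝ), 2 ≤ y →
        μ.real {ω | y ≤ (Real.log n) ^ (1 / 4 : ℝ) * ‖hmcCoeff 1 (fun k => N k ω) n‖} ≤
          C * (min (Real.sqrt (Real.log n)) (Real.log y) / y ^ 2) := by
  obtain ⟨C, -, hC⟩ := exists_measure_norm_chaosCoeff_ge_le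
  refine ⟨C, ?_⟩
  intro Ω _ μ _ N hG hI n hn y hy
  have hae : ∀ k, AEMeasurable (N k) μ := fun k => (hG k).gaussian.aemeasurable
  set M : ℕ+ → Ω → ℂ := fun k => (hae k).mk (N k) with hM
  have hMm : ∀ k, Measurable (M k) := fun k => (hae k).measurable_mk
  have hNM : ∀ k, N k =ᵐ[μ] M k := fun k => (hae k).ae_eq_mk
  have hMG : ∀ k, IsStdComplexGaussian (M k) μ := fun k => (hG k).congr (hNM k)
  have hMI : iIndepFun M μ := hI.congr hNM
  have h1 := Nat.pow_log_le_self 2 (Nat.one_le_iff_ne_zero.1 hn)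
  have h2 := Nat.lt_pow_succ_log_self (b := 2) (by norm_num) n
  refine le_trans ?_ (hC hMG hMI hMm hy h1 h2)
  refine ENNReal.toReal_mono (measure_ne_top _ _) (measure_mono_ae ?_)
  filter_upwards [ae_all_iff.2 hNM, ae_summable_norm_mul_pow hMG hMm] with ω hω hs hmem
  have e : (fun k => N k ω) = fun k => M k ω := funext hω
  have hmem' : y ≤ (Real.log n) ^ (1 / 4 : ℝ) * ‖hmcCoeff 1 (fun k => N k ω) n‖ := hmem
  rw [e, hmcCoeff_one_eq hs h2] at hmem'
  exact hmem'
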